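/- **Setting.** Let $d\in\{2,3\}$, let $\Omega\subset\mathbb R^d$ be open and bounded, and $\Omega=\Omega_1\,\dot\cup\,\Gamma\,\dot\cup\,\Omega_2$ with $\Omega_1,\Omega_2$ open, nonempty, disjoint and $\Gamma=\partial\Omega_1\cap\partial\Omega_2$. Let $\gamma_{ij},\gamma_{iI}:\mathbb R^d\times\mathbb R^d\to\mathbb R$ ($i,j=1,2$), let $\bar u,f_1,f_2\in H^2(\Omega)$, and let $\mathcal I\subset\mathbb R^d\setminus\Omega$ be measurable. For disjoint sets $A_1,A_2\subset\Omega$ that decompose $\Omega$ along an interface put $$\gamma_A=\sum_{i,j}\gamma_{ij}\chi_{A_i\times A_j}+\sum_i\gamma_{iI}\chi_{(A_i\times\mathcal I)\cup(\mathcal I\times A_i)},\qquad f_A=f_1\chi_{A_1}+f_2\chi_{A_2};$$ $\nabla\gamma_A$, $\operatorname{Hess}\gamma_A$, $\nabla f_A$, $\operatorname{Hess}f_A$ denote the same expressions with the weak derivatives of the $\gamma_{ij},\gamma_{iI},f_i$ (that is, derivatives are taken piecewise). Write $\gamma_\Gamma,f_\Gamma$ for $A_i=\Omega_i$. Assume that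 $\gamma_\Gamma(x,y)=\varphi(x,y)\chi_{B_\delta(x)}(y)$ for some $\delta>0$, $\varphi\ge 0$, and that $\mathcal I=\{y\notin\Omega:\int_\Omega\gamma_\Gamma(x,y)+\gamma_\Gamma(y,x)\,dx>0\}$. Let $V_c$ be the set of all $u\in L^2(\Omega\cup\mathcal I)$ with $u=0$ a.e. on $\mathcal I$ for which $(u(x)-u(y))(u(x)\gamma_\Gamma(x,y)-u(y)\gamma_\Gamma(y,x))$ is integrable on $(\Omega\cup\mathcal I)^2$. For $k\in\mathbb N$ let $C_0^k$ be the set of vector fields $V$ that are $C^k$ on $\Omega$, whose derivatives up to order $k$ vanish at the boundary (all sets $\{x\in\Omega:|\partial^\alpha V(x)|\ge\varepsilon\}$, $\varepsilon>0$, $|\alpha|\le k$, are compact), extended by $0$ outside $\Omega$. Let $V,W\in C_0^2$, $F_t(x)=x+tW(x)$, and let $T>0$ be so small that $T\|DW(x)\|<1$ for all $x$ (operator norm). Put $\Gamma_t=F_t(\Gamma)$, and let $\gamma_{\Gamma_t},f_{\Gamma_t}$ be $\gamma_A,f_A$ for $A_i=F_t(\Omega_i)$. **Assumption (S1).** One of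 the following holds. * (integrable kernels) $\gamma_{ij}\in W^{2,\infty}(\Omega\times\Omega)$ and $\gamma_{iI}\in W^{2,\infty}((\Omega\times\mathcal I)\cup(\mathcal I\times\Omega))$, where for $\gamma_{iI}$ only weak derivatives with respect to the variable in $\Omega$ are considered. * (singular symmetric kernels) For some $s\in(0,1)$: every $\gamma_{\Gamma_t}$, $t\in[0,T]$, is symmetric, and there are $0<\gamma_*\le\gamma^*$ and $\varepsilon>0$ with $\gamma_\Gamma(x,y)|x-y|^{d+2s}\le\gamma^*$ for $x,y\in\Omega\cup\mathcal I$ and $\gamma_*\le\gamma_\Gamma(x,y)|x-y|^{d+2s}$ for $x,y\in(\Omega\cup\mathcal I)\setminus\Gamma$, not both in $\mathcal I$, $0<|x-y|<\varepsilon$. For all $n\ge1$ the functions $\gamma_{ij}$ and $\gamma_{iI}$ are in $W^{2,\infty}$ (for $\gamma_{iI}$: in the variable in $\Omega$) of the part of $\Omega\times\Omega$, resp. of $(\Omega\times\mathcal I)\cup(\mathcal I\times\Omega)$, where $|x-y|>1/n$. Moreover, for all $\widehat V,\widehat W\in C_0^1$ and with $\widehat V(x,y)=(\widehat V(x),\widehat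 V(y))$, the functions $|\gamma_{ij}|$, $|\nabla\gamma_{ij}^\top\widehat V(x,y)|$, $|\widehat V(x,y)^\top\operatorname{Hess}(\gamma_{ij})\widehat W(x,y)|$ multiplied by $|x-y|^{d+2s}$ are in $L^\infty(\Omega\times\Omega)$, and $|\gamma_{iI}|$, $|\nabla_x\gamma_{iI}^\top\widehat V(x)|$, $|\widehat V(x)^\top\frac{d^2}{dx\,dx}\gamma_{iI}\widehat W(x)|$ multiplied by $|x-y|^{d+2s}$ are in $L^\infty((\Omega\times\mathcal I)\cup(\mathcal I\times\Omega))$. **The Lagrangian.** Let $\Psi^1_{t}=\nabla\gamma_{\Gamma_t}^\top V(x,y)$, $\Psi^2_{t}=\gamma_{\Gamma_t}(x,y)(\operatorname{div}V(x)+\operatorname{div}V(y))$ and, for a kernel $k$, $a_k(u,v)=\frac12\iint_{F_t(\Omega\cup\mathcal I)^2}(v(x)-v(y))(u(x)k(x,y)-u(y)k(y,x))\,dy\,dx$. Put $$\mathfrak J_t(u)=\int_{F_t(\Omega)}-(u-\bar u)\nabla\bar u^\top V+\tfrac12(u-\bar u)^2\operatorname{div}V\,dx,\qquad \mathfrak F_t(v)=\int_{F_t(\Omega)}v\nabla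 f_{\Gamma_t}^\top V+f_{\Gamma_t}v\operatorname{div}V\,dx,$$ $\mathfrak A_t=a_{\Psi^1_t}+a_{\Psi^2_t}$, $A_t=a_{\gamma_{\Gamma_t}}$, $F_t^{\mathrm{lin}}(v)=\int_{F_t(\Omega)}f_{\Gamma_t}v\,dx$, $\widetilde F_t(u,\varphi)=-\int_{F_t(\Omega)}(u-\bar u)\varphi\,dx$, and, with $u_t=u\circ F_t^{-1}$ etc., $$\mathfrak G(t,u,v,\psi,\varphi)=\mathfrak J_t(u_t)-\mathfrak F_t(v_t)+\mathfrak A_t(u_t,v_t)+A_t(u_t,\psi_t)-F_t^{\mathrm{lin}}(\psi_t)+A_t(\varphi_t,v_t)-\widetilde F_t(u_t,\varphi_t).$$ **Lemma.** Under (S1), for all $u,v,\psi,\varphi\in V_c$: for every $t\in[0,T]$ the integrands of all integrals in $\mathfrak G(t,u,v,\psi,\varphi)$ are integrable, and $t\mapsto\mathfrak G(t,u,v,\psi,\varphi)$ is differentiable on $[0,T]$ (one-sided at the end points), i.e. (D1) holds; so are $t\mapsto A_t(u_t,\psi_t)$, $A_t(\varphi_t,v_t)$, $F_t^{\mathrm{lin}}(\psi_t)$.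 Moreover, write $g^t=g\circ F_t$ for $g=\bar u,\nabla\bar u,\operatorname{Hess}\bar u,V,DV,\operatorname{div}V,\nabla\operatorname{div}V$, and $f^t,\nabla f^t,\operatorname{Hess}f^t$ for $f_{\Gamma_t},\nabla f_{\Gamma_t},\operatorname{Hess}f_{\Gamma_t}$ composed with $F_t$; $\xi^t=\det DF_t$, $\dot\xi^t=\frac{d}{dr}|_{r=t}\xi^r$. Then for every $t\in[0,T]$, with integrable integrands, $$\partial_t\widetilde F_t(u_t,\varphi_t)=\int_\Omega(\nabla\bar u^t)^\top W\varphi\,\xi^t-(u-\bar u^t)\varphi\,\dot\xi^t\,dx,$$ $$\begin{aligned}\partial_t\mathfrak J_t(u_t)=\int_\Omega&(\nabla\bar u^t)^\top W(\nabla\bar u^t)^\top V^t\xi^t-(u-\bar u^t)\big((V^t)^\top\operatorname{Hess}(\bar u)^tW\xi^t+(\nabla\bar u^t)^\top DV^tW\xi^t+(\nabla\bar u^t)^\top V^t\dot\xi^t\big)\\&-(u-\bar u^t)(\nabla\bar u^t)^\top W\operatorname{div}V^t\xi^t+\tfrac12(u-\bar u^t)^2\big((\nabla\operatorname{div}V^t)^\top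 W\xi^t+\operatorname{div}V^t\dot\xi^t\big)\,dx,\end{aligned}$$ $$\begin{aligned}\partial_t\mathfrak F_t(v_t)=\int_\Omega&(V^t)^\top\operatorname{Hess}(f^t)Wv\xi^t+(\nabla f^t)^\top DV^tWv\xi^t+(\nabla f^t)^\top V^tv\dot\xi^t\\&+(\nabla f^t)^\top Wv\operatorname{div}V^t\xi^t+f^tv(\nabla\operatorname{div}V^t)^\top W\xi^t+f^tv\operatorname{div}V^t\dot\xi^t\,dx.\end{aligned}$$ Let $\Psi_i^t(x,y)=\Psi^i_t(F_t(x),F_t(y))$ and $\nabla\Psi_i^t(x,y)=(\nabla\Psi^i_t)(F_t(x),F_t(y))$, where, with $D V(x,y)=\operatorname{diag}(DV(x),DV(y))$, $$\nabla\Psi^1_t=\operatorname{Hess}(\gamma_{\Gamma_t})V(x,y)+(\nabla\gamma_{\Gamma_t}^\top DV(x,y))^\top,$$ $$\nabla\Psi^2_t=(\operatorname{div}V(x)+\operatorname{div}V(y))\nabla\gamma_{\Gamma_t}+\gamma_{\Gamma_t}(\nabla\operatorname{div}V(x),\nabla\operatorname{div}V(y)).$$ For integrable kernels, $$\begin{aligned}\partial_t\mathfrak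 A_t(u_t,v_t)=\sum_{i=1}^2\frac12\iint_{(\Omega\cup\mathcal I)^2}&(v(x)-v(y))\big(u(x)\nabla\Psi_i^t(x,y)^\top W(x,y)-u(y)\nabla\Psi_i^t(y,x)^\top W(y,x)\big)\xi^t(x)\xi^t(y)\\&+(v(x)-v(y))\big(u(x)\Psi_i^t(x,y)-u(y)\Psi_i^t(y,x)\big)\tfrac{d}{dr}\big|_{r=t}(\xi^r(x)\xi^r(y))\,dy\,dx,\end{aligned}$$ and for singular symmetric kernels, with $D_n=\{(x,y)\in(\Omega\times\Omega)\cup(\Omega\times\mathcal I)\cup(\mathcal I\times\Omega):|x-y|\ge\frac1n\}$, $$\partial_t\mathfrak A_t(u_t,v_t)=\sum_{i=1}^2\lim_{n\to\infty}\frac12\iint_{D_n}(v(x)-v(y))(u(x)-u(y))\Big(\nabla\Psi_i^t(x,y)^\top W(x,y)\xi^t(x)\xi^t(y)+\Psi_i^t(x,y)\tfrac{d}{dr}\big|_{r=t}(\xi^r(x)\xi^r(y))\Big)dy\,dx,$$ where the integrands are integrable on every $D_n$, $n\ge1$, and both limits exist. -/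

import Mathlib

open Set Filter Topology MeasureTheory
open scoped ENNReal ContDiff

noncomputable section

namespace NonlocalShape

/-- The Euclidean space `ℝ^d`. -/
abbrev Euc (d : ℕ) := EuclideanSpace ℝ (Fin d)

/-! ### Weak derivatives and second order Sobolev spaces -/

/-- A real function together with candidates for its weak gradient and weak Hessian;
`hess z e e'` stands for `∂_e ∂_{e'}`. -/
structure WeakJet (X : Type*) [NormedAddCommGroup X] [NormedSpace ℝ X] where
  val : X → ℝ
  grad : X → X →L[ℝ] ℝ
  hess : X → X →L[ℝ] X →L[ℝ] ℝ

/-- `g` is the weak derivative of `f` on `D` in the direction `e`: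
`∫_D f ∂_e φ = - ∫_D g φ` for all smooth `φ` with compact support in the open set `O`.
For `D = O` this is the usual weak directional derivative on the open set `O`. For `D = Ω × I`,
`O = Ω × ℝ^d` and `e = (e₁, 0)` it is the weak derivative in the first variable on `Ω × I`, which
makes sense for an arbitrary measurable set `I`. -/
def IsWeakDirDeriv {X : Type*} [NormedAddCommGroup X] [NormedSpace ℝ X] [MeasureSpace X]
    (O D : Set X) (e : X) (f g : X → ℝ) : Prop :=
  ∀ φ : X → ℝ, ContDiff ℝ ∞ φ → HasCompactSupport φ → tsupport φ ⊆ O →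
    ∫ z in D, f z * fderiv ℝ φ z e = - ∫ z in D, g z * φ z

/-- `J.val ∈ W^{2,p}(D)`, with weak derivatives `J.grad` and `J.hess`, where only directions in the
subspace `S` are considered. For `D = O` open and `S = ⊤` this is the usual space `W^{2,p}(O)`. -/
structure IsSobolevTwo {X : Type*} [NormedAddCommGroup X] [NormedSpace ℝ X] [MeasureSpace X]
    (p : ℝ≥0∞) (O D : Set X) (S : Submodule ℝ X) (J : WeakJet X) : Prop where
  memLp_val : MemLp J.val p (volume.restrict D)
  memLp_grad : ∀ e ∈ S, MemLp (fun z => J.grad z e) p (volume.restrict D)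
  memLp_hess : ∀ e ∈ S, ∀ e' ∈ S, MemLp (fun z => J.hess z e e') p (volume.restrict D)
  weak_grad : ∀ e ∈ S, IsWeakDirDeriv O D e J.val (fun z => J.grad z e)
  weak_hess : ∀ e ∈ S, ∀ e' ∈ S,
    IsWeakDirDeriv O D e (fun z => J.grad z e') (fun z => J.hess z e e')

variable {d : ℕ}

/-! ### Vector fields and the perturbation of identity -/

/-- `V ∈ C_0^k(Ω, ℝ^d)`, extended by zero: `V` is `C^k` on `Ω`, all sets
`{x ∈ Ω : |D^j V(x)| ≥ ε}` with `j ≤ k`, `ε > 0` are compact, and `V = 0` outside `Ω`. -/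
def IsC0Field (k : ℕ) (Ω : Set (Euc d)) (V : Euc d → Euc d) : Prop :=
  ContDiffOn ℝ k V Ω ∧
  (∀ j : ℕ, j ≤ k → ∀ ε : ℝ, 0 < ε → IsCompact {x | x ∈ Ω ∧ ε ≤ ‖iteratedFDeriv ℝ j V x‖}) ∧
  ∀ x, x ∉ Ω → V x = 0

/-- The perturbation of identity `F_t(x) = x + t W(x)`. -/
def pert (W : Euc d → Euc d) (t : ℝ) (x : Euc d) : Euc d := x + t • W x

/-- `F_t` applied to both components of a pair. -/
def pert2 (W : Euc d → Euc d) (t : ℝ) (z : Euc d × Euc d) : Euc d × Euc d :=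
  (pert W t z.1, pert W t z.2)

/-- The pull-back `u ∘ (F_t)⁻¹`. -/
def pull (W : Euc d → Euc d) (t : ℝ) (u : Euc d → ℝ) : Euc d → ℝ :=
  u ∘ Function.invFun (pert W t)

/-- The divergence of a vector field. -/
def divg (V : Euc d → Euc d) (x : Euc d) : ℝ :=
  LinearMap.trace ℝ (Euc d) (fderiv ℝ V x : Euc d →ₗ[ℝ] Euc d)

/-- `V(x, y) = (V(x), V(y))`. -/
def pairField (V : Euc d → Euc d) (z : Euc d × Euc d) : Euc d × Euc d := (V z.1, V z.2)

/-- `ξ^t(x) = det D F_t(x)`. -/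
def jac (W : Euc d → Euc d) (t : ℝ) (x : Euc d) : ℝ := (fderiv ℝ (pert W t) x).det

/-- `d/dr ξ^r(x)` at `r = t`. -/
def jacDot (W : Euc d → Euc d) (t : ℝ) (x : Euc d) : ℝ := deriv (fun r => jac W r x) t

/-- `ξ^t(x) ξ^t(y)`. -/
def jac2 (W : Euc d → Euc d) (t : ℝ) (z : Euc d × Euc d) : ℝ := jac W t z.1 * jac W t z.2

/-- `d/dr (ξ^r(x) ξ^r(y))` at `r = t`. -/
def jac2Dot (W : Euc d → Euc d) (t : ℝ) (z : Euc d × Euc d) : ℝ :=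
  deriv (fun r => jac2 W r z) t

/-! ### The nonlocal interface problem -/

/-- The data: the domain `Ω`, its two parts `Ω₁, Ω₂`, the nonlocal boundary `I`, the functions
`γ_{ij}`, `γ_{iI}` out of which the kernel is assembled, the tracking data `ū` and the forcing
terms `f₁, f₂` (each with versions of its weak derivatives). -/
structure Setting (d : ℕ) where
  Ω : Set (Euc d)
  part : Fin 2 → Set (Euc d)
  I : Set (Euc d)
  γ : Fin 2 → Fin 2 → WeakJet (Euc d × Euc d)
  γI : Fin 2 → WeakJet (Euc d × Euc d)
  ubar : WeakJet (Euc d)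
  f : Fin 2 → WeakJet (Euc d)

/-- `∑_{i,j} g_{ij} χ_{A_i × A_j} + ∑_i g_{iI} χ_{(A_i × I) ∪ (I × A_i)}`. -/
def glue {M : Type*} [AddCommMonoid M] (A : Fin 2 → Set (Euc d)) (I : Set (Euc d))
    (g : Fin 2 → Fin 2 → Euc d × Euc d → M) (gI : Fin 2 → Euc d × Euc d → M)
    (z : Euc d × Euc d) : M :=
  (∑ i, ∑ j, (A i ×ˢ A j).indicator (g i j) z) +
    ∑ i, ((A i ×ˢ I) ∪ (I ×ˢ A i)).indicator (gI i) z

namespace Setting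

variable (P : Setting d)

/-- The interface `Γ = ∂Ω₁ ∩ ∂Ω₂`. -/
def Γ : Set (Euc d) := frontier (P.part 0) ∩ frontier (P.part 1)

/-- `Ω ∪ I`. -/
def dom : Set (Euc d) := P.Ω ∪ P.I

/-- The decomposition `F_t(Ω₁), F_t(Ω₂)` belonging to the interface `Γ_t = F_t(Γ)`. -/
def moved (W : Euc d → Euc d) (t : ℝ) (i : Fin 2) : Set (Euc d) := pert W t '' P.part i

/-- The kernel of the interface that decomposes `Ω` into `A 0` and `A 1`. -/
def kern (A : Fin 2 → Set (Euc d)) : Euc d × Euc d → ℝ :=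
  glue A P.I (fun i j => (P.γ i j).val) (fun i => (P.γI i).val)

/-- Its gradient, taken piecewise. -/
def kernGrad (A : Fin 2 → Set (Euc d)) : Euc d × Euc d → (Euc d × Euc d) →L[ℝ] ℝ :=
  glue A P.I (fun i j => (P.γ i j).grad) (fun i => (P.γI i).grad)

/-- Its Hessian, taken piecewise. -/
def kernHess (A : Fin 2 → Set (Euc d)) :
    Euc d × Euc d → (Euc d × Euc d) →L[ℝ] (Euc d × Euc d) →L[ℝ] ℝ :=
  glue A P.I (fun i j => (P.γ i j).hess) (fun i => (P.γI i).hess)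

/-- The forcing term `f₁ χ_{A₁} + f₂ χ_{A₂}`. -/
def force (A : Fin 2 → Set (Euc d)) (x : Euc d) : ℝ := ∑ i, (A i).indicator (P.f i).val x

/-- Its gradient, taken piecewise. -/
def forceGrad (A : Fin 2 → Set (Euc d)) (x : Euc d) : Euc d →L[ℝ] ℝ :=
  ∑ i, (A i).indicator (P.f i).grad x

/-- Its Hessian, taken piecewise. -/
def forceHess (A : Fin 2 → Set (Euc d)) (x : Euc d) : Euc d →L[ℝ] Euc d →L[ℝ] ℝ :=
  ∑ i, (A i).indicator (P.f i).hess x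

/-- The standing assumptions on the data. -/
structure Standing : Prop where
  isOpen_Ω : IsOpen P.Ω
  isBounded_Ω : Bornology.IsBounded P.Ω
  isOpen_part : ∀ i, IsOpen (P.part i)
  nonempty_part : ∀ i, (P.part i).Nonempty
  disjoint_part : Disjoint (P.part 0) (P.part 1)
  decomposition : P.Ω = P.part 0 ∪ P.Γ ∪ P.part 1
  /-- The kernel is nonnegative and truncated at a finite interaction radius. -/
  truncated : ∃ δ : ℝ, 0 < δ ∧ ∃ φ : Euc d → Euc d → ℝ, (∀ x y, 0 ≤ φ x y) ∧
    ∀ x y, P.kern P.part (x, y) = (Metric.ball x δ).indicator (φ x) y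
  measurableSet_I : MeasurableSet P.I
  /-- `I` consists of the points outside `Ω` that interact with `Ω`. -/
  interaction : P.I = {y | y ∉ P.Ω ∧
    0 < ∫⁻ x in P.Ω, ENNReal.ofReal (P.kern P.part (x, y) + P.kern P.part (y, x))}
  ubar_sobolev : IsSobolevTwo 2 P.Ω P.Ω ⊤ P.ubar
  f_sobolev : ∀ i, IsSobolevTwo 2 P.Ω P.Ω ⊤ (P.f i)

/-- `(v(x) - v(y)) (u(x) k(x,y) - u(y) k(y,x))`. -/
def nlInt (k : Euc d × Euc d → ℝ) (u v : Euc d → ℝ) (z : Euc d × Euc d) : ℝ :=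
  (v z.1 - v z.2) * (u z.1 * k z - u z.2 * k z.swap)

/-- `u ∈ V_c(Ω ∪ I)`: `u ∈ L²(Ω ∪ I)`, the energy `A(u,u)` is finite, and `u = 0` a.e. on `I`. -/
def MemVc (u : Euc d → ℝ) : Prop :=
  MemLp u 2 (volume.restrict P.dom) ∧
  IntegrableOn (nlInt (P.kern P.part) u u) (P.dom ×ˢ P.dom) ∧
  ∀ᵐ x ∂(volume.restrict P.I), u x = 0

/-! ### The two kernel classes and the assumption (S1) -/

/-- Pairs of points at distance more than `1/n`. -/
def far (n : ℕ) : Set (Euc d × Euc d) := {z | 1 / (n : ℝ) < dist z.1 z.2}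

/-- `D_n`. -/
def D (n : ℕ) : Set (Euc d × Euc d) :=
  {z | z ∈ (P.Ω ×ˢ P.Ω) ∪ ((P.Ω ×ˢ P.I) ∪ (P.I ×ˢ P.Ω)) ∧ 1 / (n : ℝ) ≤ dist z.1 z.2}

/-- The assumption (S1) for integrable kernels: `γ_{ij} ∈ W^{2,∞}(Ω × Ω)` and
`γ_{iI} ∈ W^{2,∞}((Ω × I) ∪ (I × Ω))`. As `I` is fixed, for `γ_{iI}` only the derivatives with
respect to the variable in `Ω` are used. -/
structure S1Integrable : Prop where
  inner : ∀ i j, IsSobolevTwo ∞ (P.Ω ×ˢ P.Ω) (P.Ω ×ˢ P.Ω) ⊤ (P.γ i j)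
  outer_left : ∀ i, IsSobolevTwo ∞ (P.Ω ×ˢ univ) (P.Ω ×ˢ P.I)
    ((⊤ : Submodule ℝ (Euc d)).prod ⊥) (P.γI i)
  outer_right : ∀ i, IsSobolevTwo ∞ (univ ×ˢ P.Ω) (P.I ×ˢ P.Ω)
    ((⊥ : Submodule ℝ (Euc d)).prod ⊤) (P.γI i)

/-- The kernels `γ_{Γ_t}`, `t ∈ [0,T]`, are symmetric, and `γ_Γ` has the singularity
`|x - y|^{-(d+2s)}` on the diagonal. -/
structure IsSingularSymmetric (W : Euc d → Euc d) (T s : ℝ) : Prop where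
  symm : ∀ t ∈ Icc (0 : ℝ) T, ∀ z, P.kern (P.moved W t) z.swap = P.kern (P.moved W t) z
  bounds : ∃ γlo γup ε : ℝ, 0 < γlo ∧ γlo ≤ γup ∧ 0 < ε ∧
    (∀ x ∈ P.dom, ∀ y ∈ P.dom,
      P.kern P.part (x, y) * dist x y ^ ((d : ℝ) + 2 * s) ≤ γup) ∧
    (∀ x ∈ P.dom \ P.Γ, ∀ y ∈ P.dom \ P.Γ, ¬ (x ∈ P.I ∧ y ∈ P.I) →
      0 < dist x y → dist x y < ε →
      γlo ≤ P.kern P.part (x, y) * dist x y ^ ((d : ℝ) + 2 * s))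

/-- `|x - y|^{d+2s} h(x,y) ∈ L^∞(D)`. -/
def WeightedBdd (s : ℝ) (D : Set (Euc d × Euc d)) (h : Euc d × Euc d → ℝ) : Prop :=
  MemLp (fun z => |h z| * dist z.1 z.2 ^ ((d : ℝ) + 2 * s)) ∞ (volume.restrict D)

/-- The assumption (S1) for singular symmetric kernels. -/
structure S1Singular (s : ℝ) : Prop where
  inner : ∀ n : ℕ, 0 < n → ∀ i j,
    IsSobolevTwo ∞ ((P.Ω ×ˢ P.Ω) ∩ far n) ((P.Ω ×ˢ P.Ω) ∩ far n) ⊤ (P.γ i j)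
  outer_left : ∀ n : ℕ, 0 < n → ∀ i,
    IsSobolevTwo ∞ ((P.Ω ×ˢ univ) ∩ far n) ((P.Ω ×ˢ P.I) ∩ far n)
      ((⊤ : Submodule ℝ (Euc d)).prod ⊥) (P.γI i)
  outer_right : ∀ n : ℕ, 0 < n → ∀ i,
    IsSobolevTwo ∞ ((univ ×ˢ P.Ω) ∩ far n) ((P.I ×ˢ P.Ω) ∩ far n)
      ((⊥ : Submodule ℝ (Euc d)).prod ⊤) (P.γI i)
  val_inner : ∀ i j, WeightedBdd s (P.Ω ×ˢ P.Ω) (P.γ i j).val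
  val_outer : ∀ i, WeightedBdd s ((P.Ω ×ˢ P.I) ∪ (P.I ×ˢ P.Ω)) (P.γI i).val
  grad_inner : ∀ V, IsC0Field 1 P.Ω V → ∀ i j,
    WeightedBdd s (P.Ω ×ˢ P.Ω) (fun z => (P.γ i j).grad z (pairField V z))
  grad_outer : ∀ V, IsC0Field 1 P.Ω V → ∀ i,
    WeightedBdd s ((P.Ω ×ˢ P.I) ∪ (P.I ×ˢ P.Ω)) (fun z => (P.γI i).grad z (V z.1, 0))
  hess_inner : ∀ V W, IsC0Field 1 P.Ω V → IsC0Field 1 P.Ω W → ∀ i j,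
    WeightedBdd s (P.Ω ×ˢ P.Ω) (fun z => (P.γ i j).hess z (pairField W z) (pairField V z))
  hess_outer : ∀ V W, IsC0Field 1 P.Ω V → IsC0Field 1 P.Ω W → ∀ i,
    WeightedBdd s ((P.Ω ×ˢ P.I) ∪ (P.I ×ˢ P.Ω))
      (fun z => (P.γI i).hess z (W z.1, 0) (V z.1, 0))

/-! ### The Lagrangian -/

/-- `Ψ¹ = ∇γᵀ V` (index `0`) and `Ψ² = γ (div V(x) + div V(y))` (index `1`), for the interface that
decomposes `Ω` into `A 0` and `A 1`. -/
def Psi (A : Fin 2 → Set (Euc d)) (V : Euc d → Euc d) (i : Fin 2) (z : Euc d × Euc d) : ℝ :=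
  if i = 0 then P.kernGrad A z (pairField V z)
  else P.kern A z * (divg V z.1 + divg V z.2)

/-- `∇Ψⁱ(z)ᵀ w`. -/
def PsiGrad (A : Fin 2 → Set (Euc d)) (V : Euc d → Euc d) (i : Fin 2)
    (z w : Euc d × Euc d) : ℝ :=
  if i = 0 then
    P.kernHess A z w (pairField V z) +
      P.kernGrad A z (fderiv ℝ V z.1 w.1, fderiv ℝ V z.2 w.2)
  else
    (divg V z.1 + divg V z.2) * P.kernGrad A z w +
      P.kern A z * (fderiv ℝ (divg V) z.1 w.1 + fderiv ℝ (divg V) z.2 w.2)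

/-- Integrand of the shape derivative of the objective. -/
def objInt (V : Euc d → Euc d) (u : Euc d → ℝ) (x : Euc d) : ℝ :=
  -(u x - P.ubar.val x) * P.ubar.grad x (V x) + 1 / 2 * (u x - P.ubar.val x) ^ 2 * divg V x

/-- Integrand of the shape derivative of the forcing functional. -/
def forInt (A : Fin 2 → Set (Euc d)) (V : Euc d → Euc d) (v : Euc d → ℝ) (x : Euc d) : ℝ :=
  v x * P.forceGrad A x (V x) + P.force A x * v x * divg V x

variable (V W : Euc d → Euc d) (t : ℝ)

/-- The shape derivative of the objective at `Γ_t`. -/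
def objSD (u : Euc d → ℝ) : ℝ := ∫ x in pert W t '' P.Ω, P.objInt V u x

/-- The shape derivative of the forcing functional at `Γ_t`. -/
def forSD (v : Euc d → ℝ) : ℝ := ∫ x in pert W t '' P.Ω, P.forInt (P.moved W t) V v x

/-- The shape derivative of the bilinear form at `Γ_t`. -/
def opSD (u v : Euc d → ℝ) : ℝ :=
  ∑ i : Fin 2, 1 / 2 * ∫ z in (pert W t '' P.dom) ×ˢ (pert W t '' P.dom),
    nlInt (P.Psi (P.moved W t) V i) u v z

/-- The bilinear form `A_{Γ_t}`. -/
def op (u v : Euc d → ℝ) : ℝ :=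
  1 / 2 * ∫ z in (pert W t '' P.dom) ×ˢ (pert W t '' P.dom), nlInt (P.kern (P.moved W t)) u v z

/-- The linear functional `F_{Γ_t}`. -/
def linF (v : Euc d → ℝ) : ℝ := ∫ x in pert W t '' P.Ω, P.force (P.moved W t) x * v x

/-- The right-hand side `F̃_{Γ_t}(u, φ) = - ∫ (u - ū) φ` of the adjoint equation. -/
def adjF (u φ : Euc d → ℝ) : ℝ := - ∫ x in pert W t '' P.Ω, (u x - P.ubar.val x) * φ x

/-- The Lagrangian `𝔏(t, u, v, ψ, φ)`. -/
def lagr (u v ψ φ : Euc d → ℝ) : ℝ :=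
  P.objSD V W t u - P.forSD V W t v + P.opSD V W t u v + P.op W t u ψ - P.linF W t ψ
    + P.op W t φ v - P.adjF W t u φ

/-- The pulled-back Lagrangian `𝔊(t, u, v, ψ, φ)`. -/
def G (u v ψ φ : Euc d → ℝ) : ℝ :=
  P.lagr V W t (pull W t u) (pull W t v) (pull W t ψ) (pull W t φ)

/-- All the integrals in `𝔏(t, u, v, ψ, φ)` are those of integrable functions. -/
def LagrIntegrable (u v ψ φ : Euc d → ℝ) : Prop :=
  IntegrableOn (P.objInt V u) (pert W t '' P.Ω) ∧
  IntegrableOn (P.forInt (P.moved W t) V v) (pert W t '' P.Ω) ∧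
  (∀ i, IntegrableOn (nlInt (P.Psi (P.moved W t) V i) u v)
    ((pert W t '' P.dom) ×ˢ (pert W t '' P.dom))) ∧
  IntegrableOn (nlInt (P.kern (P.moved W t)) u ψ)
    ((pert W t '' P.dom) ×ˢ (pert W t '' P.dom)) ∧
  IntegrableOn (fun x => P.force (P.moved W t) x * ψ x) (pert W t '' P.Ω) ∧
  IntegrableOn (nlInt (P.kern (P.moved W t)) φ v)
    ((pert W t '' P.dom) ×ˢ (pert W t '' P.dom)) ∧
  IntegrableOn (fun x => (u x - P.ubar.val x) * φ x) (pert W t '' P.Ω)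

/-! ### The integrands of the `t`-derivatives -/

/-- Integrand of `∂_t F̃(t, u, φ)`. -/
def adjDot (u φ : Euc d → ℝ) (x : Euc d) : ℝ :=
  P.ubar.grad (pert W t x) (W x) * φ x * jac W t x
    - (u x - P.ubar.val (pert W t x)) * φ x * jacDot W t x

/-- Integrand of the `t`-derivative of the shape derivative of the objective. -/
def objDot (u : Euc d → ℝ) (x : Euc d) : ℝ :=
  let y := pert W t x
  P.ubar.grad y (W x) * P.ubar.grad y (V y) * jac W t x
    - (u x - P.ubar.val y) *
      (P.ubar.hess y (W x) (V y) * jac W t x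
        + P.ubar.grad y (fderiv ℝ V y (W x)) * jac W t x
        + P.ubar.grad y (V y) * jacDot W t x)
    - (u x - P.ubar.val y) * P.ubar.grad y (W x) * divg V y * jac W t x
    + 1 / 2 * (u x - P.ubar.val y) ^ 2 *
      (fderiv ℝ (divg V) y (W x) * jac W t x + divg V y * jacDot W t x)

/-- Integrand of the `t`-derivative of the shape derivative of the forcing functional. -/
def forDot (v : Euc d → ℝ) (x : Euc d) : ℝ :=
  let y := pert W t x
  let A := P.moved W t
  P.forceHess A y (W x) (V y) * v x * jac W t x
    + P.forceGrad A y (fderiv ℝ V y (W x)) * v x * jac W t x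
    + P.forceGrad A y (V y) * v x * jacDot W t x
    + P.forceGrad A y (W x) * v x * divg V y * jac W t x
    + P.force A y * v x * (fderiv ℝ (divg V) y (W x)) * jac W t x
    + P.force A y * v x * divg V y * jacDot W t x

/-- `Ψ_i^t(z)`. -/
def PsiT (i : Fin 2) (z : Euc d × Euc d) : ℝ := P.Psi (P.moved W t) V i (pert2 W t z)

/-- `∇Ψ_i^t(z)ᵀ W(z)`. -/
def PsiGradT (i : Fin 2) (z : Euc d × Euc d) : ℝ :=
  P.PsiGrad (P.moved W t) V i (pert2 W t z) (pairField W z)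

/-- Integrand of the `t`-derivative of the shape derivative of the bilinear form. -/
def opDot (i : Fin 2) (u v : Euc d → ℝ) (z : Euc d × Euc d) : ℝ :=
  nlInt (P.PsiGradT V W t i) u v z * jac2 W t z + nlInt (P.PsiT V W t i) u v z * jac2Dot W t z

/-- The same integrand in the form used for symmetric kernels. -/
def opDotSymm (i : Fin 2) (u v : Euc d → ℝ) (z : Euc d × Euc d) : ℝ :=
  (v z.1 - v z.2) * (u z.1 - u z.2) * P.PsiGradT V W t i z * jac2 W t z
    + (v z.1 - v z.2) * (u z.1 - u z.2) * P.PsiT V W t i z * jac2Dot W t z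

end Setting

end NonlocalShape

end

/-! Every term of `G` is an integral over a set moved by F_t. Substituting F_t turns it into an
integral over a fixed set, and t then enters only through data composed with F_t and through the
Jacobian. The theorem is thus differentiation under the integral sign for data that have only weak
derivatives.

For a weakly differentiable f there is in general no pointwise derivative of f(F_t z) in t. What
holds is f(F_t z) = f(z) + ∫_0^t ∇f(F_r z)·W(z) dr, for each t and almost every z (`weak_chain`). It
is proved by mollification: the errors vanish in L¹ because F_r pushes Lebesgue measure to measures
of uniformly bounded density. Families obeying such a formula (`ACFamily`) are stable under sums and
products. If the family and its derivative a' are dominated by a family that is continuous in time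
with values in L¹, Fubini writes the integral as a primitive of r ↦ ∫ a'(r), and this function is
continuous (`continuousOn_integral_of_dominated`, `L1Cont.comp_flow`). Hence
`ACFamily.hasDerivWithinAt`. For the single integrals the majorant is a sum of squares of the L²
data.

For the double integrals the kernel and its first two derivatives, multiplied by a weight ρ, must be
bounded uniformly in t (`KernBound`): ρ = 1 for integrable kernels, ρ = |x-y|^{d+2s} for singular
ones. Since ∇γ(F_t z) is paired with W(z), the direction is the field W∘F_t⁻¹ evaluated at F_t z,
which varies with t. For singular kernels the assumptions bound one field at a time; a Baire
category argument makes the bound uniform (`FieldBound.of_forall`). They also say nothing useful on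
I × Ω, where bounds are carried over from Ω × I by symmetry, which passes to weak derivatives
(`IsSobolevTwo.ae_eq_swap`).

The remaining factor is handled separately in the two cases. For integrable kernels (v(x)-v(y))u(x)
is integrable because u, v are in L² of a bounded set. For singular kernels the lower bound on γ_Γ
turns finite energy into integrability of (u(x)-u(y))²/|x-y|^{d+2s} off the interface
(`integrableOn_diffProd`). -/

open Set Filter Topology MeasureTheory
open scoped ENNReal ContDiff

noncomputable section

namespace NonlocalShape

open scoped Convolution
open ContinuousLinearMap (lsmul)

/-! ### Mollification and its convergence in L¹. -/

section Mollifier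

variable {X : Type*} [NormedAddCommGroup X] [NormedSpace ℝ X] [FiniteDimensional ℝ X]
  [MeasureSpace X] [BorelSpace X] [(volume : Measure X).IsAddHaarMeasure]

/-- The convolution of `g` with a normalized bump function. -/
def mollify (φ : ContDiffBump (0 : X)) (g : X → ℝ) : X → ℝ :=
  φ.normed volume ⋆[lsmul ℝ ℝ, volume] g

theorem mollify_eq (φ : ContDiffBump (0 : X)) (g : X → ℝ) (y : X) :
    mollify φ g y = ∫ x, φ.normed volume (y - x) * g x := by
  simp [mollify, convolution_eq_swap]

theorem integrable_mollify (φ : ContDiffBump (0 : X)) {g : X → ℝ} (hg : Integrable g) :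
    Integrable (mollify φ g) :=
  φ.integrable_normed.integrable_convolution _ hg

/-- Young's inequality for a nonnegative kernel of mass one: the absolute value passes inside, and
the integral of a convolution is the product of the integrals. -/
theorem integral_norm_mollify_le (φ : ContDiffBump (0 : X)) {g : X → ℝ} (hg : Integrable g) :
    ∫ x, ‖mollify φ g x‖ ≤ ∫ x, ‖g x‖ := by
  have h1 : ∀ x, ‖mollify φ g x‖ ≤ mollify φ (fun x => ‖g x‖) x := by
    intro x
    rw [mollify_eq, mollify_eq]
    refine (norm_integral_le_integral_norm _).trans_eq ?_
    congr 1 with y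
    rw [norm_mul, Real.norm_of_nonneg (φ.nonneg_normed _)]
  refine (integral_mono (integrable_mollify φ hg).norm (integrable_mollify φ hg.norm) h1).trans_eq ?_
  have := integral_convolution (μ := (volume : Measure X)) (ν := (volume : Measure X)) (lsmul ℝ ℝ)
    φ.integrable_normed hg.norm
  simp only [mollify]
  rw [this, φ.integral_normed]
  simp

theorem mollify_sub (φ : ContDiffBump (0 : X)) {f g : X → ℝ} (hf : LocallyIntegrable f)
    (hg : LocallyIntegrable g) : mollify φ (f - g) = mollify φ f - mollify φ g := by
  have key : ∀ h : X → ℝ, LocallyIntegrable h → ConvolutionExists (φ.normed volume) h (lsmul ℝ ℝ) :=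
    fun h hh => φ.hasCompactSupport_normed.convolutionExists_left _ φ.continuous_normed hh
  have h1 := ConvolutionExists.distrib_add (key f hf) (key (-g) hg.neg)
  ext x
  rw [mollify, sub_eq_add_neg, h1]
  simp only [Pi.add_apply, Pi.sub_apply, mollify, sub_eq_add_neg]
  congr 1
  simp [convolution_def, integral_neg]

/-- Uniform continuity bounds the error pointwise. For bumps of radius below 1 the error lives in
the 1-thickening of the support, a set of finite volume. -/
theorem mollify_tendsto_of_continuous {g : X → ℝ} (hg : Continuous g)
    (hgs : HasCompactSupport g) {ε : ℝ} (hε : 0 < ε) :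
    ∃ δ > 0, ∀ φ : ContDiffBump (0 : X), φ.rOut < δ → ∫ x, ‖mollify φ g x - g x‖ ≤ ε := by
  set K := Metric.cthickening 1 (tsupport g) with hK
  have hKc : IsCompact K := hgs.isCompact.cthickening
  have hKf : volume K < ⊤ := hKc.measure_lt_top
  set v := (volume : Measure X).real K
  have hv : 0 ≤ v := measureReal_nonneg
  obtain ⟨δ, hδ, hu⟩ := Metric.uniformContinuous_iff.1 (hg.uniformContinuous_of_tendsto_cocompact
    hgs.is_zero_at_infty) (ε / (v + 1)) (by positivity)
  refine ⟨min δ 1, by positivity, fun φ hφ => ?_⟩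
  have hb : ∀ x, ‖mollify φ g x - g x‖ ≤ ε / (v + 1) := by
    intro x
    rw [← dist_eq_norm]
    refine φ.dist_normed_convolution_le hg.aestronglyMeasurable fun y hy => (hu ?_).le
    exact (Metric.mem_ball.1 hy).trans (hφ.trans_le (min_le_left _ _))
  have hz : ∀ x, x ∉ K → ‖mollify φ g x - g x‖ = 0 := by
    intro x hx
    have hx0 : ∀ y, dist y x < 1 → g y = 0 := by
      intro y hy
      by_contra h
      exact hx (Metric.mem_cthickening_of_dist_le x y 1 _ (subset_tsupport g h)
        (by rw [dist_comm]; exact hy.le))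
    have : dist (mollify φ g x) (g x) ≤ 0 := by
      refine φ.dist_normed_convolution_le hg.aestronglyMeasurable fun y hy => ?_
      rw [hx0 y ((Metric.mem_ball.1 hy).trans (hφ.trans_le (min_le_right _ _))), hx0 x (by simp)]
      simp
    rw [← dist_eq_norm]
    exact le_antisymm this dist_nonneg
  have h2 : ∫ x, ‖mollify φ g x - g x‖ = ∫ x in K, ‖mollify φ g x - g x‖ := by
    rw [setIntegral_eq_integral_of_forall_compl_eq_zero hz]
  rw [h2]
  have h3 := norm_setIntegral_le_of_norm_le_const (f := fun x => ‖mollify φ g x - g x‖) hKf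
    (C := ε / (v + 1)) (fun x _ => by rw [norm_norm]; exact hb x)
  refine (le_abs_self _).trans (h3.trans ?_)
  change ε / (v + 1) * v ≤ ε
  rw [div_mul_eq_mul_div, div_le_iff₀ (by positivity)]
  nlinarith

/-- Density of compactly supported continuous functions; mollifying the remainder does not increase
its L¹ norm. The bound holds for all small bumps, so that one bump can later serve finitely many
functions at once. -/
theorem mollify_tendsto {g : X → ℝ} (hg : Integrable g) {ε : ℝ} (hε : 0 < ε) :
    ∃ δ > 0, ∀ φ : ContDiffBump (0 : X), φ.rOut < δ → ∫ x, ‖mollify φ g x - g x‖ ≤ ε := by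
  obtain ⟨p, hps, hpg, hpc, hpi⟩ :=
    hg.exists_hasCompactSupport_integral_sub_le (ε := ε / 3) (by positivity)
  obtain ⟨δ, hδ, h⟩ := mollify_tendsto_of_continuous hpc hps (ε := ε / 3) (by positivity)
  refine ⟨δ, hδ, fun φ hφ => ?_⟩
  have hsub := hg.sub hpi
  have h1 : ∀ x, ‖mollify φ g x - g x‖ ≤
      ‖mollify φ (g - p) x‖ + ‖mollify φ p x - p x‖ + ‖g x - p x‖ := by
    intro x
    rw [mollify_sub φ hg.locallyIntegrable hpi.locallyIntegrable]
    simp only [Pi.sub_apply, Real.norm_eq_abs]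
    rcases abs_cases (mollify φ g x - g x) with h | h <;>
    rcases abs_cases (mollify φ g x - mollify φ p x) with h | h <;>
    rcases abs_cases (mollify φ p x - p x) with h | h <;>
    rcases abs_cases (g x - p x) with h | h <;> linarith
  have i1 := (integrable_mollify φ hsub).norm
  have i2 := ((integrable_mollify φ hpi).sub hpi).norm
  refine (integral_mono ((integrable_mollify φ hg).sub hg).norm ((i1.add i2).add hsub.norm)
    h1).trans ?_
  have s1 : ∫ x, (‖mollify φ (g - p) x‖ + ‖(mollify φ p - p) x‖ + ‖(g - p) x‖) = _ :=
    integral_add (i1.add i2) hsub.norm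
  have s2 : ∫ x, (‖mollify φ (g - p) x‖ + ‖(mollify φ p - p) x‖) = _ := integral_add i1 i2
  simp only [Pi.add_apply] at s1 s2 ⊢
  rw [s1, s2]
  have e1 := integral_norm_mollify_le φ hsub
  have e2 := h φ hφ
  simp only [Pi.sub_apply] at e1 e2 ⊢
  linarith

/-- All derivatives fall on the bump, so local integrability of g suffices. The kernel appears at y
- x, ready to be read as a test function of x. -/
theorem hasFDerivAt_mollify (φ : ContDiffBump (0 : X)) {g : X → ℝ} (hg : LocallyIntegrable g)
    (y : X) : ∃ D : X →L[ℝ] ℝ, HasFDerivAt (mollify φ g) D y ∧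
      ∀ e, D e = ∫ x, fderiv ℝ (φ.normed volume) (y - x) e * g x := by
  have h := (φ.hasCompactSupport_normed (μ := (volume : Measure X))).hasFDerivAt_convolution_right (μ := volume) (lsmul ℝ ℝ : ℝ →L[ℝ] ℝ →L[ℝ] ℝ).flip
    hg (φ.contDiff_normed (n := 1) (μ := (volume : Measure X))) y
  rw [convolution_flip] at h
  refine ⟨_, h, fun e => ?_⟩
  rw [convolution_precompR_apply _ hg (φ.hasCompactSupport_normed.fderiv ℝ)
    ((φ.contDiff_normed (n := 1)).continuous_fderiv (by simp)), convolution_def]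
  congr 1 with x

theorem continuous_mollify (φ : ContDiffBump (0 : X)) {g : X → ℝ} (hg : LocallyIntegrable g) :
    Continuous (mollify φ g) :=
  continuous_iff_continuousAt.2 fun y => (hasFDerivAt_mollify φ hg y).choose_spec.1.continuousAt

end Mollifier

end NonlocalShape
end

/-! ### Maps z + r w(z) that distort volume boundedly. -/

open Set Filter Topology MeasureTheory
open scoped ENNReal ContDiff

noncomputable section

namespace NonlocalShape

set_option linter.unusedSectionVars false

section Flow

variable {X : Type*} [NormedAddCommGroup X] [NormedSpace ℝ X] [FiniteDimensional ℝ X]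
  [MeasureSpace X] [BorelSpace X] [(volume : Measure X).IsAddHaarMeasure]

/-- The perturbation of identity `z + r w(z)` on a general space. -/
def flow (w : X → X) (r : ℝ) (z : X) : X := z + r • w z

/-- The maps `z + r w(z)`, `r ∈ [0,T]`, push the volume to measures of bounded density. -/
structure IsQuasiFlow (T : ℝ) (w : X → X) : Prop where
  cont : Continuous w
  bound : ∃ C : NNReal, ∀ r ∈ Icc (0 : ℝ) T,
    Measure.map (flow w r) volume ≤ (C : ℝ≥0∞) • (volume : Measure X)

theorem continuous_flow_uncurry {w : X → X} (hw : Continuous w) :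
    Continuous (fun p : ℝ × X => flow w p.1 p.2) := by
  unfold flow; fun_prop

theorem continuous_flow {w : X → X} (hw : Continuous w) (r : ℝ) : Continuous (flow w r) := by
  unfold flow; fun_prop

theorem continuous_flow_time (w : X → X) (z : X) : Continuous (fun r => flow w r z) := by
  unfold flow; fun_prop

theorem hasDerivAt_flow (w : X → X) (z : X) (r : ℝ) :
    HasDerivAt (fun r => flow w r z) (w z) r := by
  simpa [flow] using ((hasDerivAt_id r).smul_const (w z)).const_add z

theorem flow_zero (w : X → X) (z : X) : flow w 0 z = z := by simp [flow]

variable {T : ℝ} {w : X → X}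

theorem lintegral_flow_le {C : NNReal} {r : ℝ} (hc : Continuous w)
    (hC : Measure.map (flow w r) volume ≤ (C : ℝ≥0∞) • (volume : Measure X))
    {q : X → ℝ≥0∞} (hq : Measurable q) : ∫⁻ z, q (flow w r z) ≤ C * ∫⁻ z, q z := by
  rw [← lintegral_map hq (continuous_flow hc r).measurable]
  exact (lintegral_mono' hC le_rfl).trans_eq (by rw [lintegral_smul_measure]; rfl)

/-- By Tonelli, an L¹ error of a function controls, for most starting points, the error accumulated
along the whole trajectory. -/
theorem lintegral_lintegral_flow_le {C : NNReal} (hc : Continuous w)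
    (hC : ∀ r ∈ Icc (0 : ℝ) T,
      Measure.map (flow w r) volume ≤ (C : ℝ≥0∞) • (volume : Measure X))
    {q : X → ℝ≥0∞} (hq : Measurable q) :
    ∫⁻ z, ∫⁻ r in Ioc 0 T, q (flow w r z) ≤ ENNReal.ofReal T * (C * ∫⁻ z, q z) := by
  rw [lintegral_lintegral_swap]
  · calc ∫⁻ r in Ioc 0 T, ∫⁻ z, q (flow w r z) ≤ ∫⁻ r in Ioc 0 T, (C * ∫⁻ z, q z) :=
          setLIntegral_mono' measurableSet_Ioc fun r hr =>
            lintegral_flow_le hc (hC r ⟨hr.1.le, hr.2⟩) hq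
      _ = _ := by simp [mul_comm]
  · exact (hq.comp (((continuous_flow_uncurry hc).comp continuous_swap).measurable)).aemeasurable

theorem IsQuasiFlow.quasiMeasurePreserving (hw : IsQuasiFlow T w) {r : ℝ} (hr : r ∈ Icc 0 T) :
    Measure.QuasiMeasurePreserving (flow w r) (volume : Measure X) volume := by
  obtain ⟨C, hC⟩ := hw.bound
  refine ⟨(continuous_flow hw.cont r).measurable, ?_⟩
  refine (Measure.absolutelyContinuous_of_le (hC r hr)).trans ?_
  exact Measure.smul_absolutelyContinuous

theorem mollify_tendsto_lintegral {ι : Type*} [Fintype ι] {g : ι → X → ℝ}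
    (hg : ∀ k, Integrable (g k)) {ε : ℝ} (hε : 0 < ε) :
    ∃ δ > 0, ∀ φ : ContDiffBump (0 : X), φ.rOut < δ → ∀ k,
      ∫⁻ x, ‖mollify φ (g k) x - g k x‖ₑ ≤ ENNReal.ofReal ε := by
  choose δ hδ h using fun k => mollify_tendsto (hg k) hε
  obtain ⟨δ', h0, h1⟩ : ∃ δ' > 0, ∀ k, δ' ≤ δ k := by
    have : ∀ᶠ x in 𝓝[>] (0 : ℝ), ∀ k, x ≤ δ k := by
      rw [eventually_all]
      exact fun k => mem_of_superset (Ioc_mem_nhdsGT (hδ k)) fun x hx => hx.2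
    obtain ⟨x, hx⟩ := (this.and self_mem_nhdsWithin).exists
    exact ⟨x, hx.2, hx.1⟩
  refine ⟨δ', h0, fun φ hφ k => ?_⟩
  have := ofReal_integral_norm_eq_lintegral_enorm ((integrable_mollify φ (hg k)).sub (hg k))
  simp only [Pi.sub_apply] at this
  rw [← this]
  exact ENNReal.ofReal_le_ofReal (h k φ (hφ.trans_le (h1 k)))

/-- Near the compact set `K`, the mollification of `f` is differentiable in the directions
in which `f` is weakly differentiable. -/
theorem fderiv_mollify_of_weak {O K K' : Set X} (hKO : K' ⊆ O) {δ : ℝ}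
    (hK' : K' = Metric.cthickening δ K) (hK'c : IsCompact K')
    {f g : X → ℝ} {e : X} (hf : IntegrableOn f K')
    (h : ∀ φ : X → ℝ, ContDiff ℝ ∞ φ → HasCompactSupport φ → tsupport φ ⊆ O →
      ∫ z, f z * fderiv ℝ φ z e = - ∫ z, g z * φ z)
    (φ : ContDiffBump (0 : X)) (hφ : φ.rOut < δ) {y : X} (hy : y ∈ K) {D : X →L[ℝ] ℝ}
    (hD : HasFDerivAt (mollify φ (K'.indicator f)) D y) :
    D e = mollify φ (K'.indicator g) y := by
  have hK'm : MeasurableSet K' := hK'c.isClosed.measurableSet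
  have hfi : LocallyIntegrable (K'.indicator f) := (hf.integrable_indicator hK'm).locallyIntegrable
  obtain ⟨D', hD', hDe⟩ := hasFDerivAt_mollify φ hfi y
  rw [hD.unique hD', hDe, mollify_eq]
  -- The reflected bump is an admissible test function: its support lies in a ball of radius below δ
  -- about y ∈ K, hence in K' ⊆ O.
  set η : X → ℝ := fun x => φ.normed volume (y - x) with hη
  have hηc : ContDiff ℝ ∞ η := φ.contDiff_normed.comp (contDiff_const.sub contDiff_id)
  have hts : tsupport η ⊆ Metric.closedBall y φ.rOut := by
    refine closure_minimal (fun x hx => ?_) Metric.isClosed_closedBall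
    have : y - x ∈ Function.support (φ.normed (volume : Measure X)) := hx
    rw [φ.support_normed_eq, Metric.mem_ball, dist_zero_right] at this
    rw [Metric.mem_closedBall, dist_comm, dist_eq_norm]
    exact this.le
  have hts' : tsupport η ⊆ K' := hts.trans (by
    rw [hK']
    intro x hx
    exact Metric.mem_cthickening_of_dist_le x y δ K hy ((Metric.mem_closedBall.1 hx).trans hφ.le))
  have hηs : HasCompactSupport η := hK'c.of_isClosed_subset (isClosed_tsupport _) hts'
  -- The sign from the reflection cancels the sign in the definition of the weak derivative.
  have hd : ∀ x, fderiv ℝ η x e = - fderiv ℝ (φ.normed volume) (y - x) e := by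
    intro x
    have h1 : HasFDerivAt (φ.normed (volume : Measure X)) (fderiv ℝ (φ.normed volume) (y - x)) (y - x) :=
      ((φ.contDiff_normed (n := 1)).differentiable (by simp) _).hasFDerivAt
    have h2 : HasFDerivAt (fun x : X => y - x) (-ContinuousLinearMap.id ℝ X) x :=
      (hasFDerivAt_id x).const_sub y
    have h3 : HasFDerivAt η _ x := h1.comp x h2
    rw [h3.fderiv]
    simp
  have h3 := h η hηc hηs (hts'.trans hKO)
  have hz : ∀ x, x ∉ K' → η x = 0 := fun x hx => image_eq_zero_of_notMem_tsupport fun h => hx (hts' h)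
  have hz' : ∀ x, x ∉ K' → fderiv ℝ η x = 0 := fun x hx =>
    image_eq_zero_of_notMem_tsupport fun h => hx (hts' (tsupport_fderiv_subset ℝ h))
  have e1 : ∀ x, fderiv ℝ (φ.normed volume) (y - x) e * K'.indicator f x =
      - (f x * fderiv ℝ η x e) := by
    intro x
    by_cases hx : x ∈ K'
    · rw [indicator_of_mem hx, hd]; ring
    · rw [indicator_of_notMem hx, hz' x hx]; simp
  have e2 : ∀ x, φ.normed volume (y - x) * K'.indicator g x = g x * η x := by
    intro x
    by_cases hx : x ∈ K'
    · rw [indicator_of_mem hx]; ring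
    · rw [indicator_of_notMem hx, hz x hx]; simp
  simp_rw [e1, e2, integral_neg, h3, neg_neg]

theorem integrable_comp_flow_ae (hw : IsQuasiFlow T w) {g : X → ℝ} (hgm : Measurable g)
    (hg : Integrable g) : ∀ᵐ z, IntegrableOn (fun r => g (flow w r z)) (Ioc 0 T) := by
  obtain ⟨C, hC⟩ := hw.bound
  have h1 := lintegral_lintegral_flow_le hw.cont hC (q := fun z => ‖g z‖ₑ) hgm.enorm
  have hm : Measurable fun p : X × ℝ => g (flow w p.2 p.1) :=
    hgm.comp (((continuous_flow_uncurry hw.cont).comp continuous_swap).measurable)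
  have h2 : ∫⁻ z, ∫⁻ r in Ioc 0 T, ‖g (flow w r z)‖ₑ ≠ ⊤ := by
    refine (h1.trans_lt ?_).ne
    exact ENNReal.mul_lt_top ENNReal.ofReal_lt_top (ENNReal.mul_lt_top ENNReal.coe_lt_top hg.2)
  filter_upwards [ae_lt_top (Measurable.lintegral_prod_right' hm.enorm) h2] with z hz
  exact ⟨(hm.comp (measurable_prodMk_left)).aestronglyMeasurable, hz⟩

end Flow

end NonlocalShape
end

/-! ### The chain rule for weakly differentiable functions along the flow. -/

open Set Filter Topology MeasureTheory
open scoped ENNReal ContDiff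

noncomputable section

namespace NonlocalShape

set_option linter.unusedSectionVars false

section WeakChain

variable {X : Type*} [NormedAddCommGroup X] [NormedSpace ℝ X] [FiniteDimensional ℝ X]
  [MeasureSpace X] [BorelSpace X] [(volume : Measure X).IsAddHaarMeasure]
variable {T : ℝ} {w : X → X} {ι : Type*} [Fintype ι]

/-- The mollified functions satisfy the chain rule along the flow up to small errors. -/
theorem mollify_chain_error {O K K' : Set X} (hKO : K' ⊆ O) {δ : ℝ}
    (hK' : K' = Metric.cthickening δ K) (hK'c : IsCompact K') {f : X → ℝ} {g : ι → X → ℝ}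
    {e : ι → X} (hf : IntegrableOn f K') (hg : ∀ k, IntegrableOn (g k) K')
    (h : ∀ k, ∀ φ : X → ℝ, ContDiff ℝ ∞ φ → HasCompactSupport φ → tsupport φ ⊆ O →
      ∫ z, f z * fderiv ℝ φ z (e k) = - ∫ z, g k z * φ z)
    (φ : ContDiffBump (0 : X)) (hφ : φ.rOut < δ) {z : X} {c : ι → ℝ} (hz : w z = ∑ k, c k • e k)
    (hzK : ∀ r ∈ Icc (0 : ℝ) T, flow w r z ∈ K) {t : ℝ} (ht : t ∈ Icc 0 T)
    (hi : ∀ k, IntegrableOn (fun r => K'.indicator (g k) (flow w r z)) (Ioc 0 T))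
    {M : NNReal} (hM : ∀ k, ‖c k‖ₑ ≤ M) :
    ‖K'.indicator f (flow w t z) - K'.indicator f z -
        ∫ r in 0..t, ∑ k, c k * K'.indicator (g k) (flow w r z)‖ₑ ≤
      ‖mollify φ (K'.indicator f) (flow w t z) - K'.indicator f (flow w t z)‖ₑ +
      ‖mollify φ (K'.indicator f) z - K'.indicator f z‖ₑ +
      ∑ k, M * ∫⁻ r in Ioc 0 T,
        ‖mollify φ (K'.indicator (g k)) (flow w r z) - K'.indicator (g k) (flow w r z)‖ₑ := by
  have hK'm : MeasurableSet K' := hK'c.isClosed.measurableSet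
  have hfi : LocallyIntegrable (K'.indicator f) := (hf.integrable_indicator hK'm).locallyIntegrable
  have hgi : ∀ k, LocallyIntegrable (K'.indicator (g k)) := fun k =>
    ((hg k).integrable_indicator hK'm).locallyIntegrable
  set F := mollify φ (K'.indicator f) with hF
  set G := fun k => mollify φ (K'.indicator (g k)) with hG
  have hGc : ∀ k, Continuous (fun r => G k (flow w r z)) := fun k =>
    (continuous_mollify φ (hgi k)).comp (continuous_flow_time w z)
  -- The mollified function is smooth enough for the classical chain rule. Since w(z) is a
  -- combination of the e k, only directions in which f is weakly differentiable occur.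
  have hder : ∀ r ∈ uIcc 0 t, HasDerivAt (fun r => F (flow w r z))
      (∑ k, c k * G k (flow w r z)) r := by
    intro r hr
    rw [uIcc_of_le ht.1] at hr
    have hrT : r ∈ Icc (0 : ℝ) T := ⟨hr.1, hr.2.trans ht.2⟩
    obtain ⟨D, hD, -⟩ := hasFDerivAt_mollify φ hfi (flow w r z)
    have h1 := hD.comp_hasDerivAt r (hasDerivAt_flow w z r)
    have h2 : D (w z) = ∑ k, c k * G k (flow w r z) := by
      rw [hz, map_sum]
      refine Finset.sum_congr rfl fun k _ => ?_
      rw [map_smul, smul_eq_mul, fderiv_mollify_of_weak hKO hK' hK'c hf (h k) φ hφ (hzK r hrT) hD]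
    rw [← h2]
    exact h1
  have hcont : Continuous (fun r => ∑ k, c k * G k (flow w r z)) :=
    continuous_finsetSum _ fun k _ => continuous_const.mul (hGc k)
  have hftc := intervalIntegral.integral_eq_sub_of_hasDerivAt hder (hcont.intervalIntegrable _ _)
  rw [flow_zero] at hftc
  have hit : ∀ k, IntervalIntegrable (fun r => K'.indicator (g k) (flow w r z)) volume 0 t :=
    fun k => (intervalIntegrable_iff_integrableOn_Ioc_of_le ht.1).2
      ((hi k).mono_set (Ioc_subset_Ioc_right ht.2))
  -- The mollified functions satisfy the formula exactly; subtracting it leaves the errors at the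
  -- two end points and the errors of the derivatives along the trajectory.
  have hsplit : K'.indicator f (flow w t z) - K'.indicator f z -
        ∫ r in 0..t, ∑ k, c k * K'.indicator (g k) (flow w r z) =
      -(F (flow w t z) - K'.indicator f (flow w t z)) + (F z - K'.indicator f z) +
      ∑ k, c k * ∫ r in 0..t, (G k (flow w r z) - K'.indicator (g k) (flow w r z)) := by
    have e1 : ∑ k, c k * ∫ r in 0..t, (G k (flow w r z) - K'.indicator (g k) (flow w r z)) =
        (∫ r in 0..t, ∑ k, c k * G k (flow w r z)) -
          ∫ r in 0..t, ∑ k, c k * K'.indicator (g k) (flow w r z) := by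
      have s1 : ∫ r in 0..t, ∑ k, c k * G k (flow w r z) =
          ∑ k, ∫ r in 0..t, c k * G k (flow w r z) :=
        intervalIntegral.integral_finsetSum fun k _ =>
          ((hGc k).intervalIntegrable _ _).const_mul (c k)
      have s2 : ∫ r in 0..t, ∑ k, c k * K'.indicator (g k) (flow w r z) =
          ∑ k, ∫ r in 0..t, c k * K'.indicator (g k) (flow w r z) :=
        intervalIntegral.integral_finsetSum fun k _ => (hit k).const_mul (c k)
      rw [s1, s2, ← Finset.sum_sub_distrib]
      refine Finset.sum_congr rfl fun k _ => ?_
      rw [intervalIntegral.integral_sub ((hGc k).intervalIntegrable _ _) (hit k),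
        intervalIntegral.integral_const_mul, intervalIntegral.integral_const_mul]
      ring
    rw [e1, hftc]
    ring
  rw [hsplit]
  refine (enorm_add_le _ _).trans (add_le_add ((enorm_add_le _ _).trans_eq (by rw [enorm_neg])) ?_)
  refine (enorm_sum_le _ _).trans (Finset.sum_le_sum fun k _ => ?_)
  rw [enorm_mul]
  refine mul_le_mul' (hM k) ?_
  rw [intervalIntegral.integral_of_le ht.1]
  exact (enorm_integral_le_lintegral_enorm _).trans
    (lintegral_mono_set (Ioc_subset_Ioc_right ht.2))

theorem measurable_integral_flow {c : ι → X → ℝ} (hw : Continuous w) (hc : ∀ k, Measurable (c k))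
    {g : ι → X → ℝ} (hg : ∀ k, Measurable (g k)) (t : ℝ) :
    Measurable fun z => ∫ r in 0..t, ∑ k, c k z * g k (flow w r z) := by
  have hm : Measurable fun p : X × ℝ => ∑ k, c k p.1 * g k (flow w p.2 p.1) :=
    Finset.measurable_sum _ fun k _ => ((hc k).comp measurable_fst).mul
      ((hg k).comp (((continuous_flow_uncurry hw).comp continuous_swap).measurable))
  simp only [intervalIntegral]
  exact (hm.stronglyMeasurable.integral_prod_right'.measurable).sub
    (hm.stronglyMeasurable.integral_prod_right'.measurable)

/-- The defect of the formula is integrated over U ∩ E. The density bound for the push-forwards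
turns it into L¹ mollification errors of f and of the g k, which are arbitrarily small; so the
defect vanishes almost everywhere. -/
theorem weak_chain_local (hw : IsQuasiFlow T w) {O : Set X} (hO : IsOpen O) {e : ι → X}
    {c : ι → X → ℝ} (hc : ∀ k, Continuous (c k)) {E : Set X} (hE : MeasurableSet E)
    (hwe : ∀ z ∈ E, w z = ∑ k, c k z • e k) {f : X → ℝ} {g : ι → X → ℝ} (hf : Measurable f)
    (hg : ∀ k, Measurable (g k)) (hfi : LocallyIntegrableOn f O)
    (hgi : ∀ k, LocallyIntegrableOn (g k) O)
    (h : ∀ k, ∀ φ : X → ℝ, ContDiff ℝ ∞ φ → HasCompactSupport φ → tsupport φ ⊆ O →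
      ∫ z, f z * fderiv ℝ φ z (e k) = - ∫ z, g k z * φ z)
    {U : Set X} (hU : IsCompact U) (hUO : ∀ z ∈ U, ∀ r ∈ Icc (0 : ℝ) T, flow w r z ∈ O)
    {t : ℝ} (ht : t ∈ Icc 0 T) :
    ∀ᵐ z, z ∈ U → z ∈ E → (∀ k, IntegrableOn (fun r => g k (flow w r z)) (Ioc 0 T)) ∧
      f (flow w t z) = f z + ∫ r in 0..t, ∑ k, c k z * g k (flow w r z) := by
  -- All trajectories from U stay in this compact set. A closed thickening of it still lies in O,
  -- and cutting f and g off there makes them integrable on the whole space.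
  set K : Set X := (fun p : ℝ × X => flow w p.1 p.2) '' (Icc (0 : ℝ) T ×ˢ U) with hK
  have hKc : IsCompact K := (isCompact_Icc.prod hU).image (continuous_flow_uncurry hw.cont)
  have hKO : K ⊆ O := by
    rintro _ ⟨⟨r, z⟩, ⟨hr, hz⟩, rfl⟩
    exact hUO z hz r hr
  obtain ⟨δ, hδ, hδO⟩ := hKc.exists_cthickening_subset_open hO hKO
  set K' := Metric.cthickening δ K with hK'
  have hK'c : IsCompact K' := hKc.cthickening
  have hK'm : MeasurableSet K' := hK'c.isClosed.measurableSet
  have hzK : ∀ z ∈ U, ∀ r ∈ Icc (0 : ℝ) T, flow w r z ∈ K := fun z hz r hr =>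
    ⟨(r, z), ⟨hr, hz⟩, rfl⟩
  have hKK' : K ⊆ K' := Metric.self_subset_cthickening _
  have hfK : IntegrableOn f K' := hfi.integrableOn_compact_subset hδO hK'c
  have hgK : ∀ k, IntegrableOn (g k) K' := fun k => (hgi k).integrableOn_compact_subset hδO hK'c
  have hf' := hfK.integrable_indicator hK'm
  have hg' := fun k => (hgK k).integrable_indicator hK'm
  have hfm : Measurable (K'.indicator f) := hf.indicator hK'm
  have hgm : ∀ k, Measurable (K'.indicator (g k)) := fun k => (hg k).indicator hK'm
  have hint : ∀ᵐ z, ∀ k, IntegrableOn (fun r => K'.indicator (g k) (flow w r z)) (Ioc 0 T) :=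
    ae_all_iff.2 fun k => integrable_comp_flow_ae hw (hgm k) (hg' k)
  obtain ⟨C, hC⟩ := hw.bound
  obtain ⟨M, hM⟩ : ∃ M : NNReal, ∀ z ∈ U, ∀ k, ‖c k z‖ₑ ≤ M := by
    have : ∀ k, ∃ M : NNReal, ∀ z ∈ U, ‖c k z‖ ≤ M := by
      intro k
      obtain ⟨m, hm⟩ := hU.exists_bound_of_continuousOn (hc k).continuousOn
      exact ⟨m.toNNReal, fun z hz => (hm z hz).trans (Real.le_coe_toNNReal m)⟩
    choose M hM using this
    refine ⟨∑ k, M k, fun z hz k => ?_⟩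
    rw [← ofReal_norm, ENNReal.ofReal_le_iff_le_toReal (by simp)]
    refine (hM k z hz).trans ?_
    exact_mod_cast Finset.single_le_sum (f := M) (fun _ _ => zero_le) (Finset.mem_univ k)
  set err : X → ℝ≥0∞ := fun z => ‖K'.indicator f (flow w t z) - K'.indicator f z -
        ∫ r in 0..t, ∑ k, c k z * K'.indicator (g k) (flow w r z)‖ₑ with herr
  have herrm : Measurable err :=
    (((hfm.comp (continuous_flow hw.cont t).measurable).sub hfm).sub
      (measurable_integral_flow hw.cont (fun k => (hc k).measurable) hgm t)).enorm
  have hUE : MeasurableSet (U ∩ E) := hU.isClosed.measurableSet.inter hE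
  have hzero : ∫⁻ z in U ∩ E, err z = 0 := by
    -- C comes from the error at time t, 1 from the error at time 0, and each derivative contributes
    -- its coefficient bound M, the length T and the density bound C.
    set A : ℝ≥0∞ := C + 1 + Fintype.card ι * (M * (ENNReal.ofReal T * C)) with hA
    have hAtop : A ≠ ⊤ := by
      simp [hA, ENNReal.add_eq_top, ENNReal.mul_eq_top]
    have key : ∀ ε : ℝ, 0 < ε → ∫⁻ z in U ∩ E, err z ≤ A * ENNReal.ofReal ε := by
      intro ε hε
      obtain ⟨δ₁, hδ₁, h₁⟩ := mollify_tendsto_lintegral (fun _ : Unit => hf') hε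
      obtain ⟨δ₂, hδ₂, h₂⟩ := mollify_tendsto_lintegral hg' hε
      obtain ⟨a, ha0, ha⟩ : ∃ a : ℝ, 0 < a ∧ a < min δ (min δ₁ δ₂) :=
        exists_between (lt_min hδ (lt_min hδ₁ hδ₂))
      let φ : ContDiffBump (0 : X) := ⟨a / 2, a, by positivity, by linarith⟩
      have e1 := h₁ φ (ha.trans_le ((min_le_right _ _).trans (min_le_left _ _))) ()
      have e2 := h₂ φ (ha.trans_le ((min_le_right _ _).trans (min_le_right _ _)))
      set F : X → ℝ≥0∞ := fun z => ‖mollify φ (K'.indicator f) z - K'.indicator f z‖ₑ with hF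
      set G : ι → X → ℝ≥0∞ :=
        fun k z => ‖mollify φ (K'.indicator (g k)) z - K'.indicator (g k) z‖ₑ with hG
      have hFm : Measurable F :=
        ((continuous_mollify φ hf'.locallyIntegrable).measurable.sub hfm).enorm
      have hGm : ∀ k, Measurable (G k) := fun k =>
        ((continuous_mollify φ (hg' k).locallyIntegrable).measurable.sub (hgm k)).enorm
      have hGm2 : ∀ k, Measurable fun z => ∫⁻ r in Ioc 0 T, G k (flow w r z) := fun k =>
        Measurable.lintegral_prod_right' (f := fun p : X × ℝ => G k (flow w p.2 p.1))
          ((hGm k).comp (((continuous_flow_uncurry hw.cont).comp continuous_swap).measurable))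
      calc ∫⁻ z in U ∩ E, err z
          ≤ ∫⁻ z in U ∩ E, (F (flow w t z) + F z +
              ∑ k, M * ∫⁻ r in Ioc 0 T, G k (flow w r z)) := by
            refine setLIntegral_mono_ae' hUE ?_
            filter_upwards [hint] with z hz hzU
            exact mollify_chain_error hδO hK' hK'c hfK hgK h φ (ha.trans_le (min_le_left _ _))
              (hwe z hzU.2) (hzK z hzU.1) ht hz (hM z hzU.1)
        _ ≤ ∫⁻ z, (F (flow w t z) + F z + ∑ k, M * ∫⁻ r in Ioc 0 T, G k (flow w r z)) :=
            setLIntegral_le_lintegral _ _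
        _ = (∫⁻ z, F (flow w t z)) + (∫⁻ z, F z) +
              ∑ k, M * ∫⁻ z, ∫⁻ r in Ioc 0 T, G k (flow w r z) := by
            rw [lintegral_add_left, lintegral_add_left, lintegral_finsetSum]
            · congr 1
              exact Finset.sum_congr rfl fun k _ => lintegral_const_mul _ (hGm2 k)
            · exact fun k _ => (hGm2 k).const_mul _
            · exact hFm.comp (continuous_flow hw.cont t).measurable
            · exact (hFm.comp (continuous_flow hw.cont t).measurable).add hFm
        _ ≤ C * ENNReal.ofReal ε + ENNReal.ofReal ε +
              ∑ _k : ι, M * (ENNReal.ofReal T * (C * ENNReal.ofReal ε)) := by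
            gcongr with k
            · exact (lintegral_flow_le hw.cont (hC t ht) hFm).trans (by gcongr)
            · exact (lintegral_lintegral_flow_le hw.cont hC (hGm k)).trans
                (by gcongr; exact e2 k)
        _ = A * ENNReal.ofReal ε := by
            rw [Finset.sum_const, nsmul_eq_mul, Finset.card_univ, hA]; ring
    refine le_antisymm (ENNReal.le_of_forall_pos_le_add fun ε hε _ => ?_) bot_le
    rcases eq_or_ne A 0 with h0 | h0
    · exact (key 1 one_pos).trans (by simp [h0])
    · have hA' : 0 < A.toReal := ENNReal.toReal_pos h0 hAtop
      refine (key (ε / A.toReal) (by positivity)).trans ?_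
      rw [ENNReal.ofReal_div_of_pos hA', ENNReal.ofReal_toReal hAtop,
        ENNReal.mul_div_cancel h0 hAtop]
      simp
  rw [lintegral_eq_zero_iff herrm] at hzero
  have hz2 := (ae_restrict_iff' hUE).1 hzero
  filter_upwards [hz2, hint] with z hz hzi hzU hzE
  have h1 : ∀ r ∈ Icc (0 : ℝ) T, flow w r z ∈ K' := fun r hr => hKK' (hzK z hzU r hr)
  have h2 := hz ⟨hzU, hzE⟩
  have hzK' : z ∈ K' := by simpa [flow_zero] using h1 0 ⟨le_rfl, ht.1.trans ht.2⟩
  refine ⟨fun k => (hzi k).congr_fun (fun r hr => indicator_of_mem (h1 r ⟨hr.1.le, hr.2⟩) _)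
    measurableSet_Ioc, ?_⟩
  simp only [herr, Pi.zero_apply, enorm_eq_zero] at h2
  rw [indicator_of_mem (h1 t ht), indicator_of_mem hzK'] at h2
  have h3 : ∫ r in 0..t, ∑ k, c k z * K'.indicator (g k) (flow w r z) =
      ∫ r in 0..t, ∑ k, c k z * g k (flow w r z) := by
    refine intervalIntegral.integral_congr fun r hr => ?_
    rw [uIcc_of_le ht.1] at hr
    exact Finset.sum_congr rfl fun k _ => by
      rw [indicator_of_mem (h1 r ⟨hr.1, hr.2.trans ht.2⟩)]
  rw [h3] at h2
  linarith

/-- The chain rule for the composition of a weakly differentiable function with the flow. -/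
theorem weak_chain (hw : IsQuasiFlow T w) {O : Set X} (hO : IsOpen O) {e : ι → X}
    {c : ι → X → ℝ} (hc : ∀ k, Continuous (c k)) {E : Set X} (hE : MeasurableSet E)
    (hwe : ∀ z ∈ E, w z = ∑ k, c k z • e k) {f : X → ℝ} {g : ι → X → ℝ} (hf : Measurable f)
    (hg : ∀ k, Measurable (g k)) (hfi : LocallyIntegrableOn f O)
    (hgi : ∀ k, LocallyIntegrableOn (g k) O)
    (h : ∀ k, ∀ φ : X → ℝ, ContDiff ℝ ∞ φ → HasCompactSupport φ → tsupport φ ⊆ O →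
      ∫ z, f z * fderiv ℝ φ z (e k) = - ∫ z, g k z * φ z)
    {t : ℝ} (ht : t ∈ Icc 0 T) :
    ∀ᵐ z, z ∈ E → (∀ r ∈ Icc (0 : ℝ) T, flow w r z ∈ O) →
      (∀ k, IntegrableOn (fun r => g k (flow w r z)) (Ioc 0 T)) ∧
      f (flow w t z) = f z + ∫ r in 0..t, ∑ k, c k z * g k (flow w r z) := by
  rw [ae_iff]
  refine measure_null_of_locally_null _ fun z₀ hz₀ => ?_
  simp only [mem_ofPred_eq, Classical.not_imp] at hz₀
  -- By compactness of the time interval, the starting points whose whole trajectory stays in O form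
  -- an open set; the local result on small closed balls is therefore enough.
  have hnear : ∀ᶠ z in 𝓝 z₀, ∀ r ∈ Icc (0 : ℝ) T, flow w r z ∈ O := by
    refine isCompact_Icc.eventually_forall_of_forall_eventually fun r hr => ?_
    exact ((continuous_flow_uncurry hw.cont).comp continuous_swap).continuousAt.eventually
      (hO.mem_nhds (hz₀.2.1 r hr))
  obtain ⟨ρ, hρ, hball⟩ := Metric.nhds_basis_closedBall.eventually_iff.1 hnear
  have hl := weak_chain_local hw hO hc hE hwe hf hg hfi hgi h (isCompact_closedBall z₀ ρ)
    (fun z hz => hball hz) ht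
  refine ⟨_, inter_mem_nhdsWithin _ (Metric.closedBall_mem_nhds z₀ hρ), ?_⟩
  refine measure_mono_null ?_ (ae_iff.1 hl)
  rintro z ⟨hz, hzb⟩
  simp only [mem_ofPred_eq, Classical.not_imp] at hz ⊢
  exact ⟨hzb, hz.1, hz.2.2⟩

end WeakChain

end NonlocalShape
end

/-! ### Absolutely continuous families and differentiation under the integral. -/

open Set Filter Topology MeasureTheory
open scoped ENNReal ContDiff

noncomputable section

namespace NonlocalShape

set_option linter.unusedSectionVars false

section Families

variable {X : Type*} [MeasurableSpace X] {μ : Measure X} {T : ℝ}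

/-- Sequential continuity in time, almost everywhere along subsequences. -/
def SubseqCont (μ : Measure X) (T : ℝ) (b : ℝ → X → ℝ) : Prop :=
  ∀ (r : ℕ → ℝ) (r₀ : ℝ), r₀ ∈ Icc 0 T → (∀ n, r n ∈ Icc 0 T) → Tendsto r atTop (𝓝 r₀) →
    ∃ φ : ℕ → ℕ, StrictMono φ ∧
      ∀ᵐ z ∂μ, Tendsto (fun n => b (r (φ n)) z) atTop (𝓝 (b r₀ z))

theorem SubseqCont.of_tendsto {b : ℝ → X → ℝ}
    (h : ∀ᵐ z ∂μ, ContinuousOn (fun r => b r z) (Icc 0 T)) : SubseqCont μ T b := by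
  intro r r₀ h₀ hr ht
  refine ⟨id, strictMono_id, ?_⟩
  filter_upwards [h] with z hz
  exact (hz r₀ h₀).tendsto.comp (tendsto_nhdsWithin_iff.2 ⟨ht, Eventually.of_forall hr⟩)

/-- Two successive extractions: the second subsequence is chosen inside the first. -/
theorem SubseqCont.comp₂ {b₁ b₂ : ℝ → X → ℝ} (h₁ : SubseqCont μ T b₁) (h₂ : SubseqCont μ T b₂)
    {F : ℝ × ℝ → ℝ} (hF : Continuous F) : SubseqCont μ T fun r z => F (b₁ r z, b₂ r z) := by
  intro r r₀ h₀ hr ht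
  obtain ⟨φ, hφ, h⟩ := h₁ r r₀ h₀ hr ht
  obtain ⟨φ', hφ', h'⟩ := h₂ (r ∘ φ) r₀ h₀ (fun n => hr _) (ht.comp hφ.tendsto_atTop)
  refine ⟨φ ∘ φ', hφ.comp hφ', ?_⟩
  filter_upwards [h, h'] with z hz hz'
  exact (hF.tendsto _).comp ((hz.comp hφ'.tendsto_atTop).prodMk_nhds hz')

theorem SubseqCont.add {b₁ b₂ : ℝ → X → ℝ} (h₁ : SubseqCont μ T b₁) (h₂ : SubseqCont μ T b₂) :
    SubseqCont μ T fun r z => b₁ r z + b₂ r z := h₁.comp₂ h₂ (F := fun p => p.1 + p.2) (by fun_prop)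

theorem SubseqCont.mul {b₁ b₂ : ℝ → X → ℝ} (h₁ : SubseqCont μ T b₁) (h₂ : SubseqCont μ T b₂) :
    SubseqCont μ T fun r z => b₁ r z * b₂ r z := h₁.comp₂ h₂ (F := fun p => p.1 * p.2) (by fun_prop)

theorem SubseqCont.const (h : X → ℝ) : SubseqCont μ T fun _ z => h z :=
  .of_tendsto (ae_of_all _ fun _ => continuousOn_const)

theorem SubseqCont.sum {ι : Type*} (s : Finset ι) {b : ι → ℝ → X → ℝ}
    (h : ∀ k, SubseqCont μ T (b k)) : SubseqCont μ T fun r z => ∑ k ∈ s, b k r z := by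
  classical
  induction s using Finset.induction_on with
  | empty => simpa using SubseqCont.const (μ := μ) (T := T) (fun _ => 0)
  | insert k s hk ih =>
    simp only [Finset.sum_insert hk]
    exact (h k).add ih

/-- The family `a` is absolutely continuous in time with derivative `a'`, up to null sets. -/
structure ACFamily (μ : Measure X) (T : ℝ) (a a' : ℝ → X → ℝ) : Prop where
  meas : Measurable (Function.uncurry a)
  meas' : Measurable (Function.uncurry a')
  integ : ∀ᵐ z ∂μ, IntegrableOn (fun r => a' r z) (Ioc 0 T)
  -- The exceptional null set may depend on t; `ae_ae_ftc` exchanges the quantifiers at the price of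
  -- exceptional times.
  ftc : ∀ t ∈ Icc 0 T, ∀ᵐ z ∂μ, a t z = a 0 z + ∫ r in 0..t, a' r z
  cont' : SubseqCont μ T a'

namespace ACFamily

variable {a a' b b' : ℝ → X → ℝ}

theorem of_hasDerivAt (hm : Measurable (Function.uncurry a))
    (hm' : Measurable (Function.uncurry a')) (hc : ∀ z, Continuous fun r => a' r z)
    (h : ∀ z r, HasDerivAt (fun r => a r z) (a' r z) r) : ACFamily μ T a a' where
  meas := hm
  meas' := hm'
  integ := ae_of_all _ fun z => ((hc z).integrableOn_Icc).mono_set Ioc_subset_Icc_self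
  ftc := fun t _ => ae_of_all _ fun z => by
    rw [intervalIntegral.integral_eq_sub_of_hasDerivAt (fun r _ => h z r)
      ((hc z).intervalIntegrable _ _)]
    ring
  cont' := .of_tendsto (ae_of_all _ fun z => (hc z).continuousOn)

theorem const {h : X → ℝ} (hh : Measurable h) : ACFamily μ T (fun _ z => h z) (fun _ _ => 0) :=
  of_hasDerivAt (hh.comp measurable_snd) measurable_const (fun _ => continuous_const)
    fun _ _ => hasDerivAt_const _ _

theorem intervalIntegrable (hA : ∀ᵐ z ∂μ, IntegrableOn (fun r => a' r z) (Ioc 0 T)) {t : ℝ}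
    (ht : t ∈ Icc 0 T) : ∀ᵐ z ∂μ, IntervalIntegrable (fun r => a' r z) volume 0 t := by
  filter_upwards [hA] with z hz
  exact (intervalIntegrable_iff_integrableOn_Ioc_of_le ht.1).2
    (hz.mono_set (Ioc_subset_Ioc_right ht.2))

theorem add (hA : ACFamily μ T a a') (hB : ACFamily μ T b b') :
    ACFamily μ T (fun r z => a r z + b r z) (fun r z => a' r z + b' r z) where
  meas := hA.meas.add hB.meas
  meas' := hA.meas'.add hB.meas'
  integ := by
    filter_upwards [hA.integ, hB.integ] with z h1 h2 using h1.add h2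
  ftc := fun t ht => by
    filter_upwards [hA.ftc t ht, hB.ftc t ht, intervalIntegrable hA.integ ht,
      intervalIntegrable hB.integ ht] with z h1 h2 h3 h4
    rw [h1, h2, intervalIntegral.integral_add h3 h4]
    ring
  cont' := hA.cont'.add hB.cont'

theorem sum {ι : Type*} (s : Finset ι) {a a' : ι → ℝ → X → ℝ}
    (h : ∀ k, ACFamily μ T (a k) (a' k)) :
    ACFamily μ T (fun r z => ∑ k ∈ s, a k r z) (fun r z => ∑ k ∈ s, a' k r z) := by
  classical
  induction s using Finset.induction_on with
  | empty => simpa using ACFamily.const (μ := μ) (T := T) (h := fun _ => 0) measurable_const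
  | insert k s hk ih =>
    simp only [Finset.sum_insert hk]
    exact (h k).add ih

/-- A sequence involves only countably many times, so a single null set can be discarded; outside it
the primitive is continuous. -/
theorem subseqCont (hT : 0 ≤ T) (hA : ACFamily μ T a a') : SubseqCont μ T a := by
  intro r r₀ h₀ hr ht
  refine ⟨id, strictMono_id, ?_⟩
  filter_upwards [hA.ftc r₀ h₀, ae_all_iff.2 fun n => hA.ftc (r n) (hr n), hA.integ] with z h1 h2 h3
  simp only [id, h1, h2]
  refine Tendsto.const_add _ ?_
  have hc : ContinuousOn (fun t => ∫ r in 0..t, a' r z) (uIcc 0 T) :=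
    intervalIntegral.continuousOn_primitive_interval' (b₁ := 0) (b₂ := T)
      ((intervalIntegrable_iff_integrableOn_Ioc_of_le hT).2 h3) left_mem_uIcc
  rw [uIcc_of_le hT] at hc
  exact (hc r₀ h₀).tendsto.comp (tendsto_nhdsWithin_iff.2 ⟨ht, Eventually.of_forall hr⟩)

/-- Fubini applied to the set of (t, z) where the formula holds. Joint measurability of the
primitive is seen by writing it as an integral over the fixed interval with the cut-off τ ≤ t. -/
theorem ae_ae_ftc [SFinite μ] (hA : ACFamily μ T a a') :
    ∀ᵐ z ∂μ, ∀ᵐ t ∂(volume.restrict (Ioc 0 T)), a t z = a 0 z + ∫ r in 0..t, a' r z := by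
  have hB : Measurable fun p : X × ℝ =>
      ∫ τ in Ioc 0 T, (if τ ≤ p.2 then a' τ p.1 else 0) := by
    have : Measurable fun q : (X × ℝ) × ℝ => if q.2 ≤ q.1.2 then a' q.2 q.1.1 else 0 :=
      Measurable.ite (measurableSet_le measurable_snd (measurable_snd.comp measurable_fst))
        (hA.meas'.comp (measurable_snd.prodMk (measurable_fst.comp measurable_fst)))
        measurable_const
    exact this.stronglyMeasurable.integral_prod_right'.measurable
  have heq : ∀ t ∈ Ioc (0 : ℝ) T, ∀ z, ∫ r in 0..t, a' r z =
      ∫ τ in Ioc 0 T, (if τ ≤ t then a' τ z else 0) := by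
    intro t ht z
    rw [intervalIntegral.integral_of_le ht.1.le,
      show (fun τ => if τ ≤ t then a' τ z else 0) = (Iic t).indicator (fun τ => a' τ z) from rfl,
      setIntegral_indicator measurableSet_Iic, Ioc_inter_Iic, min_eq_right ht.2]
  have h1 : ∀ᵐ t ∂(volume.restrict (Ioc 0 T)), ∀ᵐ z ∂μ,
      a t z = a 0 z + ∫ τ in Ioc 0 T, (if τ ≤ t then a' τ z else 0) := by
    rw [ae_restrict_iff' measurableSet_Ioc]
    refine ae_of_all _ fun t ht => ?_
    filter_upwards [hA.ftc t ⟨ht.1.le, ht.2⟩] with z hz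
    rw [hz, heq t ht]
  have h2 := (Measure.ae_ae_comm (μ := volume.restrict (Ioc 0 T)) (ν := μ)
    (p := fun t z => a t z = a 0 z + ∫ τ in Ioc 0 T, (if τ ≤ t then a' τ z else 0))
    (measurableSet_eq_fun hA.meas ((hA.meas.comp (measurable_const.prodMk measurable_snd)).add
      (hB.comp measurable_swap)))).1 h1
  filter_upwards [h2] with z hz
  filter_upwards [hz, self_mem_ae_restrict measurableSet_Ioc] with t ht htT
  rw [ht, heq t htT]

/-- For fixed z the functions agree with absolutely continuous primitives A, B only for almost every
time. Integration by parts is done for A and B. They are replaced by a and b under the time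
integral, where almost every time suffices; at the single end time the formula for that time is
used. -/
theorem mul [SFinite μ] (hT : 0 ≤ T) (hA : ACFamily μ T a a') (hB : ACFamily μ T b b') :
    ACFamily μ T (fun r z => a r z * b r z) (fun r z => a' r z * b r z + a r z * b' r z) := by
  have key : ∀ᵐ z ∂μ, ∃ A B : ℝ → ℝ, ContinuousOn A (Icc 0 T) ∧ ContinuousOn B (Icc 0 T) ∧
      (∀ t, A t = a 0 z + ∫ r in 0..t, a' r z) ∧ (∀ t, B t = b 0 z + ∫ r in 0..t, b' r z) ∧
      (∀ᵐ t ∂(volume.restrict (Ioc 0 T)), a t z = A t) ∧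
      (∀ᵐ t ∂(volume.restrict (Ioc 0 T)), b t z = B t) ∧
      ∀ t ∈ Icc 0 T, A t * B t = A 0 * B 0 + ∫ r in 0..t, (a' r z * B r + A r * b' r z) := by
    filter_upwards [hA.ae_ae_ftc, hB.ae_ae_ftc, hA.integ, hB.integ] with z h1 h2 h3 h4
    have i1 := (intervalIntegrable_iff_integrableOn_Ioc_of_le hT).2 h3
    have i2 := (intervalIntegrable_iff_integrableOn_Ioc_of_le hT).2 h4
    have c1 : ContinuousOn (fun t => ∫ r in 0..t, a' r z) (uIcc 0 T) :=
      intervalIntegral.continuousOn_primitive_interval' i1 left_mem_uIcc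
    have c2 : ContinuousOn (fun t => ∫ r in 0..t, b' r z) (uIcc 0 T) :=
      intervalIntegral.continuousOn_primitive_interval' i2 left_mem_uIcc
    rw [uIcc_of_le hT] at c1 c2
    refine ⟨fun t => a 0 z + ∫ r in 0..t, a' r z, fun t => b 0 z + ∫ r in 0..t, b' r z,
      continuousOn_const.add c1, continuousOn_const.add c2, fun _ => rfl, fun _ => rfl, h1, h2, ?_⟩
    intro t ht
    have hsub : uIcc 0 t ⊆ uIcc 0 T := by
      rw [uIcc_of_le hT, uIcc_of_le ht.1]
      exact Icc_subset_Icc_right ht.2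
    have j1 := i1.mono_set hsub
    have j2 := i2.mono_set hsub
    have ac1 : AbsolutelyContinuousOnInterval (fun t => a 0 z + ∫ r in 0..t, a' r z) 0 t :=
      ((LipschitzWith.const (a 0 z)).lipschitzOnWith.absolutelyContinuousOnInterval
        (f := fun _ => a 0 z)).fun_add
        (j1.absolutelyContinuousOnInterval_intervalIntegral left_mem_uIcc)
    have ac2 : AbsolutelyContinuousOnInterval (fun t => b 0 z + ∫ r in 0..t, b' r z) 0 t :=
      ((LipschitzWith.const (b 0 z)).lipschitzOnWith.absolutelyContinuousOnInterval
        (f := fun _ => b 0 z)).fun_add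
        (j2.absolutelyContinuousOnInterval_intervalIntegral left_mem_uIcc)
    have hip := AbsolutelyContinuousOnInterval.integral_deriv_mul_eq_sub ac1 ac2
    have hcongr : ∫ r in 0..t, (a' r z * (b 0 z + ∫ r in 0..r, b' r z) +
          (a 0 z + ∫ r in 0..r, a' r z) * b' r z) =
        ∫ r in 0..t, (deriv (fun t => a 0 z + ∫ r in 0..t, a' r z) r *
          (b 0 z + ∫ r in 0..r, b' r z) + (a 0 z + ∫ r in 0..r, a' r z) *
          deriv (fun t => b 0 z + ∫ r in 0..t, b' r z) r) := by
      refine intervalIntegral.integral_congr_ae ?_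
      filter_upwards [j1.ae_hasDerivAt_integral, j2.ae_hasDerivAt_integral] with r hr1 hr2 hr
      have hr' := uIoc_subset_uIcc hr
      rw [((hr1 hr' 0 left_mem_uIcc).const_add _).deriv, ((hr2 hr' 0 left_mem_uIcc).const_add _).deriv]
    beta_reduce
    rw [hcongr, hip]
    ring
  have hprod : ∀ᵐ z ∂μ, ∀ t ∈ Icc 0 T, (∫ r in 0..t, (a' r z * b r z + a r z * b' r z)) =
      (a 0 z + ∫ r in 0..t, a' r z) * (b 0 z + ∫ r in 0..t, b' r z) - a 0 z * b 0 z := by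
    filter_upwards [key] with z ⟨A, B, _, _, hA0, hB0, hAa, hBb, h⟩ t ht
    have := h t ht
    simp only [hA0 t, hB0 t, hA0 0, hB0 0, intervalIntegral.integral_same, add_zero] at this
    rw [this, add_sub_cancel_left]
    refine intervalIntegral.integral_congr_ae ?_
    rw [ae_restrict_iff' measurableSet_Ioc] at hAa hBb
    filter_upwards [hAa, hBb] with r h1 h2 hr
    rw [uIoc_of_le ht.1] at hr
    have hr' : r ∈ Ioc 0 T := ⟨hr.1, hr.2.trans ht.2⟩
    rw [h1 hr', h2 hr', hA0, hB0]
  exact {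
    meas := hA.meas.mul hB.meas
    meas' := (hA.meas'.mul hB.meas).add (hA.meas.mul hB.meas')
    integ := by
      filter_upwards [key, hA.integ, hB.integ] with z ⟨A, B, cA, cB, _, _, hAa, hBb, _⟩ h1 h2
      have i1 : IntegrableOn (fun r => a' r z * B r) (Ioc 0 T) :=
        (((integrableOn_Icc_iff_integrableOn_Ioc (by simp)).2 h1).mul_continuousOn cB isCompact_Icc).mono_set
          Ioc_subset_Icc_self
      have i2 : IntegrableOn (fun r => A r * b' r z) (Ioc 0 T) :=
        (((integrableOn_Icc_iff_integrableOn_Ioc (by simp)).2 h2).continuousOn_mul cA isCompact_Icc).mono_set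
          Ioc_subset_Icc_self
      refine (i1.add i2).congr ?_
      filter_upwards [hAa, hBb] with r h1 h2
      simp [h1, h2]
    ftc := fun t ht => by
      filter_upwards [hprod, hA.ftc t ht, hB.ftc t ht] with z h1 h2 h3
      rw [h1 t ht, h2, h3]
      ring
    cont' := (hA.cont'.mul (hB.subseqCont hT)).add ((hA.subseqCont hT).mul hB.cont') }

end ACFamily

/-- Continuity in time with values in `L¹`. -/
structure L1Cont (μ : Measure X) (T : ℝ) (D : ℝ → X → ℝ) : Prop where
  integrable : ∀ r ∈ Icc 0 T, Integrable (D r) μ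
  tendsto : ∀ (r : ℕ → ℝ) (r₀ : ℝ), r₀ ∈ Icc 0 T → (∀ n, r n ∈ Icc 0 T) →
    Tendsto r atTop (𝓝 r₀) → Tendsto (fun n => ∫ z, |D (r n) z - D r₀ z| ∂μ) atTop (𝓝 0)

namespace L1Cont

variable {D D' : ℝ → X → ℝ}

theorem const {h : X → ℝ} (hh : Integrable h μ) : L1Cont μ T fun _ => h :=
  ⟨fun _ _ => hh, fun _ _ _ _ _ => by simp⟩

theorem add (h : L1Cont μ T D) (h' : L1Cont μ T D') : L1Cont μ T fun r z => D r z + D' r z where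
  integrable := fun r hr => (h.integrable r hr).add (h'.integrable r hr)
  tendsto := fun r r₀ h₀ hr ht => by
    have h1 := (h.tendsto r r₀ h₀ hr ht).add (h'.tendsto r r₀ h₀ hr ht)
    rw [add_zero] at h1
    refine squeeze_zero (fun n => integral_nonneg fun z => abs_nonneg _) (fun n => ?_) h1
    have i1 := ((h.integrable _ (hr n)).sub (h.integrable _ h₀)).abs
    have i2 := ((h'.integrable _ (hr n)).sub (h'.integrable _ h₀)).abs
    have e := integral_add i1 i2
    simp only [Pi.sub_apply] at e
    rw [← e]
    refine integral_mono (((h.integrable _ (hr n)).add (h'.integrable _ (hr n))).sub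
      ((h.integrable _ h₀).add (h'.integrable _ h₀))).abs (i1.add i2) fun z => ?_
    exact (abs_add_le _ _).trans' (le_of_eq (by ring_nf))

theorem const_mul (c : ℝ) (h : L1Cont μ T D) : L1Cont μ T fun r z => c * D r z where
  integrable := fun r hr => (h.integrable r hr).const_mul c
  tendsto := fun r r₀ h₀ hr ht => by
    have h1 := (h.tendsto r r₀ h₀ hr ht).const_mul |c|
    rw [mul_zero] at h1
    refine h1.congr fun n => ?_
    rw [← integral_const_mul]
    congr 1 with z
    rw [← abs_mul, mul_sub]

theorem sum {ι : Type*} (s : Finset ι) {D : ι → ℝ → X → ℝ} (h : ∀ k, L1Cont μ T (D k)) :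
    L1Cont μ T fun r z => ∑ k ∈ s, D k r z := by
  classical
  induction s using Finset.induction_on with
  | empty => simpa using L1Cont.const (μ := μ) (T := T) (h := fun _ => 0) (integrable_zero _ _ _)
  | insert k s hk ih =>
    simp only [Finset.sum_insert hk]
    exact (h k).add ih

theorem continuousOn_integral (h : L1Cont μ T D) :
    ContinuousOn (fun r => ∫ z, D r z ∂μ) (Icc 0 T) := by
  rw [continuousOn_iff_continuous_domRestrict, continuous_iff_seqContinuous]
  intro r r₀ ht
  have h1 := h.tendsto (fun n => r n) r₀ r₀.2 (fun n => (r n).2)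
    ((continuous_subtype_val.tendsto _).comp ht)
  rw [tendsto_iff_dist_tendsto_zero]
  refine squeeze_zero (fun n => dist_nonneg) (fun n => ?_) h1
  simp only [Function.comp, domRestrict_apply, Real.dist_eq]
  rw [← integral_sub (h.integrable _ (r n).2) (h.integrable _ r₀.2)]
  exact abs_integral_le_integral_abs

end L1Cont

/-- Truncating at the level of a fixed majorant costs no more than the distance of the two
majorants. This trades a moving majorant for a fixed one. -/
theorem clamp_sub_le {x D D₀ : ℝ} (h : |x| ≤ D) (hD₀ : 0 ≤ D₀) :
    |x - max (-D₀) (min D₀ x)| ≤ |D - D₀| := by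
  rcases abs_le.1 h with ⟨h1, h2⟩
  rcases le_total D₀ x with h3 | h3
  · rw [min_eq_left h3, max_eq_right (by linarith), abs_of_nonneg (by linarith)]
    exact (by linarith : x - D₀ ≤ D - D₀).trans (le_abs_self _)
  · rw [min_eq_right h3]
    rcases le_total (-D₀) x with h4 | h4
    · rw [max_eq_right h4]; simp
    · rw [max_eq_left h4, abs_of_nonpos (by linarith)]
      exact (by linarith : -(x - -D₀) ≤ D - D₀).trans (le_abs_self _)

/-- A family dominated by an `L¹`-continuous one has continuous integrals. -/
theorem continuousOn_integral_of_dominated {b D : ℝ → X → ℝ}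
    (hb : ∀ r ∈ Icc 0 T, AEStronglyMeasurable (b r) μ) (hc : SubseqCont μ T b) (hD : L1Cont μ T D)
    (h : ∀ r ∈ Icc 0 T, ∀ᵐ z ∂μ, |b r z| ≤ D r z) :
    ContinuousOn (fun r => ∫ z, b r z ∂μ) (Icc 0 T) := by
  have hbi : ∀ r ∈ Icc 0 T, Integrable (b r) μ := fun r hr =>
    (hD.integrable r hr).mono' (hb r hr) (h r hr)
  rw [continuousOn_iff_continuous_domRestrict, continuous_iff_seqContinuous]
  intro r r₀ ht
  -- Almost everywhere convergence is available only along subsequences, which is enough for the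
  -- convergence of real numbers.
  refine tendsto_of_subseq_tendsto fun ns hns => ?_
  have ht' : Tendsto (fun n => (r (ns n) : ℝ)) atTop (𝓝 r₀) :=
    ((continuous_subtype_val.tendsto _).comp ht).comp hns
  obtain ⟨φ, hφ, hae⟩ := hc (fun n => r (ns n)) r₀ r₀.2 (fun n => (r (ns n)).2) ht'
  refine ⟨φ, ?_⟩
  set s : ℕ → ℝ := fun n => r (ns (φ n)) with hs
  have hsI : ∀ n, s n ∈ Icc 0 T := fun n => (r (ns (φ n))).2
  have hD0 := hD.integrable r₀ r₀.2
  have hnn : ∀ᵐ z ∂μ, 0 ≤ D r₀ z := by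
    filter_upwards [h r₀ r₀.2] with z hz using (abs_nonneg _).trans hz
  -- After truncation at D r₀ ordinary dominated convergence applies; the truncation error is at
  -- most the L¹ distance of D (s n) from D r₀.
  have hcm : ∀ n, AEStronglyMeasurable (fun z => max (-D r₀ z) (min (D r₀ z) (b (s n) z))) μ :=
    fun n => hD0.1.neg.sup (hD0.1.inf (hb _ (hsI n)))
  have hcb : ∀ n, ∀ᵐ z ∂μ, ‖max (-D r₀ z) (min (D r₀ z) (b (s n) z))‖ ≤ D r₀ z := by
    intro n
    filter_upwards [hnn] with z hz
    rw [Real.norm_eq_abs, abs_le]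
    exact ⟨le_max_left _ _, max_le (by linarith) (min_le_left _ _)⟩
  have h1 : Tendsto (fun n => ∫ z, max (-D r₀ z) (min (D r₀ z) (b (s n) z)) ∂μ) atTop
      (𝓝 (∫ z, b r₀ z ∂μ)) := by
    refine tendsto_integral_of_dominated_convergence (D r₀) hcm hD0 hcb ?_
    filter_upwards [hae, h r₀ r₀.2] with z hz hz2
    have : b r₀ z = max (-D r₀ z) (min (D r₀ z) (b r₀ z)) := by
      rcases abs_le.1 hz2 with ⟨h1, h2⟩
      rw [min_eq_right h2, max_eq_right h1]
    rw [this]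
    exact tendsto_const_nhds.max (tendsto_const_nhds.min hz)
  have h2 : Tendsto (fun n => ∫ z, (b (s n) z - max (-D r₀ z) (min (D r₀ z) (b (s n) z))) ∂μ) atTop
      (𝓝 0) := by
    refine squeeze_zero_norm (fun n => ?_) (hD.tendsto s r₀ r₀.2 hsI (ht'.comp hφ.tendsto_atTop))
    refine (norm_integral_le_integral_norm _).trans ?_
    refine integral_mono_ae ((hbi _ (hsI n)).sub (hD0.mono' (hcm n) (hcb n))).norm
      ((hD.integrable _ (hsI n)).sub hD0).abs ?_
    filter_upwards [h _ (hsI n), hnn] with z hz hz2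
    exact clamp_sub_le hz hz2
  have h3 := h1.add h2
  rw [add_zero] at h3
  refine h3.congr fun n => ?_
  rw [integral_sub (hbi _ (hsI n)) (hD0.mono' (hcm n) (hcb n)), add_sub_cancel]
  rfl

/-- Extending B by its end values makes it continuous on the line, so the end points need no
separate treatment. -/
theorem hasDerivWithinAt_primitive_Icc {B : ℝ → ℝ} (hT : 0 ≤ T) (hB : ContinuousOn B (Icc 0 T))
    {t : ℝ} (ht : t ∈ Icc 0 T) :
    HasDerivWithinAt (fun t => ∫ r in 0..t, B r) (B t) (Icc 0 T) t := by
  set B' := IccExtend hT (domRestrict (Icc 0 T) B) with hB'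
  have hc : Continuous B' := (continuousOn_iff_continuous_domRestrict.1 hB).Icc_extend'
  have heq : ∀ r ∈ Icc 0 T, B' r = B r := fun r hr => by
    rw [hB', IccExtend_of_mem _ _ hr]; rfl
  have h1 := (hc.integral_hasStrictDerivAt 0 t).hasDerivAt.hasDerivWithinAt (s := Icc 0 T)
  rw [heq t ht] at h1
  have h2 : ∀ r ∈ Icc 0 T, ∫ x in 0..r, B x = ∫ x in 0..r, B' x := by
    intro r hr
    refine intervalIntegral.integral_congr fun x hx => ?_
    rw [uIcc_of_le hr.1] at hx
    exact (heq x ⟨hx.1, hx.2.trans hr.2⟩).symm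
  exact h1.congr h2 (h2 t ht)

/-- Differentiation under the integral sign for dominated absolutely continuous families. -/
theorem ACFamily.hasDerivWithinAt [SFinite μ] {a a' D : ℝ → X → ℝ} (hT : 0 ≤ T)
    (hA : ACFamily μ T a a') (hD : L1Cont μ T D) (h : ∀ r ∈ Icc 0 T, ∀ᵐ z ∂μ, |a r z| ≤ D r z)
    (h' : ∀ r ∈ Icc 0 T, ∀ᵐ z ∂μ, |a' r z| ≤ D r z) {t : ℝ} (ht : t ∈ Icc 0 T) :
    Integrable (a t) μ ∧ Integrable (a' t) μ ∧
      HasDerivWithinAt (fun t => ∫ z, a t z ∂μ) (∫ z, a' t z ∂μ) (Icc 0 T) t := by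
  have hm : ∀ r, AEStronglyMeasurable (a r) μ := fun r =>
    (hA.meas.comp measurable_prodMk_left).aestronglyMeasurable
  have hm' : ∀ r, AEStronglyMeasurable (a' r) μ := fun r =>
    (hA.meas'.comp measurable_prodMk_left).aestronglyMeasurable
  have hi : ∀ r ∈ Icc 0 T, Integrable (a r) μ := fun r hr =>
    (hD.integrable r hr).mono' (hm r) (h r hr)
  have hi' : ∀ r ∈ Icc 0 T, Integrable (a' r) μ := fun r hr =>
    (hD.integrable r hr).mono' (hm' r) (h' r hr)
  refine ⟨hi t ht, hi' t ht, ?_⟩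
  have hBc := continuousOn_integral_of_dominated (fun r _ => hm' r) hA.cont' hD h'
  -- Fubini's hypothesis: the space integrals of |a'| are bounded by those of D, which are
  -- continuous in time.
  have hint : Integrable (Function.uncurry a') ((volume.restrict (Ioc 0 T)).prod μ) := by
    rw [integrable_prod_iff hA.meas'.aestronglyMeasurable]
    constructor
    · rw [ae_restrict_iff' measurableSet_Ioc]
      exact ae_of_all _ fun r hr => hi' r ⟨hr.1.le, hr.2⟩
    · have hDi : IntegrableOn (fun r => ∫ z, D r z ∂μ) (Ioc 0 T) :=
        (hD.continuousOn_integral.integrableOn_Icc).mono_set Ioc_subset_Icc_self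
      refine hDi.mono' ?_ ?_
      · exact hA.meas'.norm.stronglyMeasurable.integral_prod_right'.aestronglyMeasurable
      · rw [ae_restrict_iff' measurableSet_Ioc]
        refine ae_of_all _ fun r hr => ?_
        have hr' : r ∈ Icc 0 T := ⟨hr.1.le, hr.2⟩
        rw [Real.norm_of_nonneg (integral_nonneg fun _ => norm_nonneg _)]
        exact integral_mono_ae (hi' r hr').norm (hD.integrable r hr') (h' r hr')
  -- Integrating the formula over z and exchanging the integrals leaves the primitive of a
  -- continuous function of time.
  have heq : ∀ s ∈ Icc 0 T, ∫ z, a s z ∂μ = ∫ z, a 0 z ∂μ + ∫ r in 0..s, ∫ z, a' r z ∂μ := by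
    intro s hs
    have hint' : Integrable (Function.uncurry a') ((volume.restrict (Ioc 0 s)).prod μ) :=
      hint.mono_measure (Measure.prod_mono (Measure.restrict_mono_set _
        (Ioc_subset_Ioc_right hs.2)) le_rfl)
    have e1 := integral_add (hi 0 ⟨le_rfl, hT⟩) hint'.integral_prod_right
    simp only [Function.uncurry] at e1
    rw [intervalIntegral.integral_of_le hs.1, integral_integral_swap hint', ← e1]
    refine integral_congr_ae ?_
    filter_upwards [hA.ftc s hs] with z hz
    rw [hz, intervalIntegral.integral_of_le hs.1]
  exact ((hasDerivWithinAt_primitive_Icc hT hBc ht).const_add _).congr heq (heq t ht)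

end Families

end NonlocalShape
end

/-! ### Functions composed with the flow as families in time. -/

open Set Filter Topology MeasureTheory
open scoped ENNReal ContDiff

noncomputable section

namespace NonlocalShape

set_option linter.unusedSectionVars false

section FlowFamilies

variable {X : Type*} [NormedAddCommGroup X] [NormedSpace ℝ X] [FiniteDimensional ℝ X]
  [MeasureSpace X] [BorelSpace X] [(volume : Measure X).IsAddHaarMeasure]
variable {T : ℝ} {w : X → X}

theorem IsQuasiFlow.integrable_comp (hw : IsQuasiFlow T w) {q : X → ℝ} (hqm : Measurable q)
    (hq : Integrable q) {r : ℝ} (hr : r ∈ Icc 0 T) : Integrable fun z => q (flow w r z) := by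
  obtain ⟨C, hC⟩ := hw.bound
  refine ⟨(hqm.comp (continuous_flow hw.cont r).measurable).aestronglyMeasurable, ?_⟩
  refine (lintegral_flow_le hw.cont (hC r hr) hqm.enorm).trans_lt ?_
  exact ENNReal.mul_lt_top ENNReal.coe_lt_top hq.2

/-- For a continuous compactly supported p the compositions converge boundedly on the set E of
finite measure. Replacing q by such a p costs little, uniformly in time, by the density bound. -/
theorem L1Cont.comp_flow (hw : IsQuasiFlow T w) {E : Set X} (hE : volume E ≠ ⊤) {q : X → ℝ}
    (hqm : Measurable q) (hq : Integrable q) :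
    L1Cont (volume.restrict E) T fun r z => q (flow w r z) where
  integrable := fun r hr => (hw.integrable_comp hqm hq hr).integrableOn
  tendsto := fun r r₀ h₀ hr ht => by
    have : IsFiniteMeasure (volume.restrict E) := isFiniteMeasure_restrict.2 hE
    obtain ⟨C, hC⟩ := hw.bound
    rw [Metric.tendsto_atTop]
    intro ε hε
    -- Composition with the flow multiplies the L¹ error by at most C, so this choice leaves ε/3
    -- afterwards.
    obtain ⟨p, hps, hpq, hpc, hpi⟩ :=
      hq.exists_hasCompactSupport_integral_sub_le (ε := ε / (3 * (C + 1))) (by positivity)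
    have hdi := hq.sub hpi
    have hdm : Measurable (q - p) := hqm.sub hpc.measurable
    have hbound : ∀ s ∈ Icc 0 T, ∫ z in E, |q (flow w s z) - p (flow w s z)| ≤ ε / 3 := by
      intro s hs
      have i1 : Integrable fun z => |q (flow w s z) - p (flow w s z)| :=
        (hw.integrable_comp hdm hdi hs).abs
      calc ∫ z in E, |q (flow w s z) - p (flow w s z)|
          ≤ ∫ z, |q (flow w s z) - p (flow w s z)| :=
            setIntegral_le_integral i1 (ae_of_all _ fun z => abs_nonneg _)
        _ ≤ C * ∫ z, ‖q z - p z‖ := by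
            have e1 := integral_norm_eq_lintegral_enorm (hw.integrable_comp hdm hdi hs).1
            have e2 := integral_norm_eq_lintegral_enorm hdi.1
            simp only [Pi.sub_apply, Real.norm_eq_abs] at e1 e2
            simp only [Real.norm_eq_abs]
            rw [e1, e2]
            have := lintegral_flow_le hw.cont (hC s hs) hdm.enorm
            simp only [Pi.sub_apply] at this
            rw [show (C : ℝ) = (C : ℝ≥0∞).toReal by simp, ← ENNReal.toReal_mul]
            exact ENNReal.toReal_mono (ENNReal.mul_lt_top ENNReal.coe_lt_top hdi.2).ne this
        _ ≤ C * (ε / (3 * (C + 1))) := by gcongr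
        _ ≤ ε / 3 := by
            rw [mul_div_assoc', div_le_div_iff₀ (by positivity) (by norm_num)]
            have : (0 : ℝ) ≤ C := C.2
            nlinarith
    obtain ⟨M, hM⟩ := hps.exists_bound_of_continuous hpc
    have hlim : Tendsto (fun n => ∫ z in E, |p (flow w (r n) z) - p (flow w r₀ z)|) atTop (𝓝 0) := by
      have := tendsto_integral_of_dominated_convergence (μ := volume.restrict E)
        (F := fun n z => |p (flow w (r n) z) - p (flow w r₀ z)|) (f := fun _ => 0)
        (fun _ => 2 * M)
        (fun n => ((hpc.comp (continuous_flow hw.cont _)).sub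
          (hpc.comp (continuous_flow hw.cont _))).abs.aestronglyMeasurable)
        (integrable_const _)
        (fun n => ae_of_all _ fun z => by
          rw [Real.norm_eq_abs, abs_abs]
          have h1 := hM (flow w (r n) z)
          have h2 := hM (flow w r₀ z)
          rw [Real.norm_eq_abs] at h1 h2
          exact (abs_sub _ _).trans (by linarith))
        (ae_of_all _ fun z => by
          have h1 : Tendsto (fun n => p (flow w (r n) z)) atTop (𝓝 (p (flow w r₀ z))) :=
            ((hpc.comp (continuous_flow_time w z)).tendsto r₀).comp ht
          simpa using (h1.sub_const (p (flow w r₀ z))).abs)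
      simpa using this
    obtain ⟨N, hN⟩ := Metric.tendsto_atTop.1 hlim (ε / 3) (by positivity)
    refine ⟨N, fun n hn => ?_⟩
    have hn' := hN n hn
    rw [Real.dist_0_eq_abs, abs_of_nonneg (integral_nonneg fun _ => abs_nonneg _)] at hn' ⊢
    have ia : ∀ s ∈ Icc 0 T, IntegrableOn (fun z => |q (flow w s z) - p (flow w s z)|) E :=
      fun s hs => (hw.integrable_comp hdm hdi hs).abs.integrableOn
    have ip : ∀ s ∈ Icc 0 T, IntegrableOn (fun z => p (flow w s z)) E := fun s hs =>
      (hw.integrable_comp hpc.measurable hpi hs).integrableOn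
    have iq : ∀ s ∈ Icc 0 T, IntegrableOn (fun z => q (flow w s z)) E := fun s hs =>
      (hw.integrable_comp hqm hq hs).integrableOn
    have ib : IntegrableOn (fun z => |p (flow w (r n) z) - p (flow w r₀ z)|) E :=
      ((ip _ (hr n)).sub (ip _ h₀)).abs
    calc ∫ z in E, |q (flow w (r n) z) - q (flow w r₀ z)|
        ≤ ∫ z in E, (|q (flow w (r n) z) - p (flow w (r n) z)| +
            |p (flow w (r n) z) - p (flow w r₀ z)| + |q (flow w r₀ z) - p (flow w r₀ z)|) := by
          refine integral_mono ((iq _ (hr n)).sub (iq _ h₀)).abs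
            (((ia _ (hr n)).add ib).add (ia _ h₀)) fun z => ?_
          refine (abs_sub_le _ (p (flow w (r n) z)) _).trans ?_
          rw [add_assoc]
          gcongr
          refine (abs_sub_le _ (p (flow w r₀ z)) _).trans ?_
          rw [abs_sub_comm (p (flow w r₀ z)) (q (flow w r₀ z))]
      _ = (∫ z in E, |q (flow w (r n) z) - p (flow w (r n) z)|) +
            (∫ z in E, |p (flow w (r n) z) - p (flow w r₀ z)|) +
            ∫ z in E, |q (flow w r₀ z) - p (flow w r₀ z)| := by
          have e1 := integral_add ((ia _ (hr n)).add ib) (ia _ h₀)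
          have e2 := integral_add (ia _ (hr n)) ib
          simp only [Pi.add_apply] at e1
          rw [e1, e2]
      _ < ε := by
          have := hbound _ (hr n)
          have := hbound _ h₀
          linarith

/-- No integrability of g is assumed, so arctan ∘ g is used instead, which is integrable on the set
B of finite measure. L¹ continuity gives convergence in measure, hence almost everywhere along a
subsequence, and tan recovers g. -/
theorem SubseqCont.comp_flow (hw : IsQuasiFlow T w) {E B : Set X} (hE : MeasurableSet E)
    (hEf : volume E ≠ ⊤) (hB : MeasurableSet B) (hBf : volume B ≠ ⊤)
    (hEB : ∀ z ∈ E, ∀ r ∈ Icc (0 : ℝ) T, flow w r z ∈ B) {g : X → ℝ} (hg : Measurable g) :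
    SubseqCont (volume.restrict E) T fun r z => g (flow w r z) := by
  set q : X → ℝ := B.indicator fun z => Real.arctan (g z) with hq
  have hqm : Measurable q := (Real.measurable_arctan.comp hg).indicator hB
  have hqi : Integrable q := by
    rw [hq, integrable_indicator_iff hB]
    have : IsFiniteMeasure (volume.restrict B) := isFiniteMeasure_restrict.2 hBf
    refine Integrable.of_bound (Real.measurable_arctan.comp hg).aestronglyMeasurable (Real.pi / 2)
      (ae_of_all _ fun z => ?_)
    rw [Real.norm_eq_abs, abs_le]
    exact ⟨by linarith [Real.neg_pi_div_two_lt_arctan (g z)], (Real.arctan_lt_pi_div_two _).le⟩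
  have hL := L1Cont.comp_flow hw hEf hqm hqi
  intro r r₀ h₀ hr ht
  have h1 : Tendsto (fun n => eLpNorm ((fun z => q (flow w (r n) z)) - fun z => q (flow w r₀ z)) 1
      (volume.restrict E)) atTop (𝓝 0) := by
    have h2 := (ENNReal.continuous_ofReal.tendsto 0).comp (hL.tendsto r r₀ h₀ hr ht)
    rw [ENNReal.ofReal_zero] at h2
    refine h2.congr fun n => ?_
    rw [eLpNorm_one_eq_lintegral_enorm]
    exact ofReal_integral_norm_eq_lintegral_enorm
      ((hL.integrable _ (hr n)).sub (hL.integrable _ h₀))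
  have h2 := tendstoInMeasure_of_tendsto_eLpNorm one_ne_zero
    (fun n => (hL.integrable _ (hr n)).1) (hL.integrable _ h₀).1 h1
  obtain ⟨φ, hφ, hae⟩ := h2.exists_seq_tendsto_ae
  refine ⟨φ, hφ, ?_⟩
  filter_upwards [hae, self_mem_ae_restrict hE] with z hz hzE
  have e : ∀ s ∈ Icc 0 T, q (flow w s z) = Real.arctan (g (flow w s z)) := fun s hs =>
    indicator_of_mem (hEB z hzE s hs) _
  rw [e _ h₀] at hz
  have h3 := (Real.continuousAt_tan.2 (Real.cos_arctan_pos (g (flow w r₀ z))).ne').tendsto.comp hz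
  rw [Real.tan_arctan] at h3
  refine h3.congr fun n => ?_
  simp only [Function.comp]
  rw [e _ (hr _), Real.tan_arctan]

/-- For kernels, weak derivatives exist only away from the diagonal. The sets O n describe this:
each trajectory must stay inside one of them, which may depend on its starting point. -/
theorem ACFamily.of_weak {ι : Type*} [Fintype ι] (hw : IsQuasiFlow T w) (hT : 0 ≤ T)
    {O : ℕ → Set X} (hO : ∀ n, IsOpen (O n)) {E B : Set X} (hE : MeasurableSet E)
    (hEf : volume E ≠ ⊤) (hB : MeasurableSet B) (hBf : volume B ≠ ⊤)
    (hEB : ∀ z ∈ E, ∀ r ∈ Icc (0 : ℝ) T, flow w r z ∈ B)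
    (hEO : ∀ᵐ z, z ∈ E → ∃ n, ∀ r ∈ Icc (0 : ℝ) T, flow w r z ∈ O n)
    {e : ι → X} {c : ι → X → ℝ} (hc : ∀ k, Continuous (c k))
    (hwe : ∀ z ∈ E, w z = ∑ k, c k z • e k) {f : X → ℝ} {g : ι → X → ℝ} (hf : Measurable f)
    (hg : ∀ k, Measurable (g k)) (hfi : ∀ n, LocallyIntegrableOn f (O n))
    (hgi : ∀ n k, LocallyIntegrableOn (g k) (O n))
    (h : ∀ n k, ∀ φ : X → ℝ, ContDiff ℝ ∞ φ → HasCompactSupport φ → tsupport φ ⊆ O n →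
      ∫ z, f z * fderiv ℝ φ z (e k) = - ∫ z, g k z * φ z) :
    ACFamily (volume.restrict E) T (fun r z => f (flow w r z))
      (fun r z => ∑ k, c k z * g k (flow w r z)) := by
  have hfm := (continuous_flow_uncurry hw.cont).measurable
  have hall : ∀ t ∈ Icc 0 T, ∀ᵐ z, z ∈ E →
      (∀ k, IntegrableOn (fun r => g k (flow w r z)) (Ioc 0 T)) ∧
      f (flow w t z) = f z + ∫ r in 0..t, ∑ k, c k z * g k (flow w r z) := by
    intro t ht
    have := ae_all_iff.2 fun n => weak_chain hw (hO n) hc hE hwe hf hg (hfi n) (hgi n) (h n) ht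
    filter_upwards [this, hEO] with z hz hzO hzE
    obtain ⟨n, hn⟩ := hzO hzE
    exact hz n hzE hn
  exact {
    meas := hf.comp hfm
    meas' := Finset.measurable_sum _ fun k _ =>
      ((hc k).measurable.comp measurable_snd).mul ((hg k).comp hfm)
    integ := by
      rw [ae_restrict_iff' hE]
      filter_upwards [hall 0 ⟨le_rfl, hT⟩] with z hz hzE
      exact integrable_finsetSum _ fun k _ => ((hz hzE).1 k).const_mul (c k z)
    ftc := fun t ht => by
      rw [ae_restrict_iff' hE]
      filter_upwards [hall t ht] with z hz hzE
      rw [flow_zero]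
      exact (hz hzE).2
    cont' := SubseqCont.sum _ fun k => (SubseqCont.const _).mul
      (SubseqCont.comp_flow hw hE hEf hB hBf hEB (hg k)) }

end FlowFamilies

/-! ### Coordinates and measurable representatives of Sobolev jets. -/

section Jets

variable {X : Type*} [NormedAddCommGroup X] [NormedSpace ℝ X] [FiniteDimensional ℝ X]

/-- The coordinates are extended from S to the whole space by a left inverse of the inclusion, so
that they are continuous functions of any vector. -/
theorem exists_frame (S : Submodule ℝ X) : ∃ (n : ℕ) (e : Fin n → X) (c : Fin n → X →L[ℝ] ℝ),
    (∀ k, e k ∈ S) ∧ ∀ x ∈ S, x = ∑ k, c k x • e k := by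
  obtain ⟨p, hp⟩ := S.subtype.exists_leftInverse_of_injective (by simp)
  let b := Module.finBasis ℝ S
  refine ⟨Module.finrank ℝ S, fun k => b k,
    fun k => LinearMap.toContinuousLinearMap ((b.coord k).comp p), fun k => (b k).2, fun x hx => ?_⟩
  have h1 : p x = ⟨x, hx⟩ := LinearMap.congr_fun hp ⟨x, hx⟩
  have h2 := congrArg S.subtype (b.sum_repr ⟨x, hx⟩)
  simp only [map_sum, map_smul, Submodule.subtype_apply] at h2
  simp [h1, h2]

variable [MeasureSpace X] [BorelSpace X] [(volume : Measure X).IsAddHaarMeasure]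

/-- A measurable representative, extended by zero, of a function on the sets `D ∩ O n`. -/
structure IsRep (O : ℕ → Set X) (D : Set X) (a f : X → ℝ) : Prop where
  meas : Measurable f
  zero : ∀ z, z ∉ D → f z = 0
  ae : ∀ᵐ z, ∀ n, z ∈ D ∩ O n → f z = a z

/-- The given versions are measurable only up to null sets on each D ∩ O n. One genuine Borel
function for all n makes the composition with the flow jointly measurable in time and space. -/
theorem exists_isRep {O : ℕ → Set X} (hO : ∀ n, IsOpen (O n)) {D : Set X} (hD : MeasurableSet D)
    {a : X → ℝ} (ha : ∀ n, AEStronglyMeasurable a (volume.restrict (D ∩ O n))) :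
    ∃ f, IsRep O D a f := by
  have hm : ∀ n, MeasurableSet (D ∩ O n) := fun n => hD.inter (hO n).measurableSet
  have h1 : AEMeasurable a (volume.restrict (⋃ n, D ∩ O n)) :=
    aemeasurable_iUnion_iff.2 fun n => (ha n).aemeasurable
  refine ⟨(⋃ n, D ∩ O n).indicator (h1.mk a), h1.measurable_mk.indicator (.iUnion hm), ?_, ?_⟩
  · intro z hz
    exact indicator_of_notMem (by simp [hz]) _
  · have h2 := (ae_restrict_iff' (.iUnion hm)).1 h1.ae_eq_mk
    filter_upwards [h2] with z hz n hzn
    have : z ∈ ⋃ n, D ∩ O n := mem_iUnion.2 ⟨n, hzn⟩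
    rw [indicator_of_mem this, ← hz this]

namespace IsRep

variable {O : ℕ → Set X} {D : Set X} {a f : X → ℝ}

theorem memLp (hf : IsRep O D a f) (hO : ∀ n, IsOpen (O n)) (hD : MeasurableSet D) {n : ℕ}
    {p : ℝ≥0∞} (ha : MemLp a p (volume.restrict (D ∩ O n))) : MemLp f p (volume.restrict (O n)) := by
  have hm : MeasurableSet (D ∩ O n) := hD.inter (hO n).measurableSet
  have h1 : MemLp ((D ∩ O n).indicator a) p volume := (memLp_indicator_iff_restrict hm).2 ha
  refine (memLp_congr_ae ?_).1 (h1.restrict (O n))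
  rw [Filter.EventuallyEq, ae_restrict_iff' (hO n).measurableSet]
  filter_upwards [hf.ae] with z hz hzO
  by_cases hzD : z ∈ D
  · rw [indicator_of_mem (show z ∈ D ∩ O n from ⟨hzD, hzO⟩), hz n ⟨hzD, hzO⟩]
  · rw [indicator_of_notMem (fun h => hzD h.1), hf.zero z hzD]

theorem locallyIntegrableOn (hf : IsRep O D a f) (hO : ∀ n, IsOpen (O n)) (hD : MeasurableSet D)
    {n : ℕ} {p : ℝ≥0∞} (hp : 1 ≤ p) (ha : MemLp a p (volume.restrict (D ∩ O n))) :
    LocallyIntegrableOn f (O n) :=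
  locallyIntegrableOn_of_locallyIntegrable_restrict ((hf.memLp hO hD ha).locallyIntegrable hp)

/-- A test function supported in O n does not see f outside O n, and f vanishes off D. Hence a
partial weak derivative on a set like Ω × I, with I only measurable, becomes an ordinary weak
derivative on an open set and can be mollified. -/
theorem weak {b g : X → ℝ} (hf : IsRep O D a f) (hg : IsRep O D b g) (hO : ∀ n, IsOpen (O n))
    (hD : MeasurableSet D) {n : ℕ} {e : X} (h : IsWeakDirDeriv (O n) (D ∩ O n) e a b) (φ : X → ℝ)
    (hφ : ContDiff ℝ ∞ φ) (hφc : HasCompactSupport φ) (hφO : tsupport φ ⊆ O n) :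
    ∫ z, f z * fderiv ℝ φ z e = - ∫ z, g z * φ z := by
  have hm : MeasurableSet (D ∩ O n) := hD.inter (hO n).measurableSet
  have key : ∀ {a f η : X → ℝ}, IsRep O D a f → (∀ z, z ∉ O n → η z = 0) →
      ∫ z, f z * η z = ∫ z in D ∩ O n, a z * η z := by
    intro a f η hf hη
    rw [← setIntegral_eq_integral_of_forall_compl_eq_zero (s := D ∩ O n)]
    · refine setIntegral_congr_ae hm ?_
      filter_upwards [hf.ae] with z hz hzn
      rw [hz n hzn]
    · intro z hz
      by_cases hzD : z ∈ D
      · rw [hη z fun h => hz ⟨hzD, h⟩, mul_zero]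
      · rw [hf.zero z hzD, zero_mul]
  rw [key hf fun z hz => ?_, key hg fun z hz => ?_]
  · exact h φ hφ hφc hφO
  · exact image_eq_zero_of_notMem_tsupport fun h => hz (hφO h)
  · rw [image_eq_zero_of_notMem_tsupport fun h => hz (hφO (tsupport_fderiv_subset ℝ h))]
    rfl

theorem ae_flow {w : X → X} {T : ℝ} (hf : IsRep O D a f) (hw : IsQuasiFlow T w) {E : Set X}
    (hE : MeasurableSet E) (hED : ∀ z ∈ E, ∀ r ∈ Icc (0 : ℝ) T, flow w r z ∈ D)
    (hEO : ∀ᵐ z, z ∈ E → ∃ n, ∀ r ∈ Icc (0 : ℝ) T, flow w r z ∈ O n) {r : ℝ} (hr : r ∈ Icc 0 T) :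
    ∀ᵐ z ∂(volume.restrict E), a (flow w r z) = f (flow w r z) := by
  rw [ae_restrict_iff' hE]
  filter_upwards [(hw.quasiMeasurePreserving hr).ae hf.ae, hEO] with z hz hzO hzE
  obtain ⟨n, hn⟩ := hzO hzE
  exact (hz n ⟨hED z hzE r hr, hn r hr⟩).symm

end IsRep

/-- Measurable coordinates of a second order Sobolev jet along a flow. -/
structure JetFamilies (w : X → X) (T : ℝ) (O : ℕ → Set X) (D E : Set X) (S : Submodule ℝ X)
    (J : WeakJet X) {m : ℕ} (c : Fin m → X →L[ℝ] ℝ) (e : Fin m → X)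
    (f : X → ℝ) (g : Fin m → X → ℝ) (h : Fin m → Fin m → X → ℝ) : Prop where
  rep : IsRep O D J.val f
  rep_grad : ∀ k, IsRep O D (fun z => J.grad z (e k)) (g k)
  rep_hess : ∀ k l, IsRep O D (fun z => J.hess z (e k) (e l)) (h k l)
  val_eq : ∀ r ∈ Icc 0 T, ∀ᵐ z ∂(volume.restrict E), J.val (flow w r z) = f (flow w r z)
  grad_eq : ∀ r ∈ Icc 0 T, ∀ᵐ z ∂(volume.restrict E), ∀ v ∈ S,
    J.grad (flow w r z) v = ∑ k, c k v * g k (flow w r z)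
  hess_eq : ∀ r ∈ Icc 0 T, ∀ᵐ z ∂(volume.restrict E), ∀ v ∈ S, ∀ v' ∈ S,
    J.hess (flow w r z) v v' = ∑ k, ∑ l, c k v * (c l v' * h k l (flow w r z))
  ac : ACFamily (volume.restrict E) T (fun r z => f (flow w r z))
    (fun r z => ∑ k, c k (w z) * g k (flow w r z))
  ac_grad : ∀ l, ACFamily (volume.restrict E) T (fun r z => g l (flow w r z))
    (fun r z => ∑ k, c k (w z) * h k l (flow w r z))

/-- The weak chain rule is used at two levels: for f with derivatives g k, and for each g l with
derivatives h k l. -/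
theorem exists_jetFamilies {w : X → X} {T : ℝ} (hw : IsQuasiFlow T w) (hT : 0 ≤ T)
    {O : ℕ → Set X} (hO : ∀ n, IsOpen (O n)) {D : Set X} (hD : MeasurableSet D)
    {S : Submodule ℝ X} {J : WeakJet X} {p : ℝ≥0∞} (hp : 1 ≤ p)
    (hJ : ∀ n, IsSobolevTwo p (O n) (D ∩ O n) S J)
    {E B : Set X} (hE : MeasurableSet E) (hEf : volume E ≠ ⊤) (hB : MeasurableSet B)
    (hBf : volume B ≠ ⊤) (hEB : ∀ z ∈ E, ∀ r ∈ Icc (0 : ℝ) T, flow w r z ∈ B)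
    (hED : ∀ z ∈ E, ∀ r ∈ Icc (0 : ℝ) T, flow w r z ∈ D)
    (hEO : ∀ᵐ z, z ∈ E → ∃ n, ∀ r ∈ Icc (0 : ℝ) T, flow w r z ∈ O n)
    (hwS : ∀ z ∈ E, w z ∈ S) {m : ℕ} {c : Fin m → X →L[ℝ] ℝ} {e : Fin m → X}
    (he : ∀ k, e k ∈ S) (hce : ∀ x ∈ S, x = ∑ k, c k x • e k) :
    ∃ f g h, JetFamilies w T O D E S J c e f g h := by
  obtain ⟨f, hf⟩ := exists_isRep hO hD fun n => (hJ n).memLp_val.1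
  choose g hg using fun k => exists_isRep hO hD fun n => ((hJ n).memLp_grad (e k) (he k)).1
  choose h hh using fun k l =>
    exists_isRep hO hD fun n => ((hJ n).memLp_hess (e k) (he k) (e l) (he l)).1
  have hwe : ∀ z ∈ E, w z = ∑ k, c k (w z) • e k := fun z hz => hce _ (hwS z hz)
  have hcc : ∀ k, Continuous fun z => c k (w z) := fun k => (c k).continuous.comp hw.cont
  refine ⟨f, g, h, hf, hg, hh, fun r hr => hf.ae_flow hw hE hED hEO hr, ?_, ?_, ?_, ?_⟩
  · intro r hr
    filter_upwards [ae_all_iff.2 fun k => (hg k).ae_flow hw hE hED hEO hr] with z hz v hv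
    conv_lhs => rw [hce v hv]
    rw [map_sum]
    exact Finset.sum_congr rfl fun k _ => by rw [map_smul, smul_eq_mul, hz k]
  · intro r hr
    filter_upwards [ae_all_iff.2 fun k => ae_all_iff.2 fun l =>
      (hh k l).ae_flow hw hE hED hEO hr] with z hz v hv v' hv'
    conv_lhs => rw [hce v hv, hce v' hv']
    rw [map_sum, Finset.sum_comm]
    refine Finset.sum_congr rfl fun l _ => ?_
    rw [map_smul, map_sum, sum_apply, smul_eq_mul, Finset.mul_sum]
    refine Finset.sum_congr rfl fun k _ => ?_
    rw [map_smul, smul_apply, smul_eq_mul, hz k l]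
    ring
  · exact .of_weak hw hT hO hE hEf hB hBf hEB hEO hcc hwe hf.meas (fun k => (hg k).meas)
      (fun n => hf.locallyIntegrableOn hO hD hp (hJ n).memLp_val)
      (fun n k => (hg k).locallyIntegrableOn hO hD hp ((hJ n).memLp_grad _ (he k)))
      (fun n k => hf.weak (hg k) hO hD ((hJ n).weak_grad _ (he k)))
  · intro l
    exact .of_weak hw hT hO hE hEf hB hBf hEB hEO hcc hwe (hg l).meas (fun k => (hh k l).meas)
      (fun n => (hg l).locallyIntegrableOn hO hD hp ((hJ n).memLp_grad _ (he l)))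
      (fun n k => (hh k l).locallyIntegrableOn hO hD hp ((hJ n).memLp_hess _ (he k) _ (he l)))
      (fun n k => (hg l).weak (hh k l) hO hD ((hJ n).weak_hess _ (he k) _ (he l)))

end Jets

end NonlocalShape
end

/-! ### Extension by zero of fields vanishing at the boundary. -/

open Set Filter Topology MeasureTheory
open scoped ENNReal ContDiff

noncomputable section

namespace NonlocalShape

set_option linter.unusedSectionVars false

section ZeroExtension

variable {E F : Type*} [NormedAddCommGroup E] [NormedSpace ℝ E]
  [NormedAddCommGroup F] [NormedSpace ℝ F] {Ω : Set E} {f : E → F}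

theorem continuousAt_of_isCompact_superlevel (h0 : ∀ x, x ∉ Ω → f x = 0)
    (hc : ∀ ε : ℝ, 0 < ε → IsCompact {x | x ∈ Ω ∧ ε ≤ ‖f x‖}) {x : E} (hx : x ∉ Ω) :
    ContinuousAt f x := by
  rw [Metric.continuousAt_iff']
  intro ε hε
  have hK := (hc ε hε).isClosed.isOpen_compl.mem_nhds
    (show x ∈ {x | x ∈ Ω ∧ ε ≤ ‖f x‖}ᶜ from fun h => hx h.1)
  filter_upwards [hK] with y hy
  rw [h0 x hx, dist_zero_right]
  by_cases hyΩ : y ∈ Ω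
  · by_contra h
    exact hy ⟨hyΩ, not_lt.1 h⟩
  · rw [h0 y hyΩ, norm_zero]; exact hε

theorem continuous_of_isCompact_superlevel (hΩ : IsOpen Ω) (hf : ContinuousOn f Ω)
    (h0 : ∀ x, x ∉ Ω → f x = 0)
    (hc : ∀ ε : ℝ, 0 < ε → IsCompact {x | x ∈ Ω ∧ ε ≤ ‖f x‖}) : Continuous f :=
  continuous_iff_continuousAt.2 fun x => by
    by_cases hx : x ∈ Ω
    · exact hf.continuousAt (hΩ.mem_nhds hx)
    · exact continuousAt_of_isCompact_superlevel h0 hc hx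

/-- If the derivative on `Ω` vanishes at the boundary, the extension by zero is differentiable. -/
theorem hasFDerivAt_zero_of_isCompact_superlevel (hΩ : IsOpen Ω) (hf : Continuous f)
    (hd : DifferentiableOn ℝ f Ω) (h0 : ∀ x, x ∉ Ω → f x = 0)
    (hc : ∀ ε : ℝ, 0 < ε → IsCompact {x | x ∈ Ω ∧ ε ≤ ‖fderiv ℝ f x‖}) {x : E} (hx : x ∉ Ω) :
    HasFDerivAt f (0 : E →L[ℝ] F) x := by
  rw [hasFDerivAt_iff_isLittleO, Asymptotics.isLittleO_iff]
  intro ε hε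
  have hK := (hc ε hε).isClosed.isOpen_compl.mem_nhds
    (show x ∈ {x | x ∈ Ω ∧ ε ≤ ‖fderiv ℝ f x‖}ᶜ from fun h => hx h.1)
  obtain ⟨ρ, hρ, hball⟩ := Metric.mem_nhds_iff.1 hK
  filter_upwards [Metric.ball_mem_nhds x hρ] with y hy
  rw [h0 x hx]
  simp only [sub_zero, zero_apply]
  set g : ℝ → E := fun s => y + s • (x - y) with hg
  have hgc : Continuous g := by fun_prop
  have hgd : ∀ s, HasDerivAt g (x - y) s := fun s => by
    have := ((hasDerivAt_id s).smul_const (x - y)).const_add y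
    rw [one_smul] at this
    exact this
  have hgball : ∀ s ∈ Icc (0 : ℝ) 1, g s ∈ Metric.ball x ρ := by
    intro s hs
    have : g s - x = (1 - s) • (y - x) := by simp only [hg]; module
    rw [mem_ball_iff_norm, this, norm_smul, Real.norm_of_nonneg (by linarith [hs.2])]
    have h1 := mem_ball_iff_norm.1 hy
    nlinarith [norm_nonneg (y - x), hs.1]
  -- The segment from y to x is followed up to its first exit from Ω. Before the exit the derivative
  -- is smaller than ε, and at the exit f vanishes, so the mean value inequality bounds f(y).
  set S : Set ℝ := {s | s ∈ Icc (0 : ℝ) 1 ∧ g s ∉ Ω} with hS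
  have hSne : (1 : ℝ) ∈ S := ⟨by simp, by simpa [hg] using hx⟩
  have hSc : IsClosed S := isClosed_Icc.inter (hΩ.isClosed_compl.preimage hgc)
  have hSb : BddBelow S := ⟨0, fun s hs => hs.1.1⟩
  have hs0 : sInf S ∈ S := hSc.csInf_mem ⟨1, hSne⟩ hSb
  set s₀ := sInf S
  have hmem : ∀ s ∈ Ico 0 s₀, g s ∈ Ω := by
    intro s hs
    by_contra h
    exact absurd (csInf_le hSb (show s ∈ S from ⟨⟨hs.1, hs.2.le.trans hs0.1.2⟩, h⟩)) (not_le.2 hs.2)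
  have key := norm_image_sub_le_of_norm_deriv_right_le_segment (f := fun s => f (g s))
    (f' := fun s => fderiv ℝ f (g s) (x - y)) (C := ε * ‖x - y‖) (a := 0) (b := s₀)
    (hf.comp hgc).continuousOn
    (fun s hs => (((hd (g s) (hmem s hs)).differentiableAt
      (hΩ.mem_nhds (hmem s hs))).hasFDerivAt.comp_hasDerivAt s (hgd s)).hasDerivWithinAt)
    (fun s hs => by
      refine (ContinuousLinearMap.le_opNorm _ _).trans ?_
      gcongr
      by_contra h
      exact hball (hgball s ⟨hs.1, hs.2.le.trans hs0.1.2⟩) ⟨hmem s hs, (not_le.1 h).le⟩)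
    s₀ ⟨hs0.1.1, le_rfl⟩
  rw [h0 _ hs0.2] at key
  simp only [hg, zero_smul, add_zero, zero_sub, norm_neg, sub_zero] at key
  refine key.trans ?_
  rw [norm_sub_rev x y]
  have := hs0.1.2
  have h2 : 0 ≤ ε * ‖y - x‖ := by positivity
  nlinarith

theorem exists_bound_of_vanishing [FiniteDimensional ℝ E] (hb : Bornology.IsBounded Ω)
    (hf : Continuous f) (h0 : ∀ x, x ∉ Ω → f x = 0) : ∃ M : ℝ, 0 ≤ M ∧ ∀ x, ‖f x‖ ≤ M := by
  obtain ⟨M, hM⟩ := (hb.isCompact_closure).exists_bound_of_continuousOn hf.continuousOn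
  refine ⟨max M 0, le_max_right _ _, fun x => ?_⟩
  by_cases hx : x ∈ Ω
  · exact (hM x (subset_closure hx)).trans (le_max_left _ _)
  · rw [h0 x hx, norm_zero]; exact le_max_right _ _

end ZeroExtension

variable {d : ℕ} {Ω : Set (Euc d)}

/-- The properties of the extension by zero of a field in `C_0^2`. -/
structure IsSmoothField (Ω : Set (Euc d)) (V : Euc d → Euc d) : Prop where
  contDiff : ContDiff ℝ 2 V
  zero : ∀ x, x ∉ Ω → V x = 0
  fderiv_zero : ∀ x, x ∉ Ω → fderiv ℝ V x = 0
  fderiv_fderiv_zero : ∀ x, x ∉ Ω → fderiv ℝ (fderiv ℝ V) x = 0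

/-- The zero extension is differentiable for V and, by the same argument, for its derivative; the
second derivative is continuous by its own compact superlevel sets. Afterwards V is a C² field on
the whole space. -/
theorem IsC0Field.isSmoothField (hΩ : IsOpen Ω) {V : Euc d → Euc d} (hV : IsC0Field 2 Ω V) :
    IsSmoothField Ω V := by
  obtain ⟨h1, h2, h3⟩ := hV
  have hat : ∀ x ∈ Ω, ContDiffAt ℝ 2 V x := fun x hx => h1.contDiffAt (hΩ.mem_nhds hx)
  have c0 : ∀ ε : ℝ, 0 < ε → IsCompact {x | x ∈ Ω ∧ ε ≤ ‖V x‖} := fun ε hε => by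
    simpa using h2 0 (by simp) ε hε
  have c1 : ∀ ε : ℝ, 0 < ε → IsCompact {x | x ∈ Ω ∧ ε ≤ ‖fderiv ℝ V x‖} := fun ε hε => by
    simpa [norm_iteratedFDeriv_one] using h2 1 (by simp) ε hε
  have c2 : ∀ ε : ℝ, 0 < ε → IsCompact {x | x ∈ Ω ∧ ε ≤ ‖fderiv ℝ (fderiv ℝ V) x‖} :=
    fun ε hε => by
      have := h2 2 le_rfl ε hε
      simpa [← norm_iteratedFDeriv_fderiv, norm_iteratedFDeriv_one] using this
  have hVc : Continuous V := continuous_of_isCompact_superlevel hΩ h1.continuousOn h3 c0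
  have hd0 : ∀ x, x ∉ Ω → HasFDerivAt V (0 : Euc d →L[ℝ] Euc d) x := fun x hx =>
    hasFDerivAt_zero_of_isCompact_superlevel hΩ hVc (h1.differentiableOn (by simp)) h3 c1 hx
  have hdz : ∀ x, x ∉ Ω → fderiv ℝ V x = 0 := fun x hx => (hd0 x hx).fderiv
  have hat1 : ∀ x ∈ Ω, ContDiffAt ℝ 1 (fderiv ℝ V) x := fun x hx =>
    (hat x hx).fderiv_right (by norm_num)
  have hDc : Continuous (fderiv ℝ V) := continuous_of_isCompact_superlevel hΩ
    (fun x hx => (hat1 x hx).continuousAt.continuousWithinAt) hdz c1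
  have hdd : ∀ x ∈ Ω, DifferentiableAt ℝ (fderiv ℝ V) x := fun x hx =>
    (hat1 x hx).differentiableAt (by simp)
  have hd1 : ∀ x, x ∉ Ω → HasFDerivAt (fderiv ℝ V) (0 : Euc d →L[ℝ] Euc d →L[ℝ] Euc d) x :=
    fun x hx => hasFDerivAt_zero_of_isCompact_superlevel hΩ hDc
      (fun x hx => (hdd x hx).differentiableWithinAt) hdz c2 hx
  have hddz : ∀ x, x ∉ Ω → fderiv ℝ (fderiv ℝ V) x = 0 := fun x hx => (hd1 x hx).fderiv
  have hDDc : Continuous (fderiv ℝ (fderiv ℝ V)) := continuous_of_isCompact_superlevel hΩ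
    (fun x hx => ((hat1 x hx).fderiv_right (m := 0) (by norm_num)).continuousAt.continuousWithinAt)
    hddz c2
  refine ⟨?_, h3, hdz, hddz⟩
  rw [show (2 : WithTop ℕ∞) = 1 + 1 by norm_num, contDiff_succ_iff_fderiv]
  refine ⟨fun x => ?_, by simp, ?_⟩
  · by_cases hx : x ∈ Ω
    · exact (hat x hx).differentiableAt (by simp)
    · exact (hd0 x hx).differentiableAt
  · rw [contDiff_one_iff_fderiv]
    refine ⟨fun x => ?_, hDDc⟩
    by_cases hx : x ∈ Ω
    · exact hdd x hx
    · exact (hd1 x hx).differentiableAt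

/-- The converse direction: superlevel sets are closed and contained in the bounded set Ω. It allows
constructed fields to be inserted into assumptions about all fields in C_0^1. -/
theorem isC0Field_one_of_contDiff (hb : Bornology.IsBounded Ω) {V : Euc d → Euc d}
    (hV : ContDiff ℝ 1 V) (h0 : ∀ x, x ∉ Ω → V x = 0) (h1 : ∀ x, x ∉ Ω → fderiv ℝ V x = 0) :
    IsC0Field 1 Ω V := by
  refine ⟨hV.contDiffOn, fun j hj ε hε => ?_, h0⟩
  have hz : ∀ x, x ∉ Ω → iteratedFDeriv ℝ j V x = 0 := by
    intro x hx
    rw [← norm_eq_zero]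
    interval_cases j
    · simp [h0 x hx]
    · simp [norm_iteratedFDeriv_one, h1 x hx]
  have heq : {x | x ∈ Ω ∧ ε ≤ ‖iteratedFDeriv ℝ j V x‖} = {x | ε ≤ ‖iteratedFDeriv ℝ j V x‖} := by
    ext x
    refine ⟨fun h => h.2, fun h => ⟨?_, h⟩⟩
    by_contra hx
    simp only [mem_ofPred_eq, hz x hx, norm_zero] at h
    linarith
  refine Metric.isCompact_of_isClosed_isBounded ?_ (hb.subset fun x hx => hx.1)
  rw [heq]
  exact isClosed_le continuous_const (hV.continuous_iteratedFDeriv (by exact_mod_cast hj)).norm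

namespace IsSmoothField

variable {V : Euc d → Euc d}

theorem continuous (hV : IsSmoothField Ω V) : Continuous V := hV.contDiff.continuous

theorem contDiff_fderiv (hV : IsSmoothField Ω V) : ContDiff ℝ 1 (fderiv ℝ V) :=
  hV.contDiff.fderiv_right (by norm_num)

theorem continuous_fderiv (hV : IsSmoothField Ω V) : Continuous (fderiv ℝ V) :=
  hV.contDiff_fderiv.continuous

theorem hasFDerivAt (hV : IsSmoothField Ω V) (x : Euc d) : HasFDerivAt V (fderiv ℝ V x) x :=
  (hV.contDiff.differentiable (by simp) x).hasFDerivAt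

end IsSmoothField

/-- The trace as a continuous linear map. -/
def traceL (d : ℕ) : (Euc d →L[ℝ] Euc d) →L[ℝ] ℝ :=
  LinearMap.toContinuousLinearMap
    ((LinearMap.trace ℝ (Euc d)).comp (ContinuousLinearMap.coeLM ℝ))

theorem divg_eq (V : Euc d → Euc d) : divg V = fun x => traceL d (fderiv ℝ V x) := rfl

namespace IsSmoothField

variable {V : Euc d → Euc d}

theorem contDiff_divg (hV : IsSmoothField Ω V) : ContDiff ℝ 1 (divg V) := by
  rw [divg_eq]
  exact (traceL d).contDiff.comp hV.contDiff_fderiv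

theorem continuous_divg (hV : IsSmoothField Ω V) : Continuous (divg V) :=
  hV.contDiff_divg.continuous

theorem hasFDerivAt_divg (hV : IsSmoothField Ω V) (x : Euc d) :
    HasFDerivAt (divg V) (fderiv ℝ (divg V) x) x :=
  (hV.contDiff_divg.differentiable (by simp) x).hasFDerivAt

theorem continuous_fderiv_divg (hV : IsSmoothField Ω V) : Continuous (fderiv ℝ (divg V)) :=
  hV.contDiff_divg.continuous_fderiv (by simp)

theorem divg_zero (hV : IsSmoothField Ω V) {x : Euc d} (hx : x ∉ Ω) : divg V x = 0 := by
  rw [divg_eq]; simp [hV.fderiv_zero x hx]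

theorem fderiv_divg_zero (hV : IsSmoothField Ω V) {x : Euc d} (hx : x ∉ Ω) :
    fderiv ℝ (divg V) x = 0 := by
  have h1 := (hV.contDiff_fderiv.differentiable (by simp) x).hasFDerivAt
  rw [hV.fderiv_fderiv_zero x hx] at h1
  have h2 := (traceL d).hasFDerivAt.comp x h1
  rw [ContinuousLinearMap.comp_zero] at h2
  exact h2.fderiv

end IsSmoothField

end NonlocalShape
end

/-! ### The perturbation of identity: injectivity, Jacobian, change of variables. -/

open Set Filter Topology MeasureTheory
open scoped ENNReal ContDiff

noncomputable section

namespace NonlocalShape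

set_option linter.unusedSectionVars false

section Det

variable {E : Type*} [NormedAddCommGroup E] [NormedSpace ℝ E] [FiniteDimensional ℝ E]

/-- By the Leibniz formula the determinant is a polynomial in the matrix entries, which are linear
in the map. -/
theorem contDiff_det : ContDiff ℝ 1 fun A : E →L[ℝ] E => A.det := by
  classical
  let b := Module.finBasis ℝ E
  have h1 : (fun A : E →L[ℝ] E => A.det) =
      fun A : E →L[ℝ] E => ∑ σ : Equiv.Perm (Fin (Module.finrank ℝ E)), ((Equiv.Perm.sign σ : ℤ) : ℝ) *
        ∏ i, LinearMap.toMatrix b b A.toLinearMap (σ i) i := by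
    ext A
    rw [ContinuousLinearMap.det, ← LinearMap.det_toMatrix b, Matrix.det_apply']
  rw [h1]
  refine ContDiff.sum fun σ _ => contDiff_const.mul (contDiff_prod fun i _ => ?_)
  let l : (E →L[ℝ] E) →ₗ[ℝ] ℝ :=
    { toFun := fun A => LinearMap.toMatrix b b A.toLinearMap (σ i) i
      map_add' := fun A B => by simp
      map_smul' := fun c A => by simp }
  exact (LinearMap.toContinuousLinearMap l).contDiff

theorem det_ne_zero_of_norm_lt_one {A : E →L[ℝ] E} (hA : ‖A‖ < 1) :
    (ContinuousLinearMap.id ℝ E + A).det ≠ 0 := by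
  have hker : LinearMap.ker ((ContinuousLinearMap.id ℝ E + A : E →L[ℝ] E) : E →ₗ[ℝ] E) = ⊥ := by
    rw [LinearMap.ker_eq_bot']
    intro v hv
    have h1 : v + A v = 0 := by simpa using hv
    by_contra hne
    have h2 : ‖v‖ = ‖A v‖ := by
      rw [← norm_neg (A v)]
      exact congrArg _ (eq_neg_of_add_eq_zero_left h1)
    have h3 := A.le_opNorm v
    have h4 : 0 < ‖v‖ := norm_pos_iff.2 hne
    nlinarith
  have := LinearMap.isUnit_det _ ((LinearMap.isUnit_iff_ker_eq_bot _).2 hker)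
  exact this.ne_zero

end Det

variable {d : ℕ} {Ω : Set (Euc d)} {W : Euc d → Euc d} {T : ℝ}

/-- The assumptions on the perturbation of identity. -/
structure IsAdmissible (Ω : Set (Euc d)) (W : Euc d → Euc d) (T : ℝ) : Prop where
  isOpen : IsOpen Ω
  isBounded : Bornology.IsBounded Ω
  smooth : IsSmoothField Ω W
  pos : 0 < T
  contr : ∃ q : ℝ, 0 ≤ q ∧ q < 1 ∧ ∀ x, T * ‖fderiv ℝ W x‖ ≤ q

/-- The smallness of T is assumed pointwise. The maximum over the compact closure of Ω gives one
contraction constant below 1, as DW vanishes outside Ω. -/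
theorem IsC0Field.isAdmissible (hΩ : IsOpen Ω) (hb : Bornology.IsBounded Ω)
    (hW : IsC0Field 2 Ω W) (hT : 0 < T) (hTW : ∀ x, T * ‖fderiv ℝ W x‖ < 1) :
    IsAdmissible Ω W T := by
  have hs := hW.isSmoothField hΩ
  refine ⟨hΩ, hb, hs, hT, ?_⟩
  rcases (closure Ω).eq_empty_or_nonempty with he | hne
  · refine ⟨0, le_rfl, one_pos, fun x => ?_⟩
    have hx : x ∉ Ω := fun h => by simpa [he] using subset_closure h
    simp [hs.fderiv_zero x hx]
  · obtain ⟨x₀, -, hx₀⟩ := hb.isCompact_closure.exists_isMaxOn hne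
      (f := fun x => T * ‖fderiv ℝ W x‖) (hs.continuous_fderiv.norm.const_mul T).continuousOn
    refine ⟨T * ‖fderiv ℝ W x₀‖, by positivity, hTW x₀, fun x => ?_⟩
    by_cases hx : x ∈ Ω
    · exact hx₀ (subset_closure hx)
    · rw [hs.fderiv_zero x hx]; simp; positivity

theorem flow_pair_eq_pert2 (W : Euc d → Euc d) (t : ℝ) : flow (pairField W) t = pert2 W t := rfl

namespace IsAdmissible

theorem norm_smul_sub_le (hA : IsAdmissible Ω W T) : ∃ q : ℝ, 0 ≤ q ∧ q < 1 ∧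
    ∀ r ∈ Icc 0 T, ∀ x y, ‖r • W x - r • W y‖ ≤ q * ‖x - y‖ := by
  obtain ⟨q, hq0, hq1, hq⟩ := hA.contr
  refine ⟨q, hq0, hq1, fun r hr x y => ?_⟩
  have h1 : ∀ z ∈ univ, HasFDerivWithinAt (fun z => r • W z) (r • fderiv ℝ W z) univ z := fun z _ =>
    ((hA.smooth.hasFDerivAt z).const_smul r).hasFDerivWithinAt
  refine convex_univ.norm_image_sub_le_of_norm_hasFDerivWithin_le h1 (fun z _ => ?_)
    (mem_univ y) (mem_univ x)
  rw [norm_smul, Real.norm_of_nonneg hr.1]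
  exact (mul_le_mul_of_nonneg_right hr.2 (norm_nonneg _)).trans (hq z)

/-- With contraction constant q one may take κ = 1 - q. This bound keeps pairs away from the
diagonal and the singular weight comparable along the flow. -/
theorem dist_pert (hA : IsAdmissible Ω W T) : ∃ κ : ℝ, 0 < κ ∧
    ∀ r ∈ Icc 0 T, ∀ x y, κ * dist x y ≤ dist (pert W r x) (pert W r y) := by
  obtain ⟨q, hq0, hq1, hq⟩ := hA.norm_smul_sub_le
  refine ⟨1 - q, by linarith, fun r hr x y => ?_⟩
  have h1 := hq r hr x y
  have h2 : pert W r x - pert W r y = (x - y) + (r • W x - r • W y) := by simp only [pert]; abel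
  rw [dist_eq_norm, dist_eq_norm, h2]
  have h3 := norm_sub_le ((x - y) + (r • W x - r • W y)) (r • W x - r • W y)
  rw [add_sub_cancel_right] at h3
  linarith

variable {r : ℝ}

theorem injective (hA : IsAdmissible Ω W T) (hr : r ∈ Icc 0 T) :
    Function.Injective (pert W r) := by
  obtain ⟨κ, hκ, h⟩ := hA.dist_pert
  intro x y hxy
  have := h r hr x y
  rw [hxy, dist_self] at this
  exact dist_le_zero.1 (by nlinarith [dist_nonneg (x := x) (y := y)])

/-- The map is the identity plus a strict contraction, so the quantitative inverse function theorem
applies globally. -/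
theorem exists_homeomorph (hA : IsAdmissible Ω W T) (hr : r ∈ Icc 0 T) :
    ∃ h : Euc d ≃ₜ Euc d, ⇑h = pert W r := by
  obtain ⟨q, hq0, hq1, hq⟩ := hA.norm_smul_sub_le
  have happ : ApproximatesLinearOn (pert W r)
      ((ContinuousLinearEquiv.refl ℝ (Euc d) : Euc d ≃L[ℝ] Euc d) : Euc d →L[ℝ] Euc d) univ
      q.toNNReal := by
    intro x _ y _
    have h2 : pert W r x - pert W r y - (x - y) = r • W x - r • W y := by simp only [pert]; abel
    simpa [h2, Real.coe_toNNReal q hq0] using hq r hr x y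
  rcases subsingleton_or_nontrivial (Euc d) with hs | hn
  · exact ⟨happ.toHomeomorph _ (Or.inl hs), rfl⟩
  · refine ⟨happ.toHomeomorph _ (Or.inr ?_), rfl⟩
    rw [← NNReal.coe_lt_coe]
    simpa [Real.coe_toNNReal q hq0] using hq1

theorem pert_of_notMem (hA : IsAdmissible Ω W T) (r : ℝ) {x : Euc d} (hx : x ∉ Ω) :
    pert W r x = x := by simp [pert, hA.smooth.zero x hx]

/-- Points outside Ω are fixed. If a point of Ω were moved outside, its image would be fixed too and
injectivity would identify the two. -/
theorem pert_mem_iff (hA : IsAdmissible Ω W T) (hr : r ∈ Icc 0 T) {x : Euc d} :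
    pert W r x ∈ Ω ↔ x ∈ Ω := by
  constructor
  · intro h
    by_contra hx
    rw [hA.pert_of_notMem r hx] at h
    exact hx h
  · intro hx
    by_contra h
    have := hA.injective hr (hA.pert_of_notMem r h)
    rw [this] at h
    exact h hx

theorem hasFDerivAt_pert (hA : IsAdmissible Ω W T) (r : ℝ) (x : Euc d) :
    HasFDerivAt (pert W r) (ContinuousLinearMap.id ℝ (Euc d) + r • fderiv ℝ W x) x :=
  (hasFDerivAt_id x).add ((hA.smooth.hasFDerivAt x).const_smul r)

theorem jac_eq (hA : IsAdmissible Ω W T) (r : ℝ) (x : Euc d) :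
    jac W r x = (ContinuousLinearMap.id ℝ (Euc d) + r • fderiv ℝ W x).det := by
  rw [jac, (hA.hasFDerivAt_pert r x).fderiv]

theorem continuous_jac (hA : IsAdmissible Ω W T) :
    Continuous fun p : ℝ × Euc d => jac W p.1 p.2 := by
  have h1 : Continuous fun p : ℝ × Euc d =>
      ContinuousLinearMap.id ℝ (Euc d) + p.1 • fderiv ℝ W p.2 :=
    continuous_const.add (continuous_fst.smul (hA.smooth.continuous_fderiv.comp continuous_snd))
  have h2 := (contDiff_det (E := Euc d)).continuous.comp h1
  refine h2.congr fun p => ?_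
  rw [hA.jac_eq]; rfl

theorem hasDerivAt_jac_fderiv (hA : IsAdmissible Ω W T) (r : ℝ) (x : Euc d) :
    HasDerivAt (fun r => jac W r x)
      (fderiv ℝ (fun A : Euc d →L[ℝ] Euc d => A.det)
        (ContinuousLinearMap.id ℝ (Euc d) + r • fderiv ℝ W x) (fderiv ℝ W x)) r := by
  have h1 : HasDerivAt (fun r : ℝ => ContinuousLinearMap.id ℝ (Euc d) + r • fderiv ℝ W x)
      (fderiv ℝ W x) r := by
    have := ((hasDerivAt_id r).smul_const (fderiv ℝ W x)).const_add
      (ContinuousLinearMap.id ℝ (Euc d))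
    rw [one_smul] at this
    exact this
  have h2 := (((contDiff_det (E := Euc d)).differentiable (by simp)
    (ContinuousLinearMap.id ℝ (Euc d) + r • fderiv ℝ W x)).hasFDerivAt).comp_hasDerivAt r h1
  refine h2.congr_of_eventuallyEq (Eventually.of_forall fun s => ?_)
  exact hA.jac_eq s x

theorem hasDerivAt_jac (hA : IsAdmissible Ω W T) (r : ℝ) (x : Euc d) :
    HasDerivAt (fun r => jac W r x) (jacDot W r x) r :=
  (hA.hasDerivAt_jac_fderiv r x).differentiableAt.hasDerivAt

theorem continuous_jacDot (hA : IsAdmissible Ω W T) :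
    Continuous fun p : ℝ × Euc d => jacDot W p.1 p.2 := by
  have hD : Continuous fun p : ℝ × Euc d => fderiv ℝ W p.2 :=
    hA.smooth.continuous_fderiv.comp continuous_snd
  have h1 : Continuous fun p : ℝ × Euc d =>
      ContinuousLinearMap.id ℝ (Euc d) + p.1 • fderiv ℝ W p.2 :=
    continuous_const.add (continuous_fst.smul hD)
  have h2 := (((contDiff_det (E := Euc d)).continuous_fderiv (by simp)).comp h1).clm_apply hD
  refine h2.congr fun p => ?_
  exact (hA.hasDerivAt_jac_fderiv p.1 p.2).deriv.symm

/-- The determinant does not vanish on [0,T] and equals 1 at time 0, so it keeps its sign by the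
intermediate value theorem. -/
theorem jac_pos (hA : IsAdmissible Ω W T) (hr : r ∈ Icc 0 T) (x : Euc d) : 0 < jac W r x := by
  obtain ⟨q, hq0, hq1, hq⟩ := hA.contr
  have hne : ∀ s ∈ Icc 0 T, jac W s x ≠ 0 := fun s hs => by
    rw [hA.jac_eq]
    refine det_ne_zero_of_norm_lt_one ?_
    rw [norm_smul, Real.norm_of_nonneg hs.1]
    exact ((mul_le_mul_of_nonneg_right hs.2 (norm_nonneg _)).trans (hq x)).trans_lt hq1
  have h0 : jac W 0 x = 1 := by
    rw [hA.jac_eq]; simp [ContinuousLinearMap.det]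
  by_contra hneg
  have hcont : ContinuousOn (fun s => jac W s x) (Icc 0 r) :=
    (hA.continuous_jac.comp (continuous_id.prodMk continuous_const)).continuousOn
  obtain ⟨s, hs, hs0⟩ := intermediate_value_Icc' hr.1 hcont
    (show (0 : ℝ) ∈ Icc (jac W r x) (jac W 0 x) from ⟨not_lt.1 hneg, by rw [h0]; exact zero_le_one⟩)
  exact hne s ⟨hs.1, hs.2.trans hr.2⟩ hs0

theorem jac_of_notMem (hA : IsAdmissible Ω W T) (r : ℝ) {x : Euc d} (hx : x ∉ Ω) :
    jac W r x = 1 := by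
  rw [hA.jac_eq, hA.smooth.fderiv_zero x hx]; simp [ContinuousLinearMap.det]

theorem jacDot_of_notMem (hA : IsAdmissible Ω W T) (r : ℝ) {x : Euc d} (hx : x ∉ Ω) :
    jacDot W r x = 0 := by
  have : (fun r => jac W r x) = fun _ => 1 := funext fun r => hA.jac_of_notMem r hx
  rw [jacDot, this, deriv_const]

theorem exists_jac_bounds (hA : IsAdmissible Ω W T) : ∃ c M : ℝ, 0 < c ∧ 0 ≤ M ∧
    ∀ r ∈ Icc 0 T, ∀ x, c ≤ jac W r x ∧ jac W r x ≤ M ∧ |jacDot W r x| ≤ M := by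
  have hK : IsCompact (Icc 0 T ×ˢ closure Ω) := isCompact_Icc.prod hA.isBounded.isCompact_closure
  obtain ⟨M₁, hM₁⟩ := hK.exists_bound_of_continuousOn hA.continuous_jac.continuousOn
  obtain ⟨M₂, hM₂⟩ := hK.exists_bound_of_continuousOn hA.continuous_jacDot.continuousOn
  obtain ⟨c, hc, hc'⟩ : ∃ c : ℝ, 0 < c ∧ ∀ p ∈ Icc 0 T ×ˢ closure Ω, c ≤ jac W p.1 p.2 := by
    rcases (Icc 0 T ×ˢ closure Ω).eq_empty_or_nonempty with he | hne
    · exact ⟨1, one_pos, fun p hp => by simp [he] at hp⟩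
    · obtain ⟨p, hp, hmin⟩ := hK.exists_isMinOn hne hA.continuous_jac.continuousOn
      exact ⟨jac W p.1 p.2, hA.jac_pos hp.1 p.2, fun p' hp' => hmin hp'⟩
  refine ⟨min c 1, max (max M₁ M₂) 1, by positivity, by positivity, fun r hr x => ?_⟩
  by_cases hx : x ∈ Ω
  · have hp : (r, x) ∈ Icc 0 T ×ˢ closure Ω := ⟨hr, subset_closure hx⟩
    refine ⟨(min_le_left _ _).trans (hc' _ hp), ?_, ?_⟩
    · exact (le_abs_self _).trans ((hM₁ _ hp).trans ((le_max_left _ _).trans (le_max_left _ _)))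
    · exact (hM₂ _ hp).trans ((le_max_right _ _).trans (le_max_left _ _))
  · rw [hA.jac_of_notMem r hx, hA.jacDot_of_notMem r hx]
    refine ⟨min_le_right _ _, le_max_right _ _, ?_⟩
    rw [abs_zero]; positivity

end IsAdmissible

section QuasiFlow

variable {X : Type*} [NormedAddCommGroup X] [NormedSpace ℝ X] [FiniteDimensional ℝ X]
  [MeasureSpace X] [BorelSpace X] [(volume : Measure X).IsAddHaarMeasure]

/-- The area formula on a preimage: c times the volume of F⁻¹(s) is at most the integral of |det DF|
over it, which is the volume of F(F⁻¹(s)) ⊆ s. -/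
theorem isQuasiFlow_of_det {w : X → X} (hw : Continuous w) {F' : ℝ → X → X →L[ℝ] X}
    (hF : ∀ r ∈ Icc 0 T, ∀ x, HasFDerivAt (flow w r) (F' r x) x)
    (hinj : ∀ r ∈ Icc 0 T, Function.Injective (flow w r)) {c : ℝ} (hc : 0 < c)
    (hdet : ∀ r ∈ Icc 0 T, ∀ x, c ≤ |(F' r x).det|) : IsQuasiFlow T w := by
  refine ⟨hw, (c⁻¹).toNNReal, fun r hr => ?_⟩
  rw [Measure.le_iff]
  intro s hs
  have hm := (continuous_flow hw r).measurable
  rw [Measure.map_apply hm hs, Measure.smul_apply, smul_eq_mul]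
  have h1 := lintegral_abs_det_fderiv_eq_addHaar_image (volume : Measure X) (hm hs)
    (fun x _ => (hF r hr x).hasFDerivWithinAt) (hinj r hr).injOn
  have h2 : ENNReal.ofReal c * volume (flow w r ⁻¹' s) ≤ volume s := by
    calc ENNReal.ofReal c * volume (flow w r ⁻¹' s)
        = ∫⁻ _ in flow w r ⁻¹' s, ENNReal.ofReal c := by simp
      _ ≤ ∫⁻ x in flow w r ⁻¹' s, ENNReal.ofReal |(F' r x).det| :=
          lintegral_mono fun x => ENNReal.ofReal_le_ofReal (hdet r hr x)
      _ = volume (flow w r '' (flow w r ⁻¹' s)) := h1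
      _ ≤ volume s := measure_mono (image_preimage_subset _ _)
  rw [show ((c⁻¹).toNNReal : ℝ≥0∞) = ENNReal.ofReal c⁻¹ from rfl, ENNReal.ofReal_inv_of_pos hc]
  rw [← ENNReal.div_eq_inv_mul, ENNReal.le_div_iff_mul_le (by simp [hc]) (by simp), mul_comm]
  exact h2

end QuasiFlow

instance : (volume : Measure (Euc d × Euc d)).IsAddHaarMeasure :=
  Measure.prod.instIsAddHaarMeasure _ _

namespace IsAdmissible

variable {r : ℝ}

theorem isQuasiFlow (hA : IsAdmissible Ω W T) : IsQuasiFlow T W := by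
  obtain ⟨c, M, hc, -, h⟩ := hA.exists_jac_bounds
  refine isQuasiFlow_of_det hA.smooth.continuous (fun r _ x => hA.hasFDerivAt_pert r x)
    (fun r hr => hA.injective hr) hc fun r hr x => ?_
  rw [← hA.jac_eq]
  exact (h r hr x).1.trans (le_abs_self _)

theorem hasFDerivAt_pert2 (hA : IsAdmissible Ω W T) (r : ℝ) (z : Euc d × Euc d) :
    HasFDerivAt (pert2 W r)
      ((ContinuousLinearMap.id ℝ (Euc d) + r • fderiv ℝ W z.1).prodMap
        (ContinuousLinearMap.id ℝ (Euc d) + r • fderiv ℝ W z.2)) z :=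
  HasFDerivAt.prodMap z (hA.hasFDerivAt_pert r z.1) (hA.hasFDerivAt_pert r z.2)

theorem det_pert2 (hA : IsAdmissible Ω W T) (r : ℝ) (z : Euc d × Euc d) :
    ((ContinuousLinearMap.id ℝ (Euc d) + r • fderiv ℝ W z.1).prodMap
        (ContinuousLinearMap.id ℝ (Euc d) + r • fderiv ℝ W z.2)).det = jac2 W r z := by
  rw [jac2, hA.jac_eq, hA.jac_eq, ContinuousLinearMap.det, ContinuousLinearMap.det,
    ContinuousLinearMap.det, ← LinearMap.det_prodMap]
  rfl

theorem injective_pert2 (hA : IsAdmissible Ω W T) (hr : r ∈ Icc 0 T) :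
    Function.Injective (pert2 W r) := (hA.injective hr).prodMap (hA.injective hr)

theorem jac2_pos (hA : IsAdmissible Ω W T) (hr : r ∈ Icc 0 T) (z : Euc d × Euc d) :
    0 < jac2 W r z := mul_pos (hA.jac_pos hr _) (hA.jac_pos hr _)

theorem hasDerivAt_jac2 (hA : IsAdmissible Ω W T) (r : ℝ) (z : Euc d × Euc d) :
    HasDerivAt (fun r => jac2 W r z) (jac2Dot W r z) r :=
  ((hA.hasDerivAt_jac r z.1).mul (hA.hasDerivAt_jac r z.2)).differentiableAt.hasDerivAt

theorem jac2Dot_eq (hA : IsAdmissible Ω W T) (r : ℝ) (z : Euc d × Euc d) :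
    jac2Dot W r z = jacDot W r z.1 * jac W r z.2 + jac W r z.1 * jacDot W r z.2 :=
  ((hA.hasDerivAt_jac r z.1).mul (hA.hasDerivAt_jac r z.2)).deriv

theorem continuous_jac2 (hA : IsAdmissible Ω W T) :
    Continuous fun p : ℝ × (Euc d × Euc d) => jac2 W p.1 p.2 :=
  (hA.continuous_jac.comp (by fun_prop : Continuous fun p : ℝ × (Euc d × Euc d) => (p.1, p.2.1))).mul
    (hA.continuous_jac.comp (by fun_prop : Continuous fun p : ℝ × (Euc d × Euc d) => (p.1, p.2.2)))

theorem continuous_jac2Dot (hA : IsAdmissible Ω W T) :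
    Continuous fun p : ℝ × (Euc d × Euc d) => jac2Dot W p.1 p.2 := by
  have c1 : Continuous fun p : ℝ × (Euc d × Euc d) => (p.1, p.2.1) := by fun_prop
  have c2 : Continuous fun p : ℝ × (Euc d × Euc d) => (p.1, p.2.2) := by fun_prop
  refine (((hA.continuous_jacDot.comp c1).mul (hA.continuous_jac.comp c2)).add
    ((hA.continuous_jac.comp c1).mul (hA.continuous_jacDot.comp c2))).congr fun p => ?_
  rw [hA.jac2Dot_eq]; rfl

theorem exists_jac2_bounds (hA : IsAdmissible Ω W T) : ∃ c M : ℝ, 0 < c ∧ 0 ≤ M ∧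
    ∀ r ∈ Icc 0 T, ∀ z, c ≤ jac2 W r z ∧ |jac2 W r z| ≤ M ∧ |jac2Dot W r z| ≤ M := by
  obtain ⟨c, M, hc, hM, h⟩ := hA.exists_jac_bounds
  refine ⟨c * c, 2 * (M * M), by positivity, by positivity, fun r hr z => ?_⟩
  obtain ⟨a1, a2, a3⟩ := h r hr z.1
  obtain ⟨b1, b2, b3⟩ := h r hr z.2
  have p1 := hA.jac_pos hr z.1
  have p2 := hA.jac_pos hr z.2
  refine ⟨mul_le_mul a1 b1 hc.le p1.le, ?_, ?_⟩
  · rw [abs_of_pos (hA.jac2_pos hr z), jac2]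
    nlinarith [mul_le_mul a2 b2 p2.le hM, mul_nonneg hM hM]
  · rw [hA.jac2Dot_eq]
    refine (abs_add_le _ _).trans ?_
    rw [abs_mul, abs_mul, abs_of_pos p1, abs_of_pos p2]
    have e1 := mul_le_mul a3 b2 p2.le hM
    have e2 := mul_le_mul a2 b3 (abs_nonneg _) hM
    linarith

theorem isQuasiFlow_pair (hA : IsAdmissible Ω W T) : IsQuasiFlow T (pairField W) := by
  obtain ⟨c, M, hc, -, h⟩ := hA.exists_jac2_bounds
  refine isQuasiFlow_of_det
    ((hA.smooth.continuous.comp continuous_fst).prodMk (hA.smooth.continuous.comp continuous_snd))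
    (fun r _ x => hA.hasFDerivAt_pert2 r x) (fun r hr => hA.injective_pert2 hr) hc fun r hr x => ?_
  rw [hA.det_pert2]
  exact (h r hr x).1.trans (le_abs_self _)

theorem pull_pert (hA : IsAdmissible Ω W T) (hr : r ∈ Icc 0 T) (u : Euc d → ℝ) (x : Euc d) :
    pull W r u (pert W r x) = u x := by
  simp only [pull, Function.comp]
  rw [Function.leftInverse_invFun (hA.injective hr) x]

theorem integral_image (hA : IsAdmissible Ω W T) (hr : r ∈ Icc 0 T) {s : Set (Euc d)}
    (hs : MeasurableSet s) (g : Euc d → ℝ) :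
    ∫ x in pert W r '' s, g x = ∫ x in s, g (pert W r x) * jac W r x := by
  rw [integral_image_eq_integral_abs_det_fderiv_smul volume hs
    (fun x _ => (hA.hasFDerivAt_pert r x).hasFDerivWithinAt) (hA.injective hr).injOn]
  refine integral_congr_ae (ae_of_all _ fun x => ?_)
  simp only [← hA.jac_eq, smul_eq_mul]
  rw [abs_of_pos (hA.jac_pos hr x), mul_comm]

theorem integrableOn_image (hA : IsAdmissible Ω W T) (hr : r ∈ Icc 0 T) {s : Set (Euc d)}
    (hs : MeasurableSet s) (g : Euc d → ℝ) :
    IntegrableOn g (pert W r '' s) ↔ IntegrableOn (fun x => g (pert W r x) * jac W r x) s := by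
  rw [integrableOn_image_iff_integrableOn_abs_det_fderiv_smul volume hs
    (fun x _ => (hA.hasFDerivAt_pert r x).hasFDerivWithinAt) (hA.injective hr).injOn]
  simp only [← hA.jac_eq, smul_eq_mul, abs_of_pos (hA.jac_pos hr _), mul_comm]

theorem image_prod_pert (r : ℝ) (s : Set (Euc d)) :
    (pert W r '' s) ×ˢ (pert W r '' s) = pert2 W r '' (s ×ˢ s) := prodMap_image_prod _ _ _ _ |>.symm

theorem integral_image_prod (hA : IsAdmissible Ω W T) (hr : r ∈ Icc 0 T) {s : Set (Euc d)}
    (hs : MeasurableSet s) (g : Euc d × Euc d → ℝ) :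
    ∫ z in (pert W r '' s) ×ˢ (pert W r '' s), g z =
      ∫ z in s ×ˢ s, g (pert2 W r z) * jac2 W r z := by
  rw [image_prod_pert, integral_image_eq_integral_abs_det_fderiv_smul volume (hs.prod hs)
    (fun x _ => (hA.hasFDerivAt_pert2 r x).hasFDerivWithinAt) (hA.injective_pert2 hr).injOn]
  refine integral_congr_ae (ae_of_all _ fun x => ?_)
  simp only [hA.det_pert2, smul_eq_mul]
  rw [abs_of_pos (hA.jac2_pos hr x), mul_comm]

theorem integrableOn_image_prod (hA : IsAdmissible Ω W T) (hr : r ∈ Icc 0 T) {s : Set (Euc d)}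
    (hs : MeasurableSet s) (g : Euc d × Euc d → ℝ) :
    IntegrableOn g ((pert W r '' s) ×ˢ (pert W r '' s)) ↔
      IntegrableOn (fun z => g (pert2 W r z) * jac2 W r z) (s ×ˢ s) := by
  rw [image_prod_pert, integrableOn_image_iff_integrableOn_abs_det_fderiv_smul volume (hs.prod hs)
    (fun x _ => (hA.hasFDerivAt_pert2 r x).hasFDerivWithinAt) (hA.injective_pert2 hr).injOn]
  simp only [hA.det_pert2, smul_eq_mul, abs_of_pos (hA.jac2_pos hr _), mul_comm]

/-- The field transported by the flow is again a `C¹` field, with uniform bounds. -/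
theorem exists_transport (hA : IsAdmissible Ω W T) : ∃ (Wt : ℝ → Euc d → Euc d) (M : ℝ),
    ∀ r ∈ Icc 0 T, ContDiff ℝ 1 (Wt r) ∧ (∀ x, Wt r (pert W r x) = W x) ∧
      (∀ x, x ∉ Ω → Wt r x = 0) ∧ (∀ x, x ∉ Ω → fderiv ℝ (Wt r) x = 0) ∧
      ∀ x, ‖Wt r x‖ ≤ M ∧ ‖fderiv ℝ (Wt r) x‖ ≤ M := by
  obtain ⟨κ, hκ, hdist⟩ := hA.dist_pert
  obtain ⟨M₀, hM₀, hb₀⟩ := exists_bound_of_vanishing hA.isBounded hA.smooth.continuous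
    hA.smooth.zero
  obtain ⟨M₁, hM₁, hb₁⟩ := exists_bound_of_vanishing hA.isBounded hA.smooth.continuous_fderiv
    hA.smooth.fderiv_zero
  -- The kernel assumptions evaluate kernel and field at the same point, while the time derivative
  -- pairs ∇γ(F_r z) with W(z); the field W ∘ F_r⁻¹ reconciles the two. The inverse is Lipschitz
  -- with constant κ⁻¹, whence the uniform bound on its derivative.
  refine ⟨fun r => W ∘ Function.invFun (pert W r), max M₀ (M₁ * κ⁻¹), fun r hr => ?_⟩
  obtain ⟨h, hh⟩ := hA.exists_homeomorph hr
  have hinv : Function.invFun (pert W r) = h.symm := by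
    ext1 y
    obtain ⟨x, rfl⟩ := h.surjective y
    rw [h.symm_apply_apply, hh, Function.leftInverse_invFun (hA.injective hr) x]
  beta_reduce
  rw [hinv]
  have hW1 : ContDiff ℝ 1 W := hA.smooth.contDiff.of_le (by norm_num)
  have hcd : ContDiff ℝ 1 h.symm := by
    rw [contDiff_iff_contDiffAt]
    intro y
    have hdet : (ContinuousLinearMap.id ℝ (Euc d) + r • fderiv ℝ W (h.symm y)).det ≠ 0 := by
      rw [← hA.jac_eq]; exact (hA.jac_pos hr _).ne'
    refine h.toOpenPartialHomeomorph.contDiffAt_symm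
      (f₀' := ContinuousLinearMap.toContinuousLinearEquivOfDetNeZero _ hdet) (mem_univ y) ?_ ?_
    · simp only [ContinuousLinearMap.coe_toContinuousLinearEquivOfDetNeZero]
      change HasFDerivAt h _ (h.symm y)
      rw [hh]
      exact hA.hasFDerivAt_pert r _
    · change ContDiffAt ℝ 1 h (h.symm y)
      rw [hh]
      exact (contDiff_id.add (hW1.const_smul r)).contDiffAt
  have hsymm : ∀ y, y ∉ Ω → h.symm y = y := fun y hy => by
    rw [Homeomorph.symm_apply_eq, hh, hA.pert_of_notMem r hy]
  have hlip : LipschitzWith (κ⁻¹).toNNReal h.symm := LipschitzWith.of_dist_le_mul fun x y => by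
    rw [Real.coe_toNNReal _ (by positivity), inv_mul_eq_div, le_div_iff₀ hκ, mul_comm]
    have := hdist r hr (h.symm x) (h.symm y)
    rwa [← hh, h.apply_symm_apply, h.apply_symm_apply] at this
  have hfd : ∀ y, fderiv ℝ (W ∘ h.symm) y = (fderiv ℝ W (h.symm y)).comp (fderiv ℝ h.symm y) :=
    fun y => fderiv_comp y (hA.smooth.hasFDerivAt _).differentiableAt
      (hcd.differentiable (by simp) y)
  refine ⟨hW1.comp hcd, fun x => ?_, fun x hx => ?_, fun x hx => ?_, fun x => ⟨?_, ?_⟩⟩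
  · rw [← hh, Function.comp, h.symm_apply_apply]
  · rw [Function.comp, hsymm x hx, hA.smooth.zero x hx]
  · rw [hfd, hsymm x hx, hA.smooth.fderiv_zero x hx, ContinuousLinearMap.zero_comp]
  · exact (hb₀ _).trans (le_max_left _ _)
  · rw [hfd]
    refine (ContinuousLinearMap.opNorm_comp_le _ _).trans (le_trans ?_ (le_max_right _ _))
    refine mul_le_mul (hb₁ _) ?_ (norm_nonneg _) hM₁
    have := norm_fderiv_le_of_lipschitz ℝ hlip (x₀ := x)
    rwa [Real.coe_toNNReal _ (by positivity)] at this

end IsAdmissible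

end NonlocalShape
end

/-! ### Families with degrees of domination. -/

open Set Filter Topology MeasureTheory
open scoped ENNReal ContDiff

noncomputable section

namespace NonlocalShape

set_option linter.unusedSectionVars false

section AEFamilies

variable {X : Type*} [MeasurableSpace X] {μ : Measure X} {T : ℝ}

/-- Almost everywhere equal, for every time, to an absolutely continuous family. -/
def AEFamily (μ : Measure X) (T : ℝ) (A A' : ℝ → X → ℝ) : Prop :=
  ∃ a a', ACFamily μ T a a' ∧ ∀ r ∈ Icc 0 T, ∀ᵐ z ∂μ, A r z = a r z ∧ A' r z = a' r z

namespace AEFamily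

variable {A A' B B' : ℝ → X → ℝ}

theorem congr (h : AEFamily μ T A A')
    (hB : ∀ r ∈ Icc 0 T, ∀ᵐ z ∂μ, B r z = A r z ∧ B' r z = A' r z) : AEFamily μ T B B' := by
  obtain ⟨a, a', ha, hae⟩ := h
  refine ⟨a, a', ha, fun r hr => ?_⟩
  filter_upwards [hae r hr, hB r hr] with z h1 h2
  exact ⟨h2.1.trans h1.1, h2.2.trans h1.2⟩

theorem add (hA : AEFamily μ T A A') (hB : AEFamily μ T B B') :
    AEFamily μ T (fun r z => A r z + B r z) (fun r z => A' r z + B' r z) := by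
  obtain ⟨a, a', ha, h1⟩ := hA
  obtain ⟨b, b', hb, h2⟩ := hB
  refine ⟨_, _, ha.add hb, fun r hr => ?_⟩
  filter_upwards [h1 r hr, h2 r hr] with z h1 h2
  exact ⟨by rw [h1.1, h2.1], by rw [h1.2, h2.2]⟩

theorem mul [SFinite μ] (hT : 0 ≤ T) (hA : AEFamily μ T A A') (hB : AEFamily μ T B B') :
    AEFamily μ T (fun r z => A r z * B r z) (fun r z => A' r z * B r z + A r z * B' r z) := by
  obtain ⟨a, a', ha, h1⟩ := hA
  obtain ⟨b, b', hb, h2⟩ := hB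
  refine ⟨_, _, ha.mul hT hb, fun r hr => ?_⟩
  filter_upwards [h1 r hr, h2 r hr] with z h1 h2
  exact ⟨by rw [h1.1, h2.1], by rw [h1.1, h2.1, h1.2, h2.2]⟩

theorem sum {ι : Type*} [Fintype ι] {A A' : ι → ℝ → X → ℝ}
    (h : ∀ k, AEFamily μ T (A k) (A' k)) :
    AEFamily μ T (fun r z => ∑ k, A k r z) (fun r z => ∑ k, A' k r z) := by
  choose a a' ha hae using h
  refine ⟨_, _, ACFamily.sum Finset.univ ha, fun r hr => ?_⟩
  filter_upwards [ae_all_iff.2 fun k => hae k r hr] with z hz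
  exact ⟨Finset.sum_congr rfl fun k _ => (hz k).1, Finset.sum_congr rfl fun k _ => (hz k).2⟩

theorem const {h : X → ℝ} (hh : AEStronglyMeasurable h μ) :
    AEFamily μ T (fun _ z => h z) (fun _ _ => 0) := by
  refine ⟨_, _, ACFamily.const hh.stronglyMeasurable_mk.measurable, fun r _ => ?_⟩
  filter_upwards [hh.ae_eq_mk] with z hz
  exact ⟨hz, rfl⟩

end AEFamily

theorem ACFamily.aeFamily {A A' : ℝ → X → ℝ} (h : ACFamily μ T A A') : AEFamily μ T A A' :=
  ⟨A, A', h, fun _ _ => ae_of_all _ fun _ => ⟨rfl, rfl⟩⟩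

/-- Domination of a family by a power of `N`, uniformly in time. -/
def DomBy (μ : Measure X) (T : ℝ) (N : ℝ → X → ℝ) (k : ℕ) (A : ℝ → X → ℝ) : Prop :=
  ∃ C : ℝ, 0 ≤ C ∧ ∀ r ∈ Icc 0 T, ∀ᵐ z ∂μ, |A r z| ≤ C * N r z ^ k

namespace DomBy

variable {N A B : ℝ → X → ℝ} {k l : ℕ}

theorem congr (h : DomBy μ T N k A) (hB : ∀ r ∈ Icc 0 T, ∀ᵐ z ∂μ, B r z = A r z) :
    DomBy μ T N k B := by
  obtain ⟨C, hC, h⟩ := h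
  refine ⟨C, hC, fun r hr => ?_⟩
  filter_upwards [h r hr, hB r hr] with z h1 h2
  rwa [h2]

theorem add (hA : DomBy μ T N k A) (hB : DomBy μ T N k B) :
    DomBy μ T N k fun r z => A r z + B r z := by
  obtain ⟨C, hC, h⟩ := hA
  obtain ⟨C', hC', h'⟩ := hB
  refine ⟨C + C', by positivity, fun r hr => ?_⟩
  filter_upwards [h r hr, h' r hr] with z h1 h2
  exact (abs_add_le _ _).trans (by rw [add_mul]; exact add_le_add h1 h2)

/-- Degrees count the L² factors: bounded factors have degree 0, L² factors degree 1, and a product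
of degree 2 is dominated by the integrable function N². -/
theorem mul (hN : ∀ r z, 0 ≤ N r z) (hA : DomBy μ T N k A) (hB : DomBy μ T N l B) :
    DomBy μ T N (k + l) fun r z => A r z * B r z := by
  obtain ⟨C, hC, h⟩ := hA
  obtain ⟨C', hC', h'⟩ := hB
  refine ⟨C * C', by positivity, fun r hr => ?_⟩
  filter_upwards [h r hr, h' r hr] with z h1 h2
  rw [abs_mul, pow_add, mul_mul_mul_comm]
  exact mul_le_mul h1 h2 (abs_nonneg _) (mul_nonneg hC (pow_nonneg (hN r z) k))

theorem sum {ι : Type*} (s : Finset ι) {A : ι → ℝ → X → ℝ} (h : ∀ i, DomBy μ T N k (A i)) :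
    DomBy μ T N k fun r z => ∑ i ∈ s, A i r z := by
  classical
  induction s using Finset.induction_on with
  | empty => exact ⟨0, le_rfl, fun r _ => ae_of_all _ fun z => by simp⟩
  | insert i s hi ih =>
    simp only [Finset.sum_insert hi]
    exact (h i).add ih

theorem zero : DomBy μ T N k fun _ _ => 0 := ⟨0, le_rfl, fun r _ => ae_of_all _ fun z => by simp⟩

end DomBy

/-- A family that is absolutely continuous in time and dominated, together with its derivative. -/
structure Fam (μ : Measure X) (T : ℝ) (N : ℝ → X → ℝ) (k : ℕ) (A A' : ℝ → X → ℝ) : Prop where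
  ac : AEFamily μ T A A'
  dom : DomBy μ T N k A
  dom' : DomBy μ T N k A'

namespace Fam

variable {N A A' B B' : ℝ → X → ℝ} {k l : ℕ}

theorem congr (h : Fam μ T N k A A')
    (hB : ∀ r ∈ Icc 0 T, ∀ᵐ z ∂μ, B r z = A r z ∧ B' r z = A' r z) : Fam μ T N k B B' :=
  ⟨h.ac.congr hB, h.dom.congr fun r hr => (hB r hr).mono fun _ h => h.1,
    h.dom'.congr fun r hr => (hB r hr).mono fun _ h => h.2⟩

theorem add (hA : Fam μ T N k A A') (hB : Fam μ T N k B B') :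
    Fam μ T N k (fun r z => A r z + B r z) (fun r z => A' r z + B' r z) :=
  ⟨hA.ac.add hB.ac, hA.dom.add hB.dom, hA.dom'.add hB.dom'⟩

theorem mul [SFinite μ] (hT : 0 ≤ T) (hN : ∀ r z, 0 ≤ N r z) (hA : Fam μ T N k A A')
    (hB : Fam μ T N l B B') :
    Fam μ T N (k + l) (fun r z => A r z * B r z) (fun r z => A' r z * B r z + A r z * B' r z) :=
  ⟨hA.ac.mul hT hB.ac, hA.dom.mul hN hB.dom, (hA.dom'.mul hN hB.dom).add (hA.dom.mul hN hB.dom')⟩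

theorem sum {ι : Type*} [Fintype ι] {A A' : ι → ℝ → X → ℝ}
    (h : ∀ i, Fam μ T N k (A i) (A' i)) :
    Fam μ T N k (fun r z => ∑ i, A i r z) (fun r z => ∑ i, A' i r z) :=
  ⟨.sum fun i => (h i).ac, .sum _ fun i => (h i).dom, .sum _ fun i => (h i).dom'⟩

theorem const {h : X → ℝ} (hh : AEStronglyMeasurable h μ) (hd : DomBy μ T N k fun _ z => h z) :
    Fam μ T N k (fun _ z => h z) (fun _ _ => 0) :=
  ⟨.const hh, hd, .zero⟩

theorem real (c : ℝ) : Fam μ T N 0 (fun _ _ => c) (fun _ _ => 0) :=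
  .const aestronglyMeasurable_const ⟨|c|, abs_nonneg c, fun _ _ => ae_of_all _ fun _ => by simp⟩

theorem neg [SFinite μ] (hT : 0 ≤ T) (hN : ∀ r z, 0 ≤ N r z) (hA : Fam μ T N k A A') :
    Fam μ T N k (fun r z => -A r z) (fun r z => -A' r z) := by
  have := (Fam.real (μ := μ) (T := T) (N := N) (-1)).mul hT hN hA
  rw [zero_add] at this
  exact this.congr fun r _ => ae_of_all _ fun z => ⟨by ring, by ring⟩

theorem sub [SFinite μ] (hT : 0 ≤ T) (hN : ∀ r z, 0 ≤ N r z) (hA : Fam μ T N k A A')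
    (hB : Fam μ T N k B B') :
    Fam μ T N k (fun r z => A r z - B r z) (fun r z => A' r z - B' r z) :=
  (hA.add (hB.neg hT hN)).congr fun r _ => ae_of_all _ fun z => ⟨by ring, by ring⟩

theorem of_hasDerivAt [TopologicalSpace X] [SecondCountableTopology X] [OpensMeasurableSpace X]
    (hA : Continuous fun p : ℝ × X => A p.1 p.2) (hA' : Continuous fun p : ℝ × X => A' p.1 p.2)
    (h : ∀ z r, HasDerivAt (fun r => A r z) (A' r z) r)
    {M : ℝ} (hM : ∀ r ∈ Icc 0 T, ∀ z, |A r z| ≤ M ∧ |A' r z| ≤ M) : Fam μ T N 0 A A' := by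
  have hac : ACFamily μ T A A' := .of_hasDerivAt hA.measurable hA'.measurable
    (fun z => hA'.comp (continuous_id.prodMk continuous_const)) h
  refine ⟨hac.aeFamily, ⟨max M 0, le_max_right _ _, fun r hr => ae_of_all _ fun z => ?_⟩,
    ⟨max M 0, le_max_right _ _, fun r hr => ae_of_all _ fun z => ?_⟩⟩
  · simpa using Or.inl (hM r hr z).1
  · simpa using Or.inl (hM r hr z).2

/-- Differentiation under the integral sign. -/
theorem hasDerivWithinAt [SFinite μ] (hT : 0 ≤ T) (hA : Fam μ T N k A A')
    (hD : L1Cont μ T fun r z => N r z ^ k) {t : ℝ} (ht : t ∈ Icc 0 T) :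
    Integrable (A t) μ ∧ Integrable (A' t) μ ∧
      HasDerivWithinAt (fun t => ∫ z, A t z ∂μ) (∫ z, A' t z ∂μ) (Icc 0 T) t := by
  obtain ⟨⟨a, a', hac, hae⟩, ⟨C, hC, hd⟩, ⟨C', hC', hd'⟩⟩ := hA
  have hpow : ∀ r ∈ Icc 0 T, ∀ᵐ z ∂μ, |a r z| ≤ C * N r z ^ k + C' * N r z ^ k ∧
      |a' r z| ≤ C * N r z ^ k + C' * N r z ^ k := by
    intro r hr
    filter_upwards [hae r hr, hd r hr, hd' r hr] with z h1 h2 h3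
    rw [h1.1] at h2
    rw [h1.2] at h3
    have e1 := (abs_nonneg _).trans h2
    have e2 := (abs_nonneg _).trans h3
    constructor <;> linarith
  have key := hac.hasDerivWithinAt hT ((hD.const_mul C).add (hD.const_mul C'))
    (fun r hr => (hpow r hr).mono fun _ h => h.1) (fun r hr => (hpow r hr).mono fun _ h => h.2) ht
  have e1 : ∀ r ∈ Icc 0 T, A r =ᵐ[μ] a r := fun r hr => (hae r hr).mono fun _ h => h.1
  have e2 : ∀ r ∈ Icc 0 T, A' r =ᵐ[μ] a' r := fun r hr => (hae r hr).mono fun _ h => h.2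
  refine ⟨key.1.congr (e1 t ht).symm, key.2.1.congr (e2 t ht).symm, ?_⟩
  rw [integral_congr_ae (e2 t ht)]
  exact key.2.2.congr (fun r hr => integral_congr_ae (e1 r hr)) (integral_congr_ae (e1 t ht))

end Fam

end AEFamilies

section JetFam

variable {X : Type*} [NormedAddCommGroup X] [NormedSpace ℝ X] [FiniteDimensional ℝ X]
  [MeasureSpace X] [BorelSpace X] [(volume : Measure X).IsAddHaarMeasure]
variable {w : X → X} {T : ℝ} {O : ℕ → Set X} {D E : Set X} {S : Submodule ℝ X} {J : WeakJet X}
  {m : ℕ} {c : Fin m → X →L[ℝ] ℝ} {e : Fin m → X} {f : X → ℝ} {g : Fin m → X → ℝ}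
  {h : Fin m → Fin m → X → ℝ}

theorem JetFamilies.val_family (hJ : JetFamilies w T O D E S J c e f g h) (hE : MeasurableSet E)
    (hwS : ∀ z ∈ E, w z ∈ S) : AEFamily (volume.restrict E) T (fun r z => J.val (flow w r z))
      (fun r z => J.grad (flow w r z) (w z)) :=
  hJ.ac.aeFamily.congr fun r hr => by
    filter_upwards [hJ.val_eq r hr, hJ.grad_eq r hr, self_mem_ae_restrict hE] with z h1 h2 hz
    exact ⟨h1, h2 _ (hwS z hz)⟩

/-- In coordinates the gradient in the direction v is a sum of products c l (v) · g l. The product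
rule gives the Hessian term and the term in which the direction itself is differentiated. -/
theorem JetFamilies.grad_family (hJ : JetFamilies w T O D E S J c e f g h) (hT : 0 ≤ T)
    (hE : MeasurableSet E) (hwS : ∀ z ∈ E, w z ∈ S) {v v' : ℝ → X → X}
    (hv : Continuous fun p : ℝ × X => v p.1 p.2) (hv' : Continuous fun p : ℝ × X => v' p.1 p.2)
    (hd : ∀ z r, HasDerivAt (fun r => v r z) (v' r z) r)
    (hvS : ∀ z ∈ E, ∀ r ∈ Icc 0 T, v r z ∈ S ∧ v' r z ∈ S) :
    AEFamily (volume.restrict E) T (fun r z => J.grad (flow w r z) (v r z))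
      (fun r z => J.hess (flow w r z) (w z) (v r z) + J.grad (flow w r z) (v' r z)) := by
  have h1 : ∀ l, ACFamily (volume.restrict E) T (fun r z => c l (v r z)) (fun r z => c l (v' r z)) :=
    fun l => .of_hasDerivAt ((c l).continuous.comp hv).measurable
      ((c l).continuous.comp hv').measurable
      (fun z => ((c l).continuous.comp hv').comp (continuous_id.prodMk continuous_const))
      (fun z r => (c l).hasFDerivAt.comp_hasDerivAt r (hd z r))
  refine (AEFamily.sum fun l => ((h1 l).mul hT (hJ.ac_grad l)).aeFamily).congr fun r hr => ?_
  filter_upwards [hJ.grad_eq r hr, hJ.hess_eq r hr, self_mem_ae_restrict hE] with z h2 h3 hz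
  obtain ⟨hs, hs'⟩ := hvS z hz r hr
  refine ⟨h2 _ hs, ?_⟩
  rw [h2 _ hs', h3 _ (hwS z hz) _ hs, Finset.sum_comm, ← Finset.sum_add_distrib]
  refine Finset.sum_congr rfl fun l _ => ?_
  rw [add_comm, Finset.mul_sum]
  congr 1
  exact Finset.sum_congr rfl fun k _ => by ring

end JetFam

end NonlocalShape
end

/-! ### Sobolev functions, divergence and Jacobian along F_t. -/

open Set Filter Topology MeasureTheory
open scoped ENNReal ContDiff

noncomputable section

namespace NonlocalShape

set_option linter.unusedSectionVars false

variable {d : ℕ} {Ω : Set (Euc d)} {W V : Euc d → Euc d} {T : ℝ}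

theorem IsSmoothField.exists_bound (hV : IsSmoothField Ω V) (hb : Bornology.IsBounded Ω) :
    ∃ M, 0 ≤ M ∧ ∀ x, ‖V x‖ ≤ M ∧ ‖fderiv ℝ V x‖ ≤ M ∧ |divg V x| ≤ M ∧
      ‖fderiv ℝ (divg V) x‖ ≤ M := by
  obtain ⟨M₁, h1, b1⟩ := exists_bound_of_vanishing hb hV.continuous hV.zero
  obtain ⟨M₂, h2, b2⟩ := exists_bound_of_vanishing hb hV.continuous_fderiv hV.fderiv_zero
  obtain ⟨M₃, h3, b3⟩ := exists_bound_of_vanishing hb hV.continuous_divg fun x => hV.divg_zero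
  obtain ⟨M₄, h4, b4⟩ := exists_bound_of_vanishing hb hV.continuous_fderiv_divg
    fun x => hV.fderiv_divg_zero
  refine ⟨M₁ + M₂ + M₃ + M₄, by positivity, fun x => ?_⟩
  have := b1 x
  have := b2 x
  have := b3 x
  have := b4 x
  rw [Real.norm_eq_abs] at *
  refine ⟨?_, ?_, ?_, ?_⟩ <;> linarith

namespace IsAdmissible

theorem continuous_pert (hA : IsAdmissible Ω W T) :
    Continuous fun p : ℝ × Euc d => pert W p.1 p.2 :=
  continuous_snd.add (continuous_fst.smul (hA.smooth.continuous.comp continuous_snd))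

theorem hasDerivAt_pert (r : ℝ) (x : Euc d) : HasDerivAt (fun r => pert W r x) (W x) r := by
  have := ((hasDerivAt_id r).smul_const (W x)).const_add x
  rw [one_smul] at this
  exact this

theorem hasDerivAt_comp_pert (hV : IsSmoothField Ω V) (r : ℝ) (x : Euc d) :
    HasDerivAt (fun r => V (pert W r x)) (fderiv ℝ V (pert W r x) (W x)) r :=
  (hV.hasFDerivAt _).comp_hasDerivAt r (hasDerivAt_pert r x)

theorem continuous_comp_pert (hA : IsAdmissible Ω W T) (hV : IsSmoothField Ω V) :
    Continuous fun p : ℝ × Euc d => V (pert W p.1 p.2) :=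
  hV.continuous.comp hA.continuous_pert

theorem continuous_fderiv_comp_pert (hA : IsAdmissible Ω W T) (hV : IsSmoothField Ω V) :
    Continuous fun p : ℝ × Euc d => fderiv ℝ V (pert W p.1 p.2) (W p.2) :=
  (hV.continuous_fderiv.comp hA.continuous_pert).clm_apply (hA.smooth.continuous.comp continuous_snd)

/-- The auxiliary map p lets one statement serve for points of space and for either component of a
pair. -/
theorem fam_divg_comp (hA : IsAdmissible Ω W T)
    (hV : IsSmoothField Ω V) {Y : Type*} [TopologicalSpace Y] [SecondCountableTopology Y]
    [MeasurableSpace Y] [OpensMeasurableSpace Y] (μ : Measure Y)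
    (N : ℝ → Y → ℝ) {p : Y → Euc d} (hp : Continuous p) :
    Fam μ T N 0 (fun r z => divg V (pert W r (p z)))
      (fun r z => fderiv ℝ (divg V) (pert W r (p z)) (W (p z))) := by
  obtain ⟨M, hM, hb⟩ := hV.exists_bound hA.isBounded
  obtain ⟨M', hM', hb'⟩ := hA.smooth.exists_bound hA.isBounded
  have hc : Continuous fun q : ℝ × Y => pert W q.1 (p q.2) :=
    hA.continuous_pert.comp (continuous_fst.prodMk (hp.comp continuous_snd))
  refine .of_hasDerivAt (M := M + M * M') (hV.continuous_divg.comp hc)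
    ((hV.continuous_fderiv_divg.comp hc).clm_apply
      (hA.smooth.continuous.comp (hp.comp continuous_snd)))
    (fun x r => (hV.hasFDerivAt_divg _).comp_hasDerivAt r (hasDerivAt_pert r (p x)))
    fun r _ x => ?_
  have h1 := (hb (pert W r (p x))).2.2.1
  have h2 : |fderiv ℝ (divg V) (pert W r (p x)) (W (p x))| ≤ M * M' :=
    ((fderiv ℝ (divg V) (pert W r (p x))).le_opNorm (W (p x))).trans
      (mul_le_mul (hb _).2.2.2 (hb' (p x)).1 (norm_nonneg _) hM)
  have h3 : 0 ≤ M * M' := by positivity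
  constructor <;> linarith

theorem fam_divg (hA : IsAdmissible Ω W T) (hV : IsSmoothField Ω V) (μ : Measure (Euc d))
    (N : ℝ → Euc d → ℝ) : Fam μ T N 0 (fun r x => divg V (pert W r x))
      (fun r x => fderiv ℝ (divg V) (pert W r x) (W x)) :=
  hA.fam_divg_comp hV μ N continuous_id

theorem fam_jac (hA : IsAdmissible Ω W T) (μ : Measure (Euc d)) (N : ℝ → Euc d → ℝ) :
    Fam μ T N 0 (fun r x => jac W r x) (fun r x => jacDot W r x) := by
  obtain ⟨c, M, hc, hM, hb⟩ := hA.exists_jac_bounds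
  refine .of_hasDerivAt hA.continuous_jac hA.continuous_jacDot (fun x r => hA.hasDerivAt_jac r x)
    (M := M) fun r hr x => ?_
  obtain ⟨h1, h2, h3⟩ := hb r hr x
  exact ⟨by rwa [abs_of_pos (hA.jac_pos hr x)], h3⟩

/-- Differentiation of an integral over a moving set. -/
theorem hasDerivWithinAt_image (hA : IsAdmissible Ω W T) {s : Set (Euc d)} (hs : MeasurableSet s)
    {N : ℝ → Euc d → ℝ} {k : ℕ} {A A' g : ℝ → Euc d → ℝ}
    (hF : Fam (volume.restrict s) T N k A A')
    (hD : L1Cont (volume.restrict s) T fun r z => N r z ^ k)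
    (hg : ∀ r ∈ Icc 0 T, ∀ x, g r (pert W r x) * jac W r x = A r x) {t : ℝ} (ht : t ∈ Icc 0 T) :
    IntegrableOn (g t) (pert W t '' s) ∧ IntegrableOn (A' t) s ∧
      HasDerivWithinAt (fun r => ∫ x in pert W r '' s, g r x) (∫ x in s, A' t x) (Icc 0 T) t := by
  obtain ⟨h1, h2, h3⟩ := hF.hasDerivWithinAt hA.pos.le hD ht
  have e : ∀ r ∈ Icc 0 T, ∫ x in pert W r '' s, g r x = ∫ x in s, A r x := fun r hr => by
    rw [hA.integral_image hr hs]
    simp only [hg r hr]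
  refine ⟨?_, h2, h3.congr e (e t ht)⟩
  rw [hA.integrableOn_image ht hs]
  simp only [hg t ht]
  exact h1

/-- Sobolev functions along the flow, dominated by a family that is continuous in `L¹`. -/
theorem exists_fam_sobolev (hA : IsAdmissible Ω W T) (hV : IsSmoothField Ω V)
    {J : WeakJet (Euc d)} (hJ : IsSobolevTwo 2 Ω Ω ⊤ J) :
    ∃ Q : ℝ → Euc d → ℝ, L1Cont (volume.restrict Ω) T Q ∧ (∀ r x, 0 ≤ Q r x) ∧
      ∀ N : ℝ → Euc d → ℝ, (∀ r x, 0 ≤ N r x ∧ Q r x ≤ N r x ^ 2) →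
        Fam (volume.restrict Ω) T N 1 (fun r x => J.val (pert W r x))
          (fun r x => J.grad (pert W r x) (W x)) ∧
        Fam (volume.restrict Ω) T N 1 (fun r x => J.grad (pert W r x) (V (pert W r x)))
          (fun r x => J.hess (pert W r x) (W x) (V (pert W r x)) +
            J.grad (pert W r x) (fderiv ℝ V (pert W r x) (W x))) := by
  obtain ⟨m, e, c, he, hce⟩ := exists_frame (⊤ : Submodule ℝ (Euc d))
  have hΩm := hA.isOpen.measurableSet
  have hΩf : volume Ω ≠ ⊤ := hA.isBounded.measure_lt_top.ne
  have hmaps : ∀ z ∈ Ω, ∀ r ∈ Icc (0 : ℝ) T, flow W r z ∈ Ω := fun z hz r hr =>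
    (hA.pert_mem_iff hr).2 hz
  obtain ⟨f, g, h, hF⟩ := exists_jetFamilies hA.isQuasiFlow hA.pos.le (O := fun _ => Ω)
    (fun _ => hA.isOpen) hΩm (p := 2) (J := J) (S := ⊤) (by norm_num)
    (fun _ => by rwa [inter_self]) hΩm hΩf hΩm hΩf hmaps hmaps
    (ae_of_all _ fun z hz => ⟨0, hmaps z hz⟩) (fun _ _ => Submodule.mem_top) he hce
  have hsq : ∀ {a q : Euc d → ℝ}, IsRep (fun _ => Ω) Ω a q → MemLp a 2 (volume.restrict Ω) →
      L1Cont (volume.restrict Ω) T fun r x => q (pert W r x) ^ 2 := by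
    intro a q hq ha
    have h1 : MemLp q 2 (volume.restrict Ω) :=
      hq.memLp (fun _ => hA.isOpen) hΩm (n := 0) (by rwa [inter_self])
    have h2 : MemLp q 2 := by
      rw [← indicator_eq_self.2 (show Function.support q ⊆ Ω from fun z hz => by
        by_contra hn; exact hz (hq.zero z hn))]
      exact (memLp_indicator_iff_restrict hΩm).2 h1
    exact .comp_flow hA.isQuasiFlow hΩf (hq.meas.pow_const 2) h2.integrable_sq
  -- The squares of all coordinates of the jet are summed, so √Q dominates each of them and Q is
  -- L¹-continuous. N stays free in order that several such majorants can be combined.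
  refine ⟨fun r x => f (pert W r x) ^ 2 + (∑ k, g k (pert W r x) ^ 2 +
    ∑ k, ∑ l, h k l (pert W r x) ^ 2), ?_, fun r x => by positivity, ?_⟩
  · refine (hsq hF.rep hJ.memLp_val).add (.add (.sum _ fun k => ?_) (.sum _ fun k => .sum _ fun l => ?_))
    · exact hsq (hF.rep_grad k) (hJ.memLp_grad _ (he k))
    · exact hsq (hF.rep_hess k l) (hJ.memLp_hess _ (he k) _ (he l))
  intro N hN
  have sg : ∀ r x k, g k (pert W r x) ^ 2 ≤ ∑ k, g k (pert W r x) ^ 2 := fun r x k =>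
    Finset.single_le_sum (f := fun k => g k (pert W r x) ^ 2) (fun _ _ => sq_nonneg _)
      (Finset.mem_univ k)
  have sh : ∀ r x k l, h k l (pert W r x) ^ 2 ≤ ∑ k, ∑ l, h k l (pert W r x) ^ 2 := fun r x k l =>
    (Finset.single_le_sum (f := fun l => h k l (pert W r x) ^ 2) (fun _ _ => sq_nonneg _)
      (Finset.mem_univ l)).trans
    (Finset.single_le_sum (f := fun k => ∑ l, h k l (pert W r x) ^ 2)
      (fun _ _ => Finset.sum_nonneg fun _ _ => sq_nonneg _) (Finset.mem_univ k))
  have p1 : ∀ r x, 0 ≤ ∑ k, g k (pert W r x) ^ 2 := fun r x => by positivity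
  have p2 : ∀ r x, 0 ≤ ∑ k, ∑ l, h k l (pert W r x) ^ 2 := fun r x => by positivity
  have bf : ∀ r x, |f (pert W r x)| ≤ N r x := fun r x => abs_le_of_sq_le_sq
    (by linarith [(hN r x).2, p1 r x, p2 r x]) (hN r x).1
  have bg : ∀ r x k, |g k (pert W r x)| ≤ N r x := fun r x k => abs_le_of_sq_le_sq
    (by linarith [(hN r x).2, sq_nonneg (f (pert W r x)), sg r x k, p2 r x]) (hN r x).1
  have bh : ∀ r x k l, |h k l (pert W r x)| ≤ N r x := fun r x k l => abs_le_of_sq_le_sq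
    (by linarith [(hN r x).2, sq_nonneg (f (pert W r x)), sh r x k l, p1 r x]) (hN r x).1
  obtain ⟨M, hM, hb⟩ := hV.exists_bound hA.isBounded
  obtain ⟨M', hM', hb'⟩ := hA.smooth.exists_bound hA.isBounded
  have hcb : ∀ k, ∀ {y : Euc d} {B : ℝ}, ‖y‖ ≤ B → |c k y| ≤ ‖c k‖ * B := fun k y B hy =>
    ((c k).le_opNorm y).trans (mul_le_mul_of_nonneg_left hy (norm_nonneg _))
  have dg : ∀ (v : ℝ → Euc d → Euc d) (B : ℝ), 0 ≤ B → (∀ r x, ‖v r x‖ ≤ B) →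
      DomBy (volume.restrict Ω) T N 1 fun r x => J.grad (pert W r x) (v r x) := by
    intro v B hB hv
    refine DomBy.congr (A := fun r x => ∑ k, c k (v r x) * g k (pert W r x)) (.sum _ fun k =>
      ⟨‖c k‖ * B, by positivity, fun r hr => ae_of_all _ fun x => ?_⟩) fun r hr =>
        (hF.grad_eq r hr).mono fun x hx => hx _ Submodule.mem_top
    rw [abs_mul, pow_one]
    exact mul_le_mul (hcb k (hv r x)) (bg r x k) (abs_nonneg _) (by positivity)
  have dh : DomBy (volume.restrict Ω) T N 1 fun r x =>
      J.hess (pert W r x) (W x) (V (pert W r x)) := by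
    refine DomBy.congr (A := fun r x => ∑ k, ∑ l, c k (W x) *
      (c l (V (pert W r x)) * h k l (pert W r x))) (.sum _ fun k => .sum _ fun l =>
        ⟨‖c k‖ * M' * (‖c l‖ * M), by positivity, fun r hr => ae_of_all _ fun x => ?_⟩) fun r hr =>
        (hF.hess_eq r hr).mono fun x hx => hx _ Submodule.mem_top _ Submodule.mem_top
    rw [abs_mul, abs_mul, pow_one, mul_assoc (‖c k‖ * M')]
    exact mul_le_mul (hcb k (hb' x).1)
      (mul_le_mul (hcb l (hb _).1) (bh r x k l) (abs_nonneg _) (by positivity))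
      (by positivity) (by positivity)
  refine ⟨⟨hF.val_family hΩm fun _ _ => Submodule.mem_top, ?_, dg (fun _ x => W x) M' hM'
    fun _ x => (hb' x).1⟩, ?_, dg (fun r x => V (pert W r x)) M hM fun _ _ => (hb _).1, dh.add
      (dg (fun r x => fderiv ℝ V (pert W r x) (W x)) (M * M') (by positivity) fun r x => ?_)⟩
  · refine DomBy.congr (A := fun r x => f (pert W r x)) ⟨1, zero_le_one, fun r _ => ae_of_all _
      fun x => by simpa using bf r x⟩ fun r hr => hF.val_eq r hr
  · exact hF.grad_family hA.pos.le hΩm (fun _ _ => Submodule.mem_top)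
      (hA.continuous_comp_pert hV) (hA.continuous_fderiv_comp_pert hV)
      (fun z r => hasDerivAt_comp_pert hV r z) fun _ _ _ _ => ⟨Submodule.mem_top, Submodule.mem_top⟩
  · exact ((fderiv ℝ V _).le_opNorm _).trans
      (mul_le_mul (hb _).2.1 (hb' x).1 (norm_nonneg _) hM)

end IsAdmissible

end NonlocalShape
end

/-! ### Time derivatives of the single integrals. -/

open Set Filter Topology MeasureTheory
open scoped ENNReal ContDiff

noncomputable section

namespace NonlocalShape

set_option linter.unusedSectionVars false

variable {d : ℕ} {P : Setting d} {W V : Euc d → Euc d} {T : ℝ}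

theorem Fam.const_of_sq_le {X : Type*} [MeasurableSpace X] {μ : Measure X} {N : ℝ → X → ℝ}
    {u : X → ℝ} (hu : AEStronglyMeasurable u μ) (h : ∀ r x, 0 ≤ N r x ∧ u x ^ 2 ≤ N r x ^ 2) :
    Fam μ T N 1 (fun _ x => u x) (fun _ _ => 0) :=
  .const hu ⟨1, zero_le_one, fun r _ => ae_of_all _ fun x => by
    simpa using abs_le_of_sq_le_sq (h r x).2 (h r x).1⟩

theorem L1Cont.sq_sqrt {X : Type*} [MeasurableSpace X] {μ : Measure X} {Q : ℝ → X → ℝ}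
    (h : L1Cont μ T Q) (h0 : ∀ r x, 0 ≤ Q r x) : L1Cont μ T fun r x => Real.sqrt (Q r x) ^ 2 := by
  have : (fun r x => Real.sqrt (Q r x) ^ 2) = Q := funext fun r => funext fun x =>
    Real.sq_sqrt (h0 r x)
  rwa [this]

namespace Setting

/-- Pulling back freezes the interface: the indicator of F_r(Ω_i) at F_r(x) is that of Ω_i at x.
What is left are the f_i, which are Sobolev functions on all of Ω. -/
theorem force_pert (hA : IsAdmissible P.Ω W T) {r : ℝ} (hr : r ∈ Icc 0 T) (x : Euc d) :
    P.force (P.moved W r) (pert W r x) =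
      ∑ i, (P.part i).indicator 1 x * (P.f i).val (pert W r x) := by
  refine Finset.sum_congr rfl fun i _ => ?_
  rw [moved, indicator_image (hA.injective hr)]
  by_cases h : x ∈ P.part i <;> simp [h]

theorem forceGrad_pert (hA : IsAdmissible P.Ω W T) {r : ℝ} (hr : r ∈ Icc 0 T) (x v : Euc d) :
    P.forceGrad (P.moved W r) (pert W r x) v =
      ∑ i, (P.part i).indicator 1 x * (P.f i).grad (pert W r x) v := by
  rw [forceGrad, sum_apply]
  refine Finset.sum_congr rfl fun i _ => ?_
  rw [moved, indicator_image (hA.injective hr)]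
  by_cases h : x ∈ P.part i <;> simp [h]

theorem forceHess_pert (hA : IsAdmissible P.Ω W T) {r : ℝ} (hr : r ∈ Icc 0 T) (x v v' : Euc d) :
    P.forceHess (P.moved W r) (pert W r x) v v' =
      ∑ i, (P.part i).indicator 1 x * (P.f i).hess (pert W r x) v v' := by
  rw [forceHess, sum_apply, sum_apply]
  refine Finset.sum_congr rfl fun i _ => ?_
  rw [moved, indicator_image (hA.injective hr)]
  by_cases h : x ∈ P.part i <;> simp [h]

theorem adjF_hasDerivWithinAt (hA : IsAdmissible P.Ω W T)
    (hJ : IsSobolevTwo 2 P.Ω P.Ω ⊤ P.ubar) {u φ : Euc d → ℝ}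
    (hu : MemLp u 2 (volume.restrict P.Ω)) (hφ : MemLp φ 2 (volume.restrict P.Ω))
    {t : ℝ} (ht : t ∈ Icc 0 T) :
    IntegrableOn (fun x => (pull W t u x - P.ubar.val x) * pull W t φ x) (pert W t '' P.Ω) ∧
    IntegrableOn (P.adjDot W t u φ) P.Ω ∧
      HasDerivWithinAt (fun r => P.adjF W r (pull W r u) (pull W r φ))
        (∫ x in P.Ω, P.adjDot W t u φ x) (Icc 0 T) t := by
  obtain ⟨Q, hQ, hQ0, hfam⟩ := hA.exists_fam_sobolev hA.smooth hJ
  -- With N = √R each of ū∘F_r, u and φ has degree one, and their products are dominated by N² = R,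
  -- which is L¹-continuous.
  set R : ℝ → Euc d → ℝ := fun r x => Q r x + (u x ^ 2 + φ x ^ 2) with hR
  have hRc : L1Cont (volume.restrict P.Ω) T R :=
    hQ.add (.add (.const hu.integrable_sq) (.const hφ.integrable_sq))
  have hR0 : ∀ r x, 0 ≤ R r x := fun r x => by have := hQ0 r x; positivity
  set N : ℝ → Euc d → ℝ := fun r x => Real.sqrt (R r x) with hN
  have hN0 : ∀ r x, 0 ≤ N r x := fun r x => Real.sqrt_nonneg _
  have hN2 : ∀ r x, N r x ^ 2 = R r x := fun r x => Real.sq_sqrt (hR0 r x)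
  have hT := hA.pos.le
  have f1 := (hfam N fun r x => ⟨hN0 r x, by rw [hN2]; simp only [hR]; linarith [sq_nonneg (u x), sq_nonneg (φ x)]⟩).1
  have f2 : Fam (volume.restrict P.Ω) T N 1 (fun _ x => u x) (fun _ _ => 0) :=
    .const_of_sq_le hu.1 fun r x => ⟨hN0 r x, by rw [hN2]; simp only [hR]; linarith [hQ0 r x, sq_nonneg (φ x)]⟩
  have f3 : Fam (volume.restrict P.Ω) T N 1 (fun _ x => φ x) (fun _ _ => 0) :=
    .const_of_sq_le hφ.1 fun r x => ⟨hN0 r x, by rw [hN2]; simp only [hR]; linarith [hQ0 r x, sq_nonneg (u x)]⟩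
  have key := hA.hasDerivWithinAt_image hA.isOpen.measurableSet
    (((f2.sub hT hN0 f1).mul hT hN0 f3).mul hT hN0 (hA.fam_jac _ N)) (hRc.sq_sqrt hR0)
    (g := fun r x => (pull W r u x - P.ubar.val x) * pull W r φ x)
    (fun r hr x => by simp only [hA.pull_pert hr]) ht
  have e : ∀ x, P.adjDot W t u φ x = -(((0 - P.ubar.grad (pert W t x) (W x)) * φ x +
      (u x - P.ubar.val (pert W t x)) * 0) * jac W t x +
      (u x - P.ubar.val (pert W t x)) * φ x * jacDot W t x) := fun x => by
    simp only [adjDot]; ring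
  refine ⟨key.1, ?_, ?_⟩
  · rw [funext e]; exact key.2.1.neg
  · simp only [e]
    rw [integral_neg]
    exact key.2.2.neg

theorem objSD_hasDerivWithinAt (hA : IsAdmissible P.Ω W T) (hV : IsSmoothField P.Ω V)
    (hJ : IsSobolevTwo 2 P.Ω P.Ω ⊤ P.ubar) {u : Euc d → ℝ}
    (hu : MemLp u 2 (volume.restrict P.Ω)) {t : ℝ} (ht : t ∈ Icc 0 T) :
    IntegrableOn (P.objInt V (pull W t u)) (pert W t '' P.Ω) ∧
    IntegrableOn (P.objDot V W t u) P.Ω ∧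
      HasDerivWithinAt (fun r => P.objSD V W r (pull W r u))
        (∫ x in P.Ω, P.objDot V W t u x) (Icc 0 T) t := by
  obtain ⟨Q, hQ, hQ0, hfam⟩ := hA.exists_fam_sobolev hV hJ
  set R : ℝ → Euc d → ℝ := fun r x => Q r x + u x ^ 2 with hR
  have hRc : L1Cont (volume.restrict P.Ω) T R := hQ.add (.const hu.integrable_sq)
  have hR0 : ∀ r x, 0 ≤ R r x := fun r x => by have := hQ0 r x; positivity
  set N : ℝ → Euc d → ℝ := fun r x => Real.sqrt (R r x) with hN
  have hN0 : ∀ r x, 0 ≤ N r x := fun r x => Real.sqrt_nonneg _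
  have hN2 : ∀ r x, N r x ^ 2 = R r x := fun r x => Real.sq_sqrt (hR0 r x)
  have hT := hA.pos.le
  obtain ⟨f1, f1'⟩ := hfam N fun r x => ⟨hN0 r x, by rw [hN2]; simp only [hR]; linarith [sq_nonneg (u x)]⟩
  have f2 : Fam (volume.restrict P.Ω) T N 1 (fun _ x => u x) (fun _ _ => 0) :=
    .const_of_sq_le hu.1 fun r x => ⟨hN0 r x, by rw [hN2]; simp only [hR]; linarith [hQ0 r x]⟩
  have f3 := f2.sub hT hN0 f1
  have f4 := (f3.mul hT hN0 f1').neg hT hN0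
  have f5 := ((f3.mul hT hN0 f3).mul hT hN0 (hA.fam_divg hV _ N)).mul hT hN0 (.real (1 / 2))
  have key := hA.hasDerivWithinAt_image hA.isOpen.measurableSet
    ((Fam.add f4 f5).mul hT hN0 (hA.fam_jac _ N))
    (hRc.sq_sqrt hR0)
    (g := fun r x => P.objInt V (pull W r u) x)
    (fun r hr x => by simp only [objInt, hA.pull_pert hr]; ring) ht
  refine ⟨key.1, ?_, ?_⟩
  · refine key.2.1.congr (ae_of_all _ fun x => ?_)
    simp only [objDot]; ring
  · refine key.2.2.congr_deriv (integral_congr_ae (ae_of_all _ fun x => ?_))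
    simp only [objDot]; ring

theorem exists_fam_force (hA : IsAdmissible P.Ω W T) (hV : IsSmoothField P.Ω V)
    (hp : ∀ i, MeasurableSet (P.part i))
    (hJ : ∀ i, IsSobolevTwo 2 P.Ω P.Ω ⊤ (P.f i)) :
    ∃ Q : ℝ → Euc d → ℝ, L1Cont (volume.restrict P.Ω) T Q ∧ (∀ r x, 0 ≤ Q r x) ∧
      ∀ N : ℝ → Euc d → ℝ, (∀ r x, 0 ≤ N r x ∧ Q r x ≤ N r x ^ 2) →
        Fam (volume.restrict P.Ω) T N 1 (fun r x => P.force (P.moved W r) (pert W r x))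
          (fun r x => P.forceGrad (P.moved W r) (pert W r x) (W x)) ∧
        Fam (volume.restrict P.Ω) T N 1
          (fun r x => P.forceGrad (P.moved W r) (pert W r x) (V (pert W r x)))
          (fun r x => P.forceHess (P.moved W r) (pert W r x) (W x) (V (pert W r x)) +
            P.forceGrad (P.moved W r) (pert W r x) (fderiv ℝ V (pert W r x) (W x))) := by
  choose Q hQ hQ0 hfam using fun i => hA.exists_fam_sobolev hV (hJ i)
  refine ⟨fun r x => ∑ i, Q i r x, .sum _ hQ, fun r x => Finset.sum_nonneg fun i _ => hQ0 i r x,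
    fun N hN => ?_⟩
  have hT := hA.pos.le
  have hi : ∀ i, Fam (volume.restrict P.Ω) T N 0 (fun _ x => (P.part i).indicator 1 x)
      (fun _ _ => 0) := fun i => .const
    ((stronglyMeasurable_one.indicator (hp i)).aestronglyMeasurable)
    ⟨1, zero_le_one, fun r _ => ae_of_all _ fun x => by
      by_cases h : x ∈ P.part i <;> simp [h]⟩
  have hf := fun i => hfam i N fun r x => ⟨(hN r x).1, (Finset.single_le_sum
    (f := fun i => Q i r x) (fun j _ => hQ0 j r x) (Finset.mem_univ i)).trans (hN r x).2⟩
  constructor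
  · have := Fam.sum fun i => (hi i).mul hT (fun r x => (hN r x).1) (hf i).1
    refine (this.congr (B := fun r x => P.force (P.moved W r) (pert W r x)) fun r hr =>
      ae_of_all _ fun x => ⟨force_pert hA hr x, ?_⟩)
    simp only [zero_mul, zero_add]
    exact forceGrad_pert hA hr x _
  · have := Fam.sum fun i => (hi i).mul hT (fun r x => (hN r x).1) (hf i).2
    refine (this.congr (B := fun r x => P.forceGrad (P.moved W r) (pert W r x) (V (pert W r x)))
      fun r hr => ae_of_all _ fun x => ⟨forceGrad_pert hA hr x _, ?_⟩)
    simp only [zero_mul, zero_add, mul_add, Finset.sum_add_distrib]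
    rw [forceGrad_pert hA hr, forceHess_pert hA hr]

theorem forSD_hasDerivWithinAt (hA : IsAdmissible P.Ω W T) (hV : IsSmoothField P.Ω V)
    (hp : ∀ i, MeasurableSet (P.part i)) (hJ : ∀ i, IsSobolevTwo 2 P.Ω P.Ω ⊤ (P.f i))
    {v : Euc d → ℝ} (hv : MemLp v 2 (volume.restrict P.Ω)) {t : ℝ} (ht : t ∈ Icc 0 T) :
    (IntegrableOn (P.forInt (P.moved W t) V (pull W t v)) (pert W t '' P.Ω) ∧
    IntegrableOn (P.forDot V W t v) P.Ω ∧
      HasDerivWithinAt (fun r => P.forSD V W r (pull W r v))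
        (∫ x in P.Ω, P.forDot V W t v x) (Icc 0 T) t) ∧
    IntegrableOn (fun x => P.force (P.moved W t) x * pull W t v x) (pert W t '' P.Ω) ∧
      DifferentiableWithinAt ℝ (fun r => P.linF W r (pull W r v)) (Icc 0 T) t := by
  obtain ⟨Q, hQ, hQ0, hfam⟩ := exists_fam_force hA hV hp hJ
  set R : ℝ → Euc d → ℝ := fun r x => Q r x + v x ^ 2 with hR
  have hRc : L1Cont (volume.restrict P.Ω) T R := hQ.add (.const hv.integrable_sq)
  have hR0 : ∀ r x, 0 ≤ R r x := fun r x => by have := hQ0 r x; positivity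
  set N : ℝ → Euc d → ℝ := fun r x => Real.sqrt (R r x) with hN
  have hN0 : ∀ r x, 0 ≤ N r x := fun r x => Real.sqrt_nonneg _
  have hN2 : ∀ r x, N r x ^ 2 = R r x := fun r x => Real.sq_sqrt (hR0 r x)
  have hT := hA.pos.le
  obtain ⟨f1, f1'⟩ := hfam N fun r x => ⟨hN0 r x, by rw [hN2]; simp only [hR]; linarith [sq_nonneg (v x)]⟩
  have f2 : Fam (volume.restrict P.Ω) T N 1 (fun _ x => v x) (fun _ _ => 0) :=
    .const_of_sq_le hv.1 fun r x => ⟨hN0 r x, by rw [hN2]; simp only [hR]; linarith [hQ0 r x]⟩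
  constructor
  · have f3 := (f1.mul hT hN0 f2).mul hT hN0 (hA.fam_divg hV _ N)
    have key := hA.hasDerivWithinAt_image hA.isOpen.measurableSet
      ((Fam.add (f2.mul hT hN0 f1') f3).mul hT hN0 (hA.fam_jac _ N)) (hRc.sq_sqrt hR0)
      (g := fun r x => P.forInt (P.moved W r) V (pull W r v) x)
      (fun r hr x => by simp only [forInt, hA.pull_pert hr]) ht
    refine ⟨key.1, ?_, ?_⟩
    · refine key.2.1.congr (ae_of_all _ fun x => ?_)
      simp only [forDot]; ring
    · refine key.2.2.congr_deriv (integral_congr_ae (ae_of_all _ fun x => ?_))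
      simp only [forDot]; ring
  · have key := hA.hasDerivWithinAt_image hA.isOpen.measurableSet
      ((f1.mul hT hN0 f2).mul hT hN0 (hA.fam_jac _ N)) (hRc.sq_sqrt hR0)
      (g := fun r x => P.force (P.moved W r) x * pull W r v x)
      (fun r hr x => by simp only [hA.pull_pert hr]) ht
    exact ⟨key.1, key.2.2.differentiableWithinAt⟩

end Setting

end NonlocalShape
end

/-! ### The glued kernel along the flow. -/

open Set Filter Topology MeasureTheory
open scoped ENNReal ContDiff

noncomputable section

namespace NonlocalShape

set_option linter.unusedSectionVars false

section Indicator

variable {X : Type*} [MeasurableSpace X] {μ : Measure X} {T : ℝ} {E : Set X}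

/-- Families on the different pieces of the domain are extended by zero so that they can be added on
one common set. -/
theorem ACFamily.indicator {a a' : ℝ → X → ℝ} (hE : MeasurableSet E)
    (h : ACFamily (μ.restrict E) T a a') :
    ACFamily μ T (fun r => E.indicator (a r)) (fun r => E.indicator (a' r)) where
  meas := by
    have : Function.uncurry (fun r => E.indicator (a r)) =
        (univ ×ˢ E : Set (ℝ × X)).indicator (Function.uncurry a) := by
      ext ⟨r, z⟩; by_cases hz : z ∈ E <;> simp [hz]
    rw [this]; exact h.meas.indicator (MeasurableSet.univ.prod hE)
  meas' := by
    have : Function.uncurry (fun r => E.indicator (a' r)) =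
        (univ ×ˢ E : Set (ℝ × X)).indicator (Function.uncurry a') := by
      ext ⟨r, z⟩; by_cases hz : z ∈ E <;> simp [hz]
    rw [this]; exact h.meas'.indicator (MeasurableSet.univ.prod hE)
  integ := by
    filter_upwards [(ae_restrict_iff' hE).1 h.integ] with z hz
    by_cases hzE : z ∈ E
    · simpa [hzE] using hz hzE
    · simp [hzE]
  ftc := fun t ht => by
    filter_upwards [(ae_restrict_iff' hE).1 (h.ftc t ht)] with z hz
    by_cases hzE : z ∈ E
    · simpa [hzE] using hz hzE
    · simp [hzE]
  cont' := fun r r₀ h₀ hr ht => by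
    obtain ⟨φ, hφ, hae⟩ := h.cont' r r₀ h₀ hr ht
    refine ⟨φ, hφ, ?_⟩
    filter_upwards [(ae_restrict_iff' hE).1 hae] with z hz
    by_cases hzE : z ∈ E
    · simpa [hzE] using hz hzE
    · simp [hzE]

theorem AEFamily.indicator {A A' : ℝ → X → ℝ} (hE : MeasurableSet E)
    (h : AEFamily (μ.restrict E) T A A') :
    AEFamily μ T (fun r => E.indicator (A r)) (fun r => E.indicator (A' r)) := by
  obtain ⟨a, a', ha, hae⟩ := h
  refine ⟨_, _, ha.indicator hE, fun r hr => ?_⟩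
  filter_upwards [(ae_restrict_iff' hE).1 (hae r hr)] with z hz
  by_cases hzE : z ∈ E
  · simpa [hzE] using hz hzE
  · simp [hzE]

end Indicator

variable {d : ℕ} {P : Setting d} {W V : Euc d → Euc d} {T : ℝ}

/-- The geometry of the pieces of the domain. -/
structure Setting.Geometry (P : Setting d) : Prop where
  isOpen_Ω : IsOpen P.Ω
  isBounded_dom : Bornology.IsBounded P.dom
  isOpen_part : ∀ i, IsOpen (P.part i)
  part_subset : ∀ i, P.part i ⊆ P.Ω
  disjoint_part : ∀ i j, i ≠ j → Disjoint (P.part i) (P.part j)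
  measurableSet_I : MeasurableSet P.I
  notMem_Ω : ∀ x ∈ P.I, x ∉ P.Ω

namespace Setting

/-- A point at distance at least δ from Ω sees a vanishing kernel and cannot belong to I. So Ω ∪ I
is bounded and has finite volume. -/
theorem Standing.geometry (h : P.Standing) : P.Geometry := by
  obtain ⟨δ, hδ, φ, -, hker⟩ := h.truncated
  have hsub : ∀ i, P.part i ⊆ P.Ω := by
    intro i x hx
    rw [h.decomposition]
    fin_cases i
    · exact Or.inl (Or.inl hx)
    · exact Or.inr hx
  have hI : P.I ⊆ Metric.thickening δ P.Ω := by
    intro y hy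
    rw [h.interaction] at hy
    obtain ⟨x, hx⟩ : ∃ x ∈ P.Ω, ENNReal.ofReal (P.kern P.part (x, y) + P.kern P.part (y, x)) ≠ 0 := by
      by_contra! hcon
      have : ∫⁻ x in P.Ω, ENNReal.ofReal (P.kern P.part (x, y) + P.kern P.part (y, x)) = 0 := by
        rw [setLIntegral_congr_fun h.isOpen_Ω.measurableSet (fun x hx => hcon x hx)]
        simp
      exact hy.2.ne' this
    refine Metric.mem_thickening_iff.2 ⟨x, hx.1, ?_⟩
    by_contra hd
    refine hx.2 ?_
    rw [hker, hker, indicator_of_notMem, indicator_of_notMem]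
    · simp
    · rw [Metric.mem_ball, dist_comm]; exact hd
    · rw [Metric.mem_ball]; exact hd
  exact
    { isOpen_Ω := h.isOpen_Ω
      isBounded_dom := h.isBounded_Ω.union (h.isBounded_Ω.thickening.subset hI)
      isOpen_part := h.isOpen_part
      part_subset := hsub
      disjoint_part := by
        intro i j hij
        fin_cases i <;> fin_cases j <;>
          first | exact absurd rfl hij | exact h.disjoint_part | exact h.disjoint_part.symm
      measurableSet_I := h.measurableSet_I
      notMem_Ω := fun x hx => by rw [h.interaction] at hx; exact hx.1 }

/-- The part of the assumptions on the kernels away from the diagonal that is common to both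
classes of kernels. -/
structure OffDiagSobolev (P : Setting d) : Prop where
  inner : ∀ n : ℕ, 0 < n → ∀ i j,
    IsSobolevTwo ⊤ ((P.Ω ×ˢ P.Ω) ∩ far n) ((P.Ω ×ˢ P.Ω) ∩ far n) ⊤ (P.γ i j)
  outer_left : ∀ n : ℕ, 0 < n → ∀ i,
    IsSobolevTwo ⊤ ((P.Ω ×ˢ univ) ∩ far n) ((P.Ω ×ˢ P.I) ∩ far n)
      ((⊤ : Submodule ℝ (Euc d)).prod ⊥) (P.γI i)
  outer_right : ∀ n : ℕ, 0 < n → ∀ i,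
    IsSobolevTwo ⊤ ((univ ×ˢ P.Ω) ∩ far n) ((P.I ×ˢ P.Ω) ∩ far n)
      ((⊥ : Submodule ℝ (Euc d)).prod ⊤) (P.γI i)

theorem S1Singular.offDiagSobolev {s : ℝ} (h : P.S1Singular s) : P.OffDiagSobolev :=
  ⟨h.inner, h.outer_left, h.outer_right⟩

end Setting

theorem IsWeakDirDeriv.restrict {X : Type*} [NormedAddCommGroup X] [NormedSpace ℝ X]
    [MeasureSpace X] [BorelSpace X] {O D U : Set X} {e : X} {f g : X → ℝ}
    (h : IsWeakDirDeriv O D e f g) (hU : IsOpen U) (hUO : U ⊆ O) :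
    IsWeakDirDeriv U (D ∩ U) e f g := by
  intro φ hφ hφc hφU
  have h1 := h φ hφ hφc (hφU.trans hUO)
  have key : ∀ q η : X → ℝ, (∀ z, z ∉ U → η z = 0) →
      ∫ z in D ∩ U, q z * η z = ∫ z in D, q z * η z := by
    intro q η hη
    rw [inter_comm, ← Measure.restrict_restrict hU.measurableSet]
    exact setIntegral_eq_integral_of_forall_compl_eq_zero fun z hz => by rw [hη z hz, mul_zero]
  rw [key f _ fun z hz => ?_, key g _ fun z hz => ?_, h1]
  · exact image_eq_zero_of_notMem_tsupport fun hz' => hz (hφU hz')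
  · rw [image_eq_zero_of_notMem_tsupport fun hz' => hz (hφU (tsupport_fderiv_subset ℝ hz'))]
    rfl

theorem IsSobolevTwo.restrict {X : Type*} [NormedAddCommGroup X] [NormedSpace ℝ X]
    [MeasureSpace X] [BorelSpace X] {O D U : Set X} {p : ℝ≥0∞} {S : Submodule ℝ X} {J : WeakJet X}
    (h : IsSobolevTwo p O D S J) (hU : IsOpen U) (hUO : U ⊆ O) :
    IsSobolevTwo p U (D ∩ U) S J where
  memLp_val := h.memLp_val.mono_measure (Measure.restrict_mono inter_subset_left le_rfl)
  memLp_grad e he := (h.memLp_grad e he).mono_measure (Measure.restrict_mono inter_subset_left le_rfl)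
  memLp_hess e he e' he' :=
    (h.memLp_hess e he e' he').mono_measure (Measure.restrict_mono inter_subset_left le_rfl)
  weak_grad e he := (h.weak_grad e he).restrict hU hUO
  weak_hess e he e' he' := (h.weak_hess e he e' he').restrict hU hUO

theorem isOpen_far (n : ℕ) : IsOpen (Setting.far n : Set (Euc d × Euc d)) :=
  isOpen_lt continuous_const continuous_dist

theorem Setting.S1Integrable.offDiagSobolev (h : P.S1Integrable) (hg : P.Geometry) :
    P.OffDiagSobolev where
  inner n _ i j := by
    have := (h.inner i j).restrict ((hg.isOpen_Ω.prod hg.isOpen_Ω).inter (isOpen_far n))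
      inter_subset_left
    rwa [← inter_assoc, inter_self] at this
  outer_left n _ i := by
    have := (h.outer_left i).restrict ((hg.isOpen_Ω.prod isOpen_univ).inter (isOpen_far n))
      inter_subset_left
    rwa [← inter_assoc, prod_inter_prod, inter_self, inter_univ] at this
  outer_right n _ i := by
    have := (h.outer_right i).restrict ((isOpen_univ.prod hg.isOpen_Ω).inter (isOpen_far n))
      inter_subset_left
    rwa [← inter_assoc, prod_inter_prod, inter_self, inter_univ] at this

theorem volume_diagonal_eq_zero (hd : 0 < d) : volume {z : Euc d × Euc d | z.1 = z.2} = 0 := by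
  have : Nonempty (Fin d) := ⟨⟨0, hd⟩⟩
  rw [Measure.volume_eq_prod, Measure.measure_prod_null (measurableSet_eq_fun measurable_fst
    measurable_snd)]
  refine ae_of_all _ fun x => ?_
  have : Prod.mk x ⁻¹' {z : Euc d × Euc d | z.1 = z.2} = {x} := by
    ext y; simp [eq_comm]
  change volume (Prod.mk x ⁻¹' {z : Euc d × Euc d | z.1 = z.2}) = 0
  rw [this]
  simp

theorem ae_fst_ne_snd (hd : 0 < d) : ∀ᵐ z : Euc d × Euc d, z.1 ≠ z.2 := by
  rw [ae_iff]; simpa using volume_diagonal_eq_zero hd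

section Glue

variable {M : Type*} [AddCommMonoid M]

theorem glue_apply {X : Type*} [NormedAddCommGroup X] [NormedSpace ℝ X] {Y : Type*}
    [NormedAddCommGroup Y] [NormedSpace ℝ Y] {A : Fin 2 → Set (Euc d)} {I : Set (Euc d)}
    {g : Fin 2 → Fin 2 → Euc d × Euc d → X →L[ℝ] Y} {gI : Fin 2 → Euc d × Euc d → X →L[ℝ] Y}
    (z : Euc d × Euc d) (v : X) :
    glue A I g gI z v = glue A I (fun i j z => g i j z v) (fun i z => gI i z v) z := by
  have key : ∀ (s : Set (Euc d × Euc d)) (q : Euc d × Euc d → X →L[ℝ] Y),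
      s.indicator q z v = s.indicator (fun z => q z v) z := fun s q => by
    by_cases h : z ∈ s <;> simp [h]
  simp only [glue, add_apply, sum_apply, key]

theorem glue_congr {A : Fin 2 → Set (Euc d)} {I : Set (Euc d)}
    {g g' : Fin 2 → Fin 2 → Euc d × Euc d → M} {gI gI' : Fin 2 → Euc d × Euc d → M}
    {z : Euc d × Euc d} (h : ∀ i j, g i j z = g' i j z) (hI : ∀ i, gI i z = gI' i z) :
    glue A I g gI z = glue A I g' gI' z := by
  have key : ∀ (s : Set (Euc d × Euc d)) (q q' : Euc d × Euc d → M), q z = q' z →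
      s.indicator q z = s.indicator q' z := fun s q q' hq => by
    by_cases h : z ∈ s <;> simp [h, hq]
  simp only [glue]
  congr 1
  · exact Finset.sum_congr rfl fun i _ => Finset.sum_congr rfl fun j _ => key _ _ _ (h i j)
  · exact Finset.sum_congr rfl fun i _ => key _ _ _ (hI i)

/-- As for the forcing term, the pieces stop moving after the pull-back; here I is pointwise fixed
because the field vanishes outside Ω. -/
theorem glue_pert2 (hg : P.Geometry) (hA : IsAdmissible P.Ω W T) {r : ℝ} (hr : r ∈ Icc 0 T)
    (g : Fin 2 → Fin 2 → Euc d × Euc d → M) (gI : Fin 2 → Euc d × Euc d → M) (z : Euc d × Euc d) :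
    glue (P.moved W r) P.I g gI (pert2 W r z) =
      glue P.part P.I (fun i j z => g i j (pert2 W r z)) (fun i z => gI i (pert2 W r z)) z := by
  classical
  have m1 : ∀ i x, pert W r x ∈ P.moved W r i ↔ x ∈ P.part i := fun i x =>
    (hA.injective hr).mem_set_image
  have m2 : ∀ x, pert W r x ∈ P.I ↔ x ∈ P.I := by
    intro x
    by_cases hx : x ∈ P.Ω
    · exact ⟨fun h => absurd ((hA.pert_mem_iff hr).2 hx) (hg.notMem_Ω _ h),
        fun h => absurd hx (hg.notMem_Ω _ h)⟩
    · rw [hA.pert_of_notMem r hx]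
  simp only [glue, indicator_apply, mem_prod, mem_union, pert2, m1, m2]

end Glue

namespace Setting

theorem Geometry.isBounded_Ω (hg : P.Geometry) : Bornology.IsBounded P.Ω :=
  hg.isBounded_dom.subset subset_union_left

theorem Geometry.measurableSet_dom (hg : P.Geometry) : MeasurableSet P.dom :=
  hg.isOpen_Ω.measurableSet.union hg.measurableSet_I

theorem Geometry.volume_dom_prod (hg : P.Geometry) : volume (P.dom ×ˢ P.dom) ≠ ⊤ :=
  (hg.isBounded_dom.prod hg.isBounded_dom).measure_lt_top.ne

theorem Geometry.aeFamily_glue (hg : P.Geometry)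
    {a a' : Fin 2 → Fin 2 → ℝ → Euc d × Euc d → ℝ} {b b' : Fin 2 → ℝ → Euc d × Euc d → ℝ}
    (h1 : ∀ i j, AEFamily (volume.restrict (P.part i ×ˢ P.part j)) T (a i j) (a' i j))
    (h2 : ∀ i, AEFamily (volume.restrict (P.part i ×ˢ P.I)) T (b i) (b' i))
    (h3 : ∀ i, AEFamily (volume.restrict (P.I ×ˢ P.part i)) T (b i) (b' i)) :
    AEFamily (volume.restrict (P.dom ×ˢ P.dom)) T
      (fun r z => glue P.part P.I (fun i j => a i j r) (fun i => b i r) z)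
      (fun r z => glue P.part P.I (fun i j => a' i j r) (fun i => b' i r) z) := by
  have hm := fun i => (hg.isOpen_part i).measurableSet
  have hpd := fun i => (hg.part_subset i).trans (subset_union_left (t := P.I))
  have hres : ∀ {E : Set (Euc d × Euc d)} {A A' : ℝ → Euc d × Euc d → ℝ}, MeasurableSet E →
      E ⊆ P.dom ×ˢ P.dom → AEFamily (volume.restrict E) T A A' →
      AEFamily (volume.restrict (P.dom ×ˢ P.dom)) T (fun r => E.indicator (A r))
        (fun r => E.indicator (A' r)) := by
    intro E A A' hE hsub h
    refine .indicator hE ?_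
    rwa [Measure.restrict_restrict hE, inter_eq_left.2 hsub]
  have hdisj : ∀ i, Disjoint (P.part i ×ˢ P.I) (P.I ×ˢ P.part i) := fun i =>
    disjoint_left.2 fun z hz hz' => hg.notMem_Ω _ hz'.1 (hg.part_subset i hz.1)
  have e1 := AEFamily.sum fun i => AEFamily.sum fun j => hres ((hm i).prod (hm j))
    (prod_mono (hpd i) (hpd j)) (h1 i j)
  have e2 := AEFamily.sum fun i => (hres ((hm i).prod hg.measurableSet_I)
    (prod_mono (hpd i) subset_union_right) (h2 i)).add
    (hres (hg.measurableSet_I.prod (hm i)) (prod_mono subset_union_right (hpd i)) (h3 i))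
  refine (e1.add e2).congr fun r hr => ae_of_all _ fun z => ?_
  simp only [glue, indicator_union_of_disjoint (hdisj _), and_self]

theorem kern_pert2 (hg : P.Geometry) (hA : IsAdmissible P.Ω W T) {r : ℝ} (hr : r ∈ Icc 0 T)
    (z : Euc d × Euc d) : P.kern (P.moved W r) (pert2 W r z) =
      glue P.part P.I (fun i j z => (P.γ i j).val (pert2 W r z))
        (fun i z => (P.γI i).val (pert2 W r z)) z :=
  glue_pert2 hg hA hr _ _ z

theorem kernGrad_pert2 (hg : P.Geometry) (hA : IsAdmissible P.Ω W T) {r : ℝ} (hr : r ∈ Icc 0 T)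
    (z : Euc d × Euc d) (v : Euc d × Euc d → Euc d × Euc d) :
    P.kernGrad (P.moved W r) (pert2 W r z) (v z) =
      glue P.part P.I (fun i j z => (P.γ i j).grad (pert2 W r z) (v z))
        (fun i z => (P.γI i).grad (pert2 W r z) (v z)) z := by
  rw [kernGrad, glue_pert2 hg hA hr, glue_apply]
  exact glue_congr (fun _ _ => rfl) fun _ => rfl

theorem kernHess_pert2 (hg : P.Geometry) (hA : IsAdmissible P.Ω W T) {r : ℝ} (hr : r ∈ Icc 0 T)
    (z : Euc d × Euc d) (v v' : Euc d × Euc d → Euc d × Euc d) :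
    P.kernHess (P.moved W r) (pert2 W r z) (v z) (v' z) =
      glue P.part P.I (fun i j z => (P.γ i j).hess (pert2 W r z) (v z) (v' z))
        (fun i z => (P.γI i).hess (pert2 W r z) (v z) (v' z)) z := by
  rw [kernHess, glue_pert2 hg hA hr, glue_apply, glue_apply]
  exact glue_congr (fun _ _ => rfl) fun _ => rfl

theorem glue_add' {A : Fin 2 → Set (Euc d)} {I : Set (Euc d)}
    (g g' : Fin 2 → Fin 2 → Euc d × Euc d → ℝ) (gI gI' : Fin 2 → Euc d × Euc d → ℝ)
    (z : Euc d × Euc d) :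
    glue A I (fun i j z => g i j z + g' i j z) (fun i z => gI i z + gI' i z) z =
      glue A I g gI z + glue A I g' gI' z := by
  simp only [glue, indicator_add, Finset.sum_add_distrib]
  ring

/-- The derivative of `V` in the two directions. -/
def pairDeriv (V : Euc d → Euc d) (y w : Euc d × Euc d) : Euc d × Euc d :=
  (fderiv ℝ V y.1 w.1, fderiv ℝ V y.2 w.2)

/-- The kernel and the derivative of the kernel in the direction `V`, transported by the flow, are
absolutely continuous in time. -/
theorem Geometry.aeFamily_kern (hg : P.Geometry) (hd : 0 < d) (hA : IsAdmissible P.Ω W T)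
    (hV : IsSmoothField P.Ω V) (hS : P.OffDiagSobolev) :
    AEFamily (volume.restrict (P.dom ×ˢ P.dom)) T
      (fun r z => P.kern (P.moved W r) (pert2 W r z))
      (fun r z => P.kernGrad (P.moved W r) (pert2 W r z) (pairField W z)) ∧
    AEFamily (volume.restrict (P.dom ×ˢ P.dom)) T
      (fun r z => P.kernGrad (P.moved W r) (pert2 W r z) (pairField V (pert2 W r z)))
      (fun r z => P.kernHess (P.moved W r) (pert2 W r z) (pairField W z)
          (pairField V (pert2 W r z)) +
        P.kernGrad (P.moved W r) (pert2 W r z) (pairDeriv V (pert2 W r z) (pairField W z))) := by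
  obtain ⟨κ, hκ, hdist⟩ := hA.dist_pert
  have hΩm := hA.isOpen.measurableSet
  have hIm := hg.measurableSet_I
  have hdm := hg.measurableSet_dom
  have hm := fun i => (hg.isOpen_part i).measurableSet
  have hT := hA.pos.le
  have mI : ∀ x ∈ P.I, ∀ r, pert W r x = x := fun x hx r => hA.pert_of_notMem r (hg.notMem_Ω x hx)
  have mdom : ∀ x ∈ P.dom, ∀ r ∈ Icc 0 T, pert W r x ∈ P.dom := by
    rintro x (hx | hx) r hr
    · exact Or.inl ((hA.pert_mem_iff hr).2 hx)
    · rw [mI x hx]; exact Or.inr hx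
  -- The lower Lipschitz bound keeps the whole trajectory of an off-diagonal pair at a fixed
  -- positive distance from the diagonal. The shift to n + 1 is needed since the assumptions are
  -- made for positive indices only.
  have hfar : ∀ᵐ z : Euc d × Euc d, ∃ n : ℕ, ∀ r ∈ Icc 0 T, pert2 W r z ∈ far (n + 1) := by
    filter_upwards [ae_fst_ne_snd hd] with z hz
    obtain ⟨n, hn⟩ := exists_nat_one_div_lt (mul_pos hκ (dist_pos.2 hz))
    refine ⟨n, fun r hr => ?_⟩
    simp only [far, mem_ofPred_eq]
    push_cast
    exact hn.trans_le (hdist r hr _ _)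
  have cont_v : Continuous fun p : ℝ × (Euc d × Euc d) => pairField V (pert2 W p.1 p.2) :=
    ((hA.continuous_comp_pert hV).comp (by fun_prop :
      Continuous fun p : ℝ × (Euc d × Euc d) => (p.1, p.2.1))).prodMk
    ((hA.continuous_comp_pert hV).comp (by fun_prop :
      Continuous fun p : ℝ × (Euc d × Euc d) => (p.1, p.2.2)))
  have cont_v' : Continuous fun p : ℝ × (Euc d × Euc d) =>
      pairDeriv V (pert2 W p.1 p.2) (pairField W p.2) :=
    ((hA.continuous_fderiv_comp_pert hV).comp (by fun_prop :
      Continuous fun p : ℝ × (Euc d × Euc d) => (p.1, p.2.1))).prodMk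
    ((hA.continuous_fderiv_comp_pert hV).comp (by fun_prop :
      Continuous fun p : ℝ × (Euc d × Euc d) => (p.1, p.2.2)))
  have der_v : ∀ (z : Euc d × Euc d) r, HasDerivAt (fun r => pairField V (pert2 W r z))
      (pairDeriv V (pert2 W r z) (pairField W z)) r := fun z r =>
    (IsAdmissible.hasDerivAt_comp_pert hV r z.1).prodMk
      (IsAdmissible.hasDerivAt_comp_pert hV r z.2)
  -- The three kinds of pieces differ only in the subspace S. Next to I the fields have a zero
  -- component, so derivatives in the variable in Ω suffice.
  have piece : ∀ {O D E : Set (Euc d × Euc d)} {S : Submodule ℝ (Euc d × Euc d)}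
      {J : WeakJet (Euc d × Euc d)}, IsOpen O → MeasurableSet D → MeasurableSet E → D ⊆ O →
      E ⊆ P.dom ×ˢ P.dom →
      (∀ z ∈ E, ∀ r ∈ Icc 0 T, pert2 W r z ∈ D) →
      (∀ n : ℕ, 0 < n → IsSobolevTwo ⊤ (O ∩ far n) (D ∩ far n) S J) →
      (∀ z ∈ E, pairField W z ∈ S) →
      (∀ z ∈ E, ∀ r ∈ Icc 0 T, pairField V (pert2 W r z) ∈ S ∧
        pairDeriv V (pert2 W r z) (pairField W z) ∈ S) →
      AEFamily (volume.restrict E) T (fun r z => J.val (pert2 W r z))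
        (fun r z => J.grad (pert2 W r z) (pairField W z)) ∧
      AEFamily (volume.restrict E) T
        (fun r z => J.grad (pert2 W r z) (pairField V (pert2 W r z)))
        (fun r z => J.hess (pert2 W r z) (pairField W z) (pairField V (pert2 W r z)) +
          J.grad (pert2 W r z) (pairDeriv V (pert2 W r z) (pairField W z))) := by
    intro O D E S J hO hD hE hDO hEdom hED hJ hwS hvS
    obtain ⟨m, e, c, he, hce⟩ := exists_frame S
    obtain ⟨f, g, h, hF⟩ := exists_jetFamilies hA.isQuasiFlow_pair hT
      (O := fun n => O ∩ far (n + 1)) (D := D) (J := J) (S := S) (p := ⊤)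
      (fun n => hO.inter (isOpen_far _)) hD le_top
      (fun n => by
        have := hJ (n + 1) n.succ_pos
        rwa [← inter_assoc, inter_eq_left.2 hDO]) hE
      (measure_ne_top_of_subset hEdom hg.volume_dom_prod) (hdm.prod hdm) hg.volume_dom_prod
      (fun z hz r hr => ⟨mdom _ (hEdom hz).1 r hr, mdom _ (hEdom hz).2 r hr⟩) hED
      (by
        filter_upwards [hfar] with z hz hzE
        obtain ⟨n, hn⟩ := hz
        exact ⟨n, fun r hr => ⟨hDO (hED z hzE r hr), hn r hr⟩⟩) hwS he hce
    exact ⟨hF.val_family hE hwS, hF.grad_family hT hE hwS cont_v cont_v' der_v hvS⟩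
  have z0 : ∀ x ∈ P.I, W x = 0 := fun x hx => hA.smooth.zero x (hg.notMem_Ω x hx)
  have z1 : ∀ x ∈ P.I, ∀ r, V (pert W r x) = 0 := fun x hx r => by
    rw [mI x hx]; exact hV.zero x (hg.notMem_Ω x hx)
  have z2 : ∀ x ∈ P.I, ∀ r, fderiv ℝ V (pert W r x) (W x) = 0 := fun x hx r => by
    rw [z0 x hx, map_zero]
  have mΩ : ∀ i, ∀ x ∈ P.part i, ∀ r ∈ Icc 0 T, pert W r x ∈ P.Ω := fun i x hx r hr =>
    (hA.pert_mem_iff hr).2 (hg.part_subset i hx)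
  have hpd := fun i => (hg.part_subset i).trans (subset_union_left (t := P.I))
  have p1 := fun i j => piece (E := P.part i ×ˢ P.part j) (hA.isOpen.prod hA.isOpen)
    (hΩm.prod hΩm) ((hm i).prod (hm j)) subset_rfl (prod_mono (hpd i) (hpd j))
    (fun z hz r hr => ⟨mΩ i _ hz.1 r hr, mΩ j _ hz.2 r hr⟩) (fun n hn => hS.inner n hn i j)
    (fun _ _ => Submodule.mem_top) (fun _ _ _ _ => ⟨Submodule.mem_top, Submodule.mem_top⟩)
  have p2 := fun i => piece (E := P.part i ×ˢ P.I) (hA.isOpen.prod isOpen_univ)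
    (hΩm.prod hIm) ((hm i).prod hIm) (prod_mono subset_rfl (subset_univ _))
    (prod_mono (hpd i) subset_union_right)
    (fun z hz r hr => ⟨mΩ i _ hz.1 r hr, by simpa only [pert2, mI _ hz.2] using hz.2⟩)
    (fun n hn => hS.outer_left n hn i)
    (fun z hz => ⟨Submodule.mem_top, (Submodule.mem_bot ℝ).2 (z0 _ hz.2)⟩)
    (fun z hz r hr => ⟨⟨Submodule.mem_top, (Submodule.mem_bot ℝ).2 (z1 _ hz.2 r)⟩,
      ⟨Submodule.mem_top, (Submodule.mem_bot ℝ).2 (z2 _ hz.2 r)⟩⟩)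
  have p3 := fun i => piece (E := P.I ×ˢ P.part i) (isOpen_univ.prod hA.isOpen)
    (hIm.prod hΩm) (hIm.prod (hm i)) (prod_mono (subset_univ _) subset_rfl)
    (prod_mono subset_union_right (hpd i))
    (fun z hz r hr => ⟨by simpa only [pert2, mI _ hz.1] using hz.1, mΩ i _ hz.2 r hr⟩)
    (fun n hn => hS.outer_right n hn i)
    (fun z hz => ⟨(Submodule.mem_bot ℝ).2 (z0 _ hz.1), Submodule.mem_top⟩)
    (fun z hz r hr => ⟨⟨(Submodule.mem_bot ℝ).2 (z1 _ hz.1 r), Submodule.mem_top⟩,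
      ⟨(Submodule.mem_bot ℝ).2 (z2 _ hz.1 r), Submodule.mem_top⟩⟩)
  constructor
  · refine (hg.aeFamily_glue (fun i j => (p1 i j).1) (fun i => (p2 i).1) fun i => (p3 i).1).congr
      fun r hr => ae_of_all _ fun z => ⟨kern_pert2 hg hA hr z, kernGrad_pert2 hg hA hr z _⟩
  · refine (hg.aeFamily_glue (fun i j => (p1 i j).2) (fun i => (p2 i).2) fun i => (p3 i).2).congr
      fun r hr => ae_of_all _ fun z => ⟨kernGrad_pert2 hg hA hr z fun z => pairField V (pert2 W r z),
        ?_⟩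
    rw [glue_add', kernHess_pert2 hg hA hr z _ fun z => pairField V (pert2 W r z),
      kernGrad_pert2 hg hA hr z fun z => pairDeriv V (pert2 W r z) (pairField W z)]

end Setting

end NonlocalShape
end

/-! ### Uniform boundedness for almost everywhere defined functionals. -/

open Set Filter Topology MeasureTheory
open scoped ENNReal ContDiff

noncomputable section

namespace NonlocalShape

set_option linter.unusedSectionVars false

variable {d : ℕ} {Ω : Set (Euc d)}

/-- Vector fields of class `C¹` that vanish with their derivatives outside `Ω`, with a bound `M`
for the field and its derivative. -/
structure IsBoundedField (Ω : Set (Euc d)) (M : ℝ) (V : Euc d → Euc d) : Prop where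
  contDiff : ContDiff ℝ 1 V
  zero : ∀ x, x ∉ Ω → V x = 0
  fderiv_zero : ∀ x, x ∉ Ω → fderiv ℝ V x = 0
  bound : ∀ x, ‖V x‖ ≤ M
  bound_fderiv : ∀ x, ‖fderiv ℝ V x‖ ≤ M

/-- A field of linear functionals, weighted with `ρ`, is bounded uniformly on bounded sets of
vector fields. -/
def FieldBound (Ω : Set (Euc d)) (ν : Measure (Euc d × Euc d))
    (l : Euc d × Euc d → Euc d × Euc d →L[ℝ] ℝ) (ρ : Euc d × Euc d → ℝ) : Prop :=
  ∀ M : ℝ, ∃ C : ℝ, ∀ V, IsBoundedField Ω M V → ∀ᵐ z ∂ν, |l z (pairField V z)| * ρ z ≤ C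

/-- The random series `∑ 2^{-k} V_k` over the indices selected by `c`. -/
def randomSeries (V : ℕ → Euc d → Euc d) (c : ℕ → Bool) (x : Euc d) : Euc d :=
  ∑' k, (if c k then (1 / 2 : ℝ) ^ k else 0) • V k x

section Series

variable {M : ℝ} {V : ℕ → Euc d → Euc d}

theorem coeff_le (c : ℕ → Bool) (k : ℕ) :
    ‖(if c k then (1 / 2 : ℝ) ^ k else 0)‖ ≤ (1 / 2 : ℝ) ^ k := by
  split_ifs
  · rw [Real.norm_of_nonneg (by positivity)]
  · rw [norm_zero]; positivity

theorem summable_half_mul (M : ℝ) : Summable fun k : ℕ => (1 / 2 : ℝ) ^ k * M :=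
  (summable_geometric_two).mul_right M

theorem norm_term_le (hV : ∀ k, IsBoundedField Ω M (V k)) (c : ℕ → Bool) (k : ℕ) (x : Euc d) :
    ‖(if c k then (1 / 2 : ℝ) ^ k else 0) • V k x‖ ≤ (1 / 2 : ℝ) ^ k * M := by
  rw [norm_smul]
  exact mul_le_mul (coeff_le c k) ((hV k).bound x) (norm_nonneg _) (by positivity)

theorem summable_term (hV : ∀ k, IsBoundedField Ω M (V k)) (c : ℕ → Bool) (x : Euc d) :
    Summable fun k => (if c k then (1 / 2 : ℝ) ^ k else 0) • V k x :=
  .of_norm_bounded (summable_half_mul M) fun k => norm_term_le hV c k x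

theorem continuous_randomSeries (hV : ∀ k, IsBoundedField Ω M (V k)) (x : Euc d) :
    Continuous fun c => randomSeries V c x := by
  refine continuous_tsum (fun k => ?_) (summable_half_mul M) fun k c => norm_term_le hV c k x
  have : Continuous fun b : Bool => (if b then (1 / 2 : ℝ) ^ k else 0) • V k x :=
    continuous_of_discreteTopology
  exact this.comp (continuous_apply k)

/-- The geometric coefficients force convergence in C¹, so every digit sequence yields a field to
which an assumption on single fields applies. -/
theorem isC0Field_randomSeries (hb : Bornology.IsBounded Ω)
    (hV : ∀ k, IsBoundedField Ω M (V k)) (c : ℕ → Bool) : IsC0Field 1 Ω (randomSeries V c) := by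
  have hc : ∀ k, ContDiff ℝ 1 fun x => (if c k then (1 / 2 : ℝ) ^ k else 0) • V k x := fun k =>
    (hV k).contDiff.const_smul _
  have hf : ∀ k x, fderiv ℝ (fun x => (if c k then (1 / 2 : ℝ) ^ k else 0) • V k x) x =
      (if c k then (1 / 2 : ℝ) ^ k else 0) • fderiv ℝ (V k) x := fun k x =>
    fderiv_fun_const_smul ((hV k).contDiff.differentiable (by simp) x) _
  have hfb : ∀ k x, ‖fderiv ℝ (fun x => (if c k then (1 / 2 : ℝ) ^ k else 0) • V k x) x‖ ≤
      (1 / 2 : ℝ) ^ k * M := fun k x => by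
    rw [hf, norm_smul]
    exact mul_le_mul (coeff_le c k) ((hV k).bound_fderiv x) (norm_nonneg _) (by positivity)
  refine isC0Field_one_of_contDiff hb ?_ (fun x hx => ?_) fun x hx => ?_
  · refine contDiff_tsum (N := 1) (v := fun _ k => (1 / 2 : ℝ) ^ k * M) hc
      (fun _ _ => summable_half_mul M) fun j k x hj => ?_
    have hj : j ≤ 1 := by exact_mod_cast hj
    interval_cases j
    · rw [norm_iteratedFDeriv_zero]; exact norm_term_le hV c k x
    · rw [norm_iteratedFDeriv_one]; exact hfb k x
  · simp [randomSeries, (hV _).zero x hx]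
  · have h1 := congrFun (fderiv_tsum (summable_half_mul M) (fun k => (hc k).differentiable (by simp))
      hfb (summable_term hV c 0)) x
    change fderiv ℝ (fun y => ∑' k, (if c k then (1 / 2 : ℝ) ^ k else 0) • V k y) x = 0
    rw [h1]
    refine (tsum_congr fun k => ?_).trans tsum_zero
    rw [hf, (hV k).fderiv_zero x hx]
    exact smul_zero (M := ℝ) (A := Euc d →L[ℝ] Euc d) (if c k then (1 / 2 : ℝ) ^ k else 0)

/-- Flipping one digit isolates one term of the series. -/
theorem randomSeries_update_sub (hV : ∀ k, IsBoundedField Ω M (V k)) (c : ℕ → Bool) (m : ℕ)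
    (x : Euc d) : randomSeries V (Function.update c m true) x -
      randomSeries V (Function.update c m false) x = (1 / 2 : ℝ) ^ m • V m x := by
  rw [randomSeries, randomSeries, ← (summable_term hV _ x).tsum_sub (summable_term hV _ x),
    tsum_eq_single m]
  · simp
  · intro k hk
    simp [Function.update_of_ne hk]

end Series

theorem tendsto_update (c : ℕ → Bool) (b : Bool) :
    Tendsto (fun m => Function.update c m b) atTop (𝓝 c) := by
  refine tendsto_pi_nhds.2 fun k => ?_
  refine tendsto_const_nhds.congr' ?_
  filter_upwards [eventually_gt_atTop k] with m hm
  rw [Function.update_of_ne hm.ne]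

/-- A uniform boundedness principle for fields of linear functionals that are defined almost
everywhere. -/
theorem FieldBound.of_forall (hb : Bornology.IsBounded Ω) {ν : Measure (Euc d × Euc d)}
    {l : Euc d × Euc d → Euc d × Euc d →L[ℝ] ℝ} {ρ : Euc d × Euc d → ℝ} (hρ : ∀ z, 0 ≤ ρ z)
    (h : ∀ V, IsC0Field 1 Ω V → ∃ C : ℝ, ∀ᵐ z ∂ν, |l z (pairField V z)| * ρ z ≤ C) :
    FieldBound Ω ν l ρ := by
  intro M
  by_contra! hcon
  -- If no uniform bound exists, there are fields violating the bounds k 2^k: the power undoes the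
  -- coefficient of V k in the series, and k outgrows the constant from the category argument.
  choose V hV hbad using fun k : ℕ => hcon (k * 2 ^ k)
  set B : ℕ → Set (ℕ → Bool) := fun n =>
    {c | ∀ᵐ z ∂ν, |l z (pairField (randomSeries V c) z)| * ρ z ≤ n} with hB
  have hcont : ∀ z, Continuous fun c => |l z (pairField (randomSeries V c) z)| * ρ z := fun z =>
    (((l z).continuous.comp ((continuous_randomSeries hV z.1).prodMk
      (continuous_randomSeries hV z.2))).abs).mul_const _
  have hclosed : ∀ n, IsClosed (B n) := fun n => by
    refine IsSeqClosed.isClosed fun c c₀ hc ht => ?_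
    have h1 : ∀ᵐ z ∂ν, ∀ m, |l z (pairField (randomSeries V (c m)) z)| * ρ z ≤ n :=
      ae_all_iff.2 hc
    change ∀ᵐ z ∂ν, _
    filter_upwards [h1] with z hz
    exact le_of_tendsto (((hcont z).tendsto c₀).comp ht) (Eventually.of_forall hz)
  have hunion : ⋃ n, B n = univ := by
    refine eq_univ_of_forall fun c => ?_
    obtain ⟨C, hC⟩ := h _ (isC0Field_randomSeries hb hV c)
    obtain ⟨n, hn⟩ := exists_nat_ge C
    exact mem_iUnion.2 ⟨n, hC.mono fun z hz => hz.trans hn⟩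
  -- Baire's theorem in the Cantor space of digit sequences: one bound n holds on a nonempty open
  -- set.
  obtain ⟨n, c, hc⟩ := nonempty_interior_of_iUnion_of_closed hclosed hunion
  -- Changing a distant digit, to either value, does not leave this open set. The difference of the
  -- two series is 2^{-m} V m, which is then bounded by 2n; for m ≥ 2n this contradicts the choice
  -- of V m.
  have hev : ∀ b, ∀ᶠ m in atTop, Function.update c m b ∈ B n := fun b =>
    (tendsto_update c b).eventually (mem_interior_iff_mem_nhds.1 hc)
  obtain ⟨m, ⟨hm1, hm2⟩, hmn⟩ :=
    (((hev true).and (hev false)).and (eventually_ge_atTop (2 * n))).exists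
  refine hbad m ?_
  have hm1' : ∀ᵐ z ∂ν, _ := hm1
  have hm2' : ∀ᵐ z ∂ν, _ := hm2
  filter_upwards [hm1', hm2'] with z h1 h2
  have e : (1 / 2 : ℝ) ^ m • pairField (V m) z =
      pairField (randomSeries V (Function.update c m true)) z -
        pairField (randomSeries V (Function.update c m false)) z :=
    Prod.ext (randomSeries_update_sub hV c m z.1).symm (randomSeries_update_sub hV c m z.2).symm
  have e2 := congrArg (l z) e
  rw [map_smul, map_sub, smul_eq_mul] at e2
  have h3 : (1 / 2 : ℝ) ^ m * (|l z (pairField (V m) z)| * ρ z) ≤ 2 * n := by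
    have h4 : (1 / 2 : ℝ) ^ m * |l z (pairField (V m) z)| =
        |(1 / 2 : ℝ) ^ m * l z (pairField (V m) z)| := by
      rw [abs_mul, abs_of_pos (show (0 : ℝ) < (1 / 2) ^ m by positivity)]
    rw [← mul_assoc, h4, e2]
    have h5 := mul_le_mul_of_nonneg_right (abs_sub (l z (pairField (randomSeries V
      (Function.update c m true)) z)) (l z (pairField (randomSeries V
      (Function.update c m false)) z))) (hρ z)
    linarith
  have hmn' : (2 * n : ℝ) ≤ m := by exact_mod_cast hmn
  have h6 : (1 / 2 : ℝ) ^ m * 2 ^ m = 1 := by rw [← mul_pow]; norm_num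
  refine not_lt.2 ?_
  calc |l z (pairField (V m) z)| * ρ z
      = ((1 / 2 : ℝ) ^ m * (|l z (pairField (V m) z)| * ρ z)) * 2 ^ m := by
        linear_combination (-(|l z (pairField (V m) z)| * ρ z)) * h6
    _ ≤ m * 2 ^ m := by gcongr; linarith

theorem exists_ae_le_of_memLp_top {X : Type*} [MeasurableSpace X] {ν : Measure X} {f : X → ℝ}
    (h : MemLp f ⊤ ν) : ∃ C : ℝ, 0 ≤ C ∧ ∀ᵐ z ∂ν, |f z| ≤ C := by
  have h1 : eLpNormEssSup f ν < ⊤ := by simpa using h.2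
  refine ⟨(eLpNormEssSup f ν).toReal, ENNReal.toReal_nonneg, ?_⟩
  filter_upwards [ae_le_eLpNormEssSup (f := f) (μ := ν)] with z hz
  have := ENNReal.toReal_mono h1.ne hz
  simpa using this

end NonlocalShape
end

/-! ### Reflection (x,y) ↦ (y,x) and bounds for the glued kernel. -/

open Set Filter Topology MeasureTheory
open scoped ENNReal ContDiff

noncomputable section

namespace NonlocalShape

set_option linter.unusedSectionVars false

variable {d : ℕ} {P : Setting d} {W V : Euc d → Euc d} {T : ℝ}

section Swap

theorem measurePreserving_swap :
    MeasurePreserving (Prod.swap : Euc d × Euc d → Euc d × Euc d) volume volume :=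
  Measure.measurePreserving_swap

theorem measurableEmbedding_swap :
    MeasurableEmbedding (Prod.swap : Euc d × Euc d → Euc d × Euc d) :=
  (MeasurableEquiv.prodComm (α := Euc d) (β := Euc d)).measurableEmbedding

theorem setIntegral_swap (G : Euc d × Euc d → ℝ) (D : Set (Euc d × Euc d)) :
    ∫ z in Prod.swap ⁻¹' D, G z.swap = ∫ z in D, G z :=
  measurePreserving_swap.setIntegral_preimage_emb measurableEmbedding_swap G D

theorem ae_restrict_swap {D : Set (Euc d × Euc d)} (hD : MeasurableSet D)
    {p : Euc d × Euc d → Prop} (h : ∀ᵐ z ∂(volume.restrict D), p z) :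
    ∀ᵐ z ∂(volume.restrict (Prod.swap ⁻¹' D)), p z.swap := by
  rw [ae_restrict_iff' hD] at h
  rw [ae_restrict_iff' (measurable_swap hD)]
  exact measurePreserving_swap.quasiMeasurePreserving.ae h

theorem integrable_mul_test {D : Set (Euc d × Euc d)} {g φ : Euc d × Euc d → ℝ}
    (hg : MemLp g ⊤ (volume.restrict D)) (hφ : Continuous φ) (hc : HasCompactSupport φ) :
    IntegrableOn (fun z => g z * φ z) D := by
  have h1 : MemLp φ 1 (volume.restrict D) :=
    memLp_one_iff_integrable.2 (hφ.integrable_of_hasCompactSupport hc).integrableOn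
  exact memLp_one_iff_integrable.1 (h1.mul hg)

/-- Weak derivatives of swapped functions agree with the swapped weak derivatives. -/
theorem IsWeakDirDeriv.ae_eq_swap {U D : Set (Euc d × Euc d)} (hU : IsOpen U)
    (hD : MeasurableSet D) (hDU : D ⊆ U) {e : Euc d × Euc d} {f g f' g' : Euc d × Euc d → ℝ}
    (h : IsWeakDirDeriv U D e f g)
    (h' : IsWeakDirDeriv (Prod.swap ⁻¹' U) (Prod.swap ⁻¹' D) e.swap f' g')
    (hf : ∀ᵐ z ∂(volume.restrict D), f z = f' z.swap)
    (hg : MemLp g ⊤ (volume.restrict D)) (hg' : MemLp g' ⊤ (volume.restrict (Prod.swap ⁻¹' D))) :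
    ∀ᵐ z ∂(volume.restrict D), g z = g' z.swap := by
  have hg2 : MemLp (fun z => g' z.swap) ⊤ (volume.restrict D) := by
    have h1 : MeasurePreserving (Prod.swap : Euc d × Euc d → Euc d × Euc d)
        (volume.restrict D) (volume.restrict (Prod.swap ⁻¹' D)) :=
      measurePreserving_swap.restrict_preimage (measurable_swap hD)
    exact hg'.comp_measurePreserving h1
  have hq : LocallyIntegrableOn (D.indicator fun z => g z - g' z.swap) U := by
    have : MemLp (D.indicator fun z => g z - g' z.swap) ⊤ volume :=
      (memLp_indicator_iff_restrict hD).2 (hg.sub hg2)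
    exact (this.locallyIntegrable le_top).locallyIntegrableOn U
  -- The fundamental lemma of the calculus of variations on U, for the difference extended by zero
  -- from D; this works although D itself need not be open.
  have key := hU.ae_eq_zero_of_integral_contDiff_smul_eq_zero hq fun φ hφ hc hs => by
    have e1 : ∀ z, φ z • D.indicator (fun z => g z - g' z.swap) z =
        D.indicator (fun z => g z * φ z - g' z.swap * φ z) z := fun z => by
      by_cases hz : z ∈ D
      · simp only [indicator_of_mem hz, smul_eq_mul]; ring
      · simp [hz]
    simp only [e1]
    rw [integral_indicator hD, integral_sub (integrable_mul_test hg hφ.continuous hc)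
      (integrable_mul_test hg2 hφ.continuous hc), ← neg_eq_iff_eq_neg.2 (h φ hφ hc hs)]
    have hφs : ContDiff ℝ ∞ (φ ∘ Prod.swap) := hφ.comp
      (ContinuousLinearEquiv.prodComm ℝ (Euc d) (Euc d)).contDiff
    have hcs : HasCompactSupport (φ ∘ Prod.swap) :=
      hc.comp_homeomorph (Homeomorph.prodComm (Euc d) (Euc d))
    have hss : tsupport (φ ∘ Prod.swap) ⊆ Prod.swap ⁻¹' U :=
      (tsupport_comp_subset_preimage φ continuous_swap).trans (preimage_mono hs)
    have e2 := h' _ hφs hcs hss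
    have e3 : ∫ z in D, g' z.swap * φ z =
        ∫ z in Prod.swap ⁻¹' D, g' z * (φ ∘ Prod.swap) z := by
      rw [← setIntegral_swap (fun z => g' z.swap * φ z)]
      rfl
    have e4 : ∀ z, fderiv ℝ (φ ∘ Prod.swap) z e.swap = fderiv ℝ φ z.swap e := fun z => by
      have := ((hφ.differentiable (by simp) z.swap).hasFDerivAt.comp z
        (ContinuousLinearEquiv.prodComm ℝ (Euc d) (Euc d)).hasFDerivAt).fderiv
      exact (congrArg (fun L : (Euc d × Euc d) →L[ℝ] ℝ => L e.swap) this).trans (by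
        simp)
    rw [e3, ← neg_eq_iff_eq_neg.2 e2]
    simp only [e4]
    have e5 := setIntegral_swap (fun z => f' z.swap * fderiv ℝ φ z e) D
    simp only [Prod.swap_swap] at e5
    rw [e5, sub_eq_zero, neg_inj]
    refine integral_congr_ae ?_
    filter_upwards [hf] with z hz
    rw [hz]
  rw [ae_restrict_iff' hD]
  filter_upwards [key] with z hz hzD
  have := hz (hDU hzD)
  rw [indicator_of_mem hzD] at this
  linarith

theorem swap_preimage_far (n : ℕ) :
    (Prod.swap ⁻¹' Setting.far n : Set (Euc d × Euc d)) = Setting.far n := by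
  ext z; simp [Setting.far, dist_comm]

theorem ae_mem_far (hd : 0 < d) : ∀ᵐ z : Euc d × Euc d, ∃ n : ℕ, z ∈ Setting.far (n + 1) := by
  filter_upwards [ae_fst_ne_snd hd] with z hz
  obtain ⟨n, hn⟩ := exists_nat_one_div_lt (dist_pos.2 hz)
  exact ⟨n, by simpa [Setting.far] using hn⟩

theorem ae_restrict_of_far (hd : 0 < d) {D : Set (Euc d × Euc d)} (hD : MeasurableSet D)
    {p : Euc d × Euc d → Prop}
    (h : ∀ n : ℕ, 0 < n → ∀ᵐ z ∂(volume.restrict (D ∩ Setting.far n)), p z) :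
    ∀ᵐ z ∂(volume.restrict D), p z := by
  rw [ae_restrict_iff' hD]
  filter_upwards [ae_mem_far hd, ae_all_iff.2 fun n : ℕ =>
    (ae_restrict_iff' (hD.inter (isOpen_far (n + 1)).measurableSet)).1 (h (n + 1) n.succ_pos)]
    with z ⟨n, hn⟩ hz hzD
  exact hz n ⟨hzD, hn⟩

/-- Equality of the functions gives equality of the gradient coordinates almost everywhere, and
these in turn give the Hessians. The sets away from the diagonal exhaust D up to a null set. -/
theorem IsSobolevTwo.ae_eq_swap (hd : 0 < d) {U D : Set (Euc d × Euc d)} (hU : IsOpen U)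
    (hD : MeasurableSet D) (hDU : D ⊆ U) {S S' : Submodule ℝ (Euc d × Euc d)}
    {J J' : WeakJet (Euc d × Euc d)} (hSS : ∀ v ∈ S, v.swap ∈ S')
    (hJ : ∀ n, 0 < n → IsSobolevTwo ⊤ (U ∩ Setting.far n) (D ∩ Setting.far n) S J)
    (hJ' : ∀ n, 0 < n → IsSobolevTwo ⊤ (Prod.swap ⁻¹' U ∩ Setting.far n)
      (Prod.swap ⁻¹' D ∩ Setting.far n) S' J')
    (hval : ∀ z ∈ D, J.val z = J'.val z.swap) :
    ∀ᵐ z ∂(volume.restrict D), (∀ v ∈ S, J.grad z v = J'.grad z.swap v.swap) ∧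
      ∀ v ∈ S, ∀ v' ∈ S, J.hess z v v' = J'.hess z.swap v.swap v'.swap := by
  obtain ⟨m, e, c, he, hce⟩ := exists_frame S
  have hpre : ∀ (s : Set (Euc d × Euc d)) n, Prod.swap ⁻¹' (s ∩ Setting.far n) =
      Prod.swap ⁻¹' s ∩ Setting.far n := fun s n => by
    rw [preimage_inter, swap_preimage_far]
  have hDm : ∀ n, MeasurableSet (D ∩ Setting.far n) := fun n =>
    hD.inter (isOpen_far n).measurableSet
  have h1 : ∀ k, ∀ n, 0 < n → ∀ᵐ z ∂(volume.restrict (D ∩ Setting.far n)),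
      J.grad z (e k) = J'.grad z.swap (e k).swap := fun k n hn => by
    have a := hJ n hn
    have b := hJ' n hn
    rw [← hpre, ← hpre] at b
    exact (a.weak_grad _ (he k)).ae_eq_swap (hU.inter (isOpen_far n)) (hDm n)
      (inter_subset_inter_left _ hDU) (b.weak_grad _ (hSS _ (he k)))
      ((ae_restrict_iff' (hDm n)).2 (ae_of_all _ fun z hz => hval z hz.1))
      (a.memLp_grad _ (he k)) (b.memLp_grad _ (hSS _ (he k)))
  have h2 : ∀ k l, ∀ n, 0 < n → ∀ᵐ z ∂(volume.restrict (D ∩ Setting.far n)),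
      J.hess z (e k) (e l) = J'.hess z.swap (e k).swap (e l).swap := fun k l n hn => by
    have a := hJ n hn
    have b := hJ' n hn
    rw [← hpre, ← hpre] at b
    exact (a.weak_hess _ (he k) _ (he l)).ae_eq_swap (hU.inter (isOpen_far n)) (hDm n)
      (inter_subset_inter_left _ hDU) (b.weak_hess _ (hSS _ (he k)) _ (hSS _ (he l)))
      (h1 l n hn) (a.memLp_hess _ (he k) _ (he l))
      (b.memLp_hess _ (hSS _ (he k)) _ (hSS _ (he l)))
  have hsw : ∀ v ∈ S, v.swap = ∑ k, c k v • (e k).swap := fun v hv => by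
    have := congrArg (ContinuousLinearEquiv.prodComm ℝ (Euc d) (Euc d)) (hce v hv)
    rw [map_sum] at this
    simpa only [map_smul, ContinuousLinearEquiv.prodComm_apply] using this
  filter_upwards [ae_all_iff.2 fun k => ae_restrict_of_far hd hD (h1 k),
    ae_all_iff.2 fun k => ae_all_iff.2 fun l => ae_restrict_of_far hd hD (h2 k l)] with z hz1 hz2
  refine ⟨fun v hv => ?_, fun v hv v' hv' => ?_⟩
  · conv_lhs => rw [hce v hv]
    rw [hsw v hv, map_sum, map_sum]
    exact Finset.sum_congr rfl fun k _ => by rw [map_smul, map_smul, hz1 k]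
  · conv_lhs => rw [hce v hv, hce v' hv']
    rw [hsw v hv, hsw v' hv']
    simp only [map_sum, map_smul, sum_apply, smul_apply, hz2]

end Swap

section GlueCases

variable {M : Type*} [AddCommMonoid M] {A : Fin 2 → Set (Euc d)} {I : Set (Euc d)}

theorem glue_of_mem_prod (hdisj : ∀ i j x, x ∈ A i → x ∈ A j → i = j)
    (hI : ∀ i x, x ∈ A i → x ∉ I) (g : Fin 2 → Fin 2 → Euc d × Euc d → M)
    (gI : Fin 2 → Euc d × Euc d → M) {i j : Fin 2} {z : Euc d × Euc d} (hz : z ∈ A i ×ˢ A j) :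
    glue A I g gI z = g i j z := by
  rw [glue, Finset.sum_eq_single i, Finset.sum_eq_single j, indicator_of_mem hz,
    Finset.sum_eq_zero, add_zero]
  · intro k _
    exact indicator_of_notMem (fun h => h.elim (fun h => hI j _ hz.2 h.2)
      fun h => hI i _ hz.1 h.1) _
  · intro k _ hk
    exact indicator_of_notMem (fun h => hk (hdisj _ _ _ h.2 hz.2)) _
  · simp
  · intro k _ hk
    exact Finset.sum_eq_zero fun l _ => indicator_of_notMem (fun h => hk (hdisj _ _ _ h.1 hz.1)) _
  · simp

theorem glue_of_mem_outer (hdisj : ∀ i j x, x ∈ A i → x ∈ A j → i = j)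
    (hI : ∀ i x, x ∈ A i → x ∉ I) (g : Fin 2 → Fin 2 → Euc d × Euc d → M)
    (gI : Fin 2 → Euc d × Euc d → M) {i : Fin 2} {z : Euc d × Euc d}
    (hz : z ∈ A i ×ˢ I ∪ I ×ˢ A i) : glue A I g gI z = gI i z := by
  rw [glue, Finset.sum_eq_zero, zero_add, Finset.sum_eq_single i, indicator_of_mem hz]
  · intro k _ hk
    refine indicator_of_notMem (fun h => ?_) _
    rcases hz with hz | hz <;> rcases h with h | h
    · exact hk (hdisj _ _ _ h.1 hz.1)
    · exact hI i _ hz.1 h.1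
    · exact hI _ _ h.1 hz.1
    · exact hk (hdisj _ _ _ h.2 hz.2)
  · simp
  · intro k _
    refine Finset.sum_eq_zero fun l _ => indicator_of_notMem (fun h => ?_) _
    rcases hz with hz | hz
    · exact hI l _ h.2 hz.2
    · exact hI k _ h.1 hz.1

theorem glue_of_notMem (g : Fin 2 → Fin 2 → Euc d × Euc d → M) (gI : Fin 2 → Euc d × Euc d → M)
    {z : Euc d × Euc d} (h1 : ∀ i j, z ∉ A i ×ˢ A j) (h2 : ∀ i, z ∉ A i ×ˢ I ∪ I ×ˢ A i) :
    glue A I g gI z = 0 := by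
  rw [glue, Finset.sum_eq_zero, Finset.sum_eq_zero, add_zero]
  · exact fun i _ => indicator_of_notMem (h2 i) _
  · exact fun i _ => Finset.sum_eq_zero fun j _ => indicator_of_notMem (h1 i j) _

end GlueCases

namespace Setting

variable {r : ℝ}

theorem moved_disjoint (hg : P.Geometry) (hA : IsAdmissible P.Ω W T) (hr : r ∈ Icc 0 T)
    (i j : Fin 2) (x : Euc d) (hi : x ∈ P.moved W r i) (hj : x ∈ P.moved W r j) : i = j := by
  by_contra hij
  obtain ⟨y, hy, rfl⟩ := hi
  exact disjoint_left.1 (hg.disjoint_part i j hij) hy ((hA.injective hr).mem_set_image.1 hj)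

theorem moved_subset (hg : P.Geometry) (hA : IsAdmissible P.Ω W T) (hr : r ∈ Icc 0 T)
    (i : Fin 2) : P.moved W r i ⊆ P.Ω := by
  rintro _ ⟨x, hx, rfl⟩
  exact (hA.pert_mem_iff hr).2 (hg.part_subset i hx)

theorem moved_notMem_I (hg : P.Geometry) (hA : IsAdmissible P.Ω W T) (hr : r ∈ Icc 0 T)
    (i : Fin 2) (x : Euc d) (hx : x ∈ P.moved W r i) : x ∉ P.I := fun h =>
  hg.notMem_Ω _ h (moved_subset hg hA hr i hx)

theorem isOpen_moved (hg : P.Geometry) (hA : IsAdmissible P.Ω W T) (hr : r ∈ Icc 0 T)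
    (i : Fin 2) : IsOpen (P.moved W r i) := by
  obtain ⟨h, hh⟩ := hA.exists_homeomorph hr
  rw [moved, ← hh]
  exact h.isOpenMap _ (hg.isOpen_part i)

/-- The jet `J` carries the kernel at the point `y`. -/
def KernIs (P : Setting d) (A : Fin 2 → Set (Euc d)) (J : WeakJet (Euc d × Euc d))
    (y : Euc d × Euc d) : Prop :=
  P.kern A y = J.val y ∧ P.kernGrad A y = J.grad y ∧ P.kernHess A y = J.hess y

theorem kernIs_inner (hg : P.Geometry) (hA : IsAdmissible P.Ω W T) (hr : r ∈ Icc 0 T)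
    {i j : Fin 2} {y : Euc d × Euc d} (hy : y ∈ P.moved W r i ×ˢ P.moved W r j) :
    P.KernIs (P.moved W r) (P.γ i j) y :=
  have h1 := moved_disjoint hg hA hr
  have h2 := moved_notMem_I hg hA hr
  ⟨glue_of_mem_prod h1 h2 _ _ hy, glue_of_mem_prod h1 h2 _ _ hy, glue_of_mem_prod h1 h2 _ _ hy⟩

theorem kernIs_outer (hg : P.Geometry) (hA : IsAdmissible P.Ω W T) (hr : r ∈ Icc 0 T)
    {i : Fin 2} {y : Euc d × Euc d} (hy : y ∈ P.moved W r i ×ˢ P.I ∪ P.I ×ˢ P.moved W r i) :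
    P.KernIs (P.moved W r) (P.γI i) y :=
  have h1 := moved_disjoint hg hA hr
  have h2 := moved_notMem_I hg hA hr
  ⟨glue_of_mem_outer h1 h2 _ _ hy, glue_of_mem_outer h1 h2 _ _ hy, glue_of_mem_outer h1 h2 _ _ hy⟩

theorem kernIs_zero {A : Fin 2 → Set (Euc d)} {y : Euc d × Euc d} (h1 : ∀ i j, y ∉ A i ×ˢ A j)
    (h2 : ∀ i, y ∉ A i ×ˢ P.I ∪ P.I ×ˢ A i) : P.KernIs A ⟨0, 0, 0⟩ y :=
  ⟨glue_of_notMem _ _ h1 h2, glue_of_notMem _ _ h1 h2, glue_of_notMem _ _ h1 h2⟩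

/-- Bounds for a jet at a point in the directions `w` and `v`. -/
def JetLe (ρ : Euc d × Euc d → ℝ) (C : ℝ) (a : ℝ) (G : Euc d × Euc d →L[ℝ] ℝ)
    (H : Euc d × Euc d →L[ℝ] Euc d × Euc d →L[ℝ] ℝ) (w v y : Euc d × Euc d) : Prop :=
  |a| * ρ y ≤ C ∧ |G w| * ρ y ≤ C ∧ |H w v| * ρ y ≤ C

theorem JetLe.mono {ρ : Euc d × Euc d → ℝ} {C C' a : ℝ} {G : Euc d × Euc d →L[ℝ] ℝ}
    {H : Euc d × Euc d →L[ℝ] Euc d × Euc d →L[ℝ] ℝ} {w v y : Euc d × Euc d}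
    (h : JetLe ρ C a G H w v y) (hC : C ≤ C') : JetLe ρ C' a G H w v y :=
  ⟨h.1.trans hC, h.2.1.trans hC, h.2.2.trans hC⟩

/-- Bounds for a jet on `D`, in the directions of vector fields. -/
def JetBound (Ω : Set (Euc d)) (D : Set (Euc d × Euc d)) (V : Euc d → Euc d)
    (ρ : Euc d × Euc d → ℝ) (J : WeakJet (Euc d × Euc d)) : Prop :=
  ∀ M : ℝ, ∃ C : ℝ, ∀ X, IsBoundedField Ω M X → ∀ᵐ y ∂(volume.restrict D),
    JetLe ρ C (J.val y) (J.grad y) (J.hess y) (pairField X y) (pairField V y) y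

/-- Bounds for the kernels of all moved interfaces, in the directions of vector fields. -/
def KernBound (P : Setting d) (W : Euc d → Euc d) (T : ℝ) (V : Euc d → Euc d)
    (ρ : Euc d × Euc d → ℝ) : Prop :=
  ∀ M : ℝ, ∃ C : ℝ, ∀ r ∈ Icc 0 T, ∀ X, IsBoundedField P.Ω M X →
    ∀ᵐ y ∂(volume.restrict (P.dom ×ˢ P.dom)),
      JetLe ρ C (P.kern (P.moved W r) y) (P.kernGrad (P.moved W r) y) (P.kernHess (P.moved W r) y)
        (pairField X y) (pairField V y) y

/-- At every point at most one jet carries the kernel, so the sum of the absolute constants works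
for all. The part I × F_r(Ω_i) is a separate assumption with a constant independent of r, because in
the singular case it is reached only through symmetry of the moved kernel. -/
theorem kernBound_of_jetBound (hg : P.Geometry) (hA : IsAdmissible P.Ω W T)
    {ρ : Euc d × Euc d → ℝ}
    (h1 : ∀ i j, JetBound P.Ω (P.Ω ×ˢ P.Ω) V ρ (P.γ i j))
    (h2 : ∀ i, JetBound P.Ω (P.Ω ×ˢ P.I) V ρ (P.γI i))
    (h3 : ∀ i, ∀ M : ℝ, ∃ C : ℝ, ∀ r ∈ Icc 0 T, ∀ X, IsBoundedField P.Ω M X →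
      ∀ᵐ y ∂(volume.restrict (P.I ×ˢ P.moved W r i)),
      JetLe ρ C ((P.γI i).val y) ((P.γI i).grad y) ((P.γI i).hess y) (pairField X y)
        (pairField V y) y) : P.KernBound W T V ρ := by
  intro M
  choose C1 hC1 using fun i j => h1 i j M
  choose C2 hC2 using fun i => h2 i M
  choose C3 hC3 using fun i => h3 i M
  have b1 : ∀ i j, C1 i j ≤ ∑ i, ∑ j, |C1 i j| := fun i j => (le_abs_self _).trans
    ((Finset.single_le_sum (f := fun j => |C1 i j|) (fun _ _ => abs_nonneg _)
      (Finset.mem_univ j)).trans (Finset.single_le_sum (f := fun i => ∑ j, |C1 i j|)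
      (fun _ _ => Finset.sum_nonneg fun _ _ => abs_nonneg _) (Finset.mem_univ i)))
  have b2 : ∀ i, C2 i ≤ ∑ i, |C2 i| := fun i => (le_abs_self _).trans
    (Finset.single_le_sum (f := fun i => |C2 i|) (fun _ _ => abs_nonneg _) (Finset.mem_univ i))
  have b3 : ∀ i, C3 i ≤ ∑ i, |C3 i| := fun i => (le_abs_self _).trans
    (Finset.single_le_sum (f := fun i => |C3 i|) (fun _ _ => abs_nonneg _) (Finset.mem_univ i))
  have p1 : 0 ≤ ∑ i, ∑ j, |C1 i j| := Finset.sum_nonneg fun _ _ => Finset.sum_nonneg fun _ _ =>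
    abs_nonneg _
  have p2 : 0 ≤ ∑ i, |C2 i| := Finset.sum_nonneg fun _ _ => abs_nonneg _
  have p3 : 0 ≤ ∑ i, |C3 i| := Finset.sum_nonneg fun _ _ => abs_nonneg _
  refine ⟨(∑ i, ∑ j, |C1 i j|) + (∑ i, |C2 i|) + ∑ i, |C3 i|, fun r hr X hX => ?_⟩
  have hm := fun i => (isOpen_moved hg hA hr i).measurableSet
  have hΩ := hg.isOpen_Ω.measurableSet
  have hI := hg.measurableSet_I
  refine ae_restrict_of_ae ?_
  filter_upwards [ae_all_iff.2 fun i => ae_all_iff.2 fun j =>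
      (ae_restrict_iff' (hΩ.prod hΩ)).1 (hC1 i j X hX),
    ae_all_iff.2 fun i => (ae_restrict_iff' (hΩ.prod hI)).1 (hC2 i X hX),
    ae_all_iff.2 fun i => (ae_restrict_iff' (hI.prod (hm i))).1 (hC3 i r hr X hX)] with y y1 y2 y3
  have hs := moved_subset hg hA hr
  by_cases c1 : ∃ i j, y ∈ P.moved W r i ×ˢ P.moved W r j
  · obtain ⟨i, j, hy⟩ := c1
    obtain ⟨k1, k2, k3⟩ := kernIs_inner hg hA hr hy
    rw [k1, k2, k3]
    exact (y1 i j ⟨hs i hy.1, hs j hy.2⟩).mono (by linarith [b1 i j])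
  by_cases c2 : ∃ i, y ∈ P.moved W r i ×ˢ P.I ∪ P.I ×ˢ P.moved W r i
  · obtain ⟨i, hy⟩ := c2
    obtain ⟨k1, k2, k3⟩ := kernIs_outer hg hA hr hy
    rw [k1, k2, k3]
    rcases hy with hy | hy
    · exact (y2 i ⟨hs i hy.1, hy.2⟩).mono (by linarith [b2 i])
    · exact (y3 i hy).mono (by linarith [b3 i])
  · push Not at c1 c2
    obtain ⟨k1, k2, k3⟩ := kernIs_zero (P := P) c1 c2
    rw [k1, k2, k3]
    have : (0 : ℝ) ≤ (∑ i, ∑ j, |C1 i j|) + (∑ i, |C2 i|) + ∑ i, |C3 i| := by positivity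
    refine ⟨?_, ?_, ?_⟩ <;> simpa using this

end Setting

end NonlocalShape
end

/-! ### Kernel bounds in the two kernel classes. -/

open Set Filter Topology MeasureTheory
open scoped ENNReal ContDiff

noncomputable section

namespace NonlocalShape

set_option linter.unusedSectionVars false

variable {d : ℕ} {P : Setting d} {W V : Euc d → Euc d} {T : ℝ}

theorem norm_pairField_le {M : ℝ} {X : Euc d → Euc d} (hX : ∀ x, ‖X x‖ ≤ M)
    (y : Euc d × Euc d) : ‖pairField X y‖ ≤ M :=
  norm_prod_le_iff.2 ⟨hX _, hX _⟩

theorem IsSmoothField.isBoundedField {Ω : Set (Euc d)} (hV : IsSmoothField Ω V)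
    (hb : Bornology.IsBounded Ω) : ∃ M, IsBoundedField Ω M V := by
  obtain ⟨M, hM, h⟩ := hV.exists_bound hb
  exact ⟨M, hV.contDiff.of_le (by norm_num), hV.zero, hV.fderiv_zero, fun x => (h x).1,
    fun x => (h x).2.1⟩

theorem IsSmoothField.isC0Field_one {Ω : Set (Euc d)} (hV : IsSmoothField Ω V)
    (hb : Bornology.IsBounded Ω) : IsC0Field 1 Ω V :=
  isC0Field_one_of_contDiff hb (hV.contDiff.of_le (by norm_num)) hV.zero hV.fderiv_zero

namespace Setting

/-- In a finite frame the jet has finitely many essentially bounded coordinates, and the coordinates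
of the fields are bounded by their norms. -/
theorem jetBound_of_sobolev {Ω : Set (Euc d)} (hb : Bornology.IsBounded Ω)
    (hV : IsSmoothField Ω V) {O D : Set (Euc d × Euc d)} {S : Submodule ℝ (Euc d × Euc d)}
    {J : WeakJet (Euc d × Euc d)} (hJ : IsSobolevTwo ⊤ O D S J) (hD : MeasurableSet D)
    (hS : ∀ X : Euc d → Euc d, (∀ x, x ∉ Ω → X x = 0) → ∀ y ∈ D, pairField X y ∈ S) :
    JetBound Ω D V (fun _ => 1) J := by
  intro M
  obtain ⟨m, e, c, he, hce⟩ := exists_frame S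
  obtain ⟨N, hN⟩ := hV.isBoundedField hb
  obtain ⟨C0, p0, b0⟩ := exists_ae_le_of_memLp_top hJ.memLp_val
  choose C1 p1 b1 using fun k => exists_ae_le_of_memLp_top (hJ.memLp_grad (e k) (he k))
  choose C2 p2 b2 using fun k l => exists_ae_le_of_memLp_top
    (hJ.memLp_hess (e k) (he k) (e l) (he l))
  have hM : ∀ X, IsBoundedField Ω M X → 0 ≤ M := fun X hX => (norm_nonneg _).trans (hX.bound 0)
  have hN0 : 0 ≤ N := (norm_nonneg _).trans (hN.bound 0)
  refine ⟨C0 + ∑ k, ‖c k‖ * |M| * C1 k + ∑ k, ∑ l, ‖c k‖ * |M| * (‖c l‖ * N * C2 k l),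
    fun X hX => ?_⟩
  have hM0 := hM X hX
  have s1 : 0 ≤ ∑ k, ‖c k‖ * |M| * C1 k := Finset.sum_nonneg fun k _ => by
    have := p1 k; positivity
  have s2 : 0 ≤ ∑ k, ∑ l, ‖c k‖ * |M| * (‖c l‖ * N * C2 k l) :=
    Finset.sum_nonneg fun k _ => Finset.sum_nonneg fun l _ => by
      have := p2 k l; positivity
  have hcX : ∀ k y, |c k (pairField X y)| ≤ ‖c k‖ * |M| := fun k y => by
    rw [abs_of_nonneg hM0]
    exact ((c k).le_opNorm _).trans
      (mul_le_mul_of_nonneg_left (norm_pairField_le hX.bound y) (norm_nonneg _))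
  have hcV : ∀ k y, |c k (pairField V y)| ≤ ‖c k‖ * N := fun k y =>
    ((c k).le_opNorm _).trans
      (mul_le_mul_of_nonneg_left (norm_pairField_le hN.bound y) (norm_nonneg _))
  filter_upwards [b0, ae_all_iff.2 b1, ae_all_iff.2 fun k => ae_all_iff.2 (b2 k),
    self_mem_ae_restrict hD] with y y0 y1 y2 hy
  have hXS := hS X hX.zero y hy
  have hVS := hS V hV.zero y hy
  refine ⟨by linarith, ?_, ?_⟩
  · rw [hce _ hXS, map_sum, mul_one]
    have : |∑ k, J.grad y (c k (pairField X y) • e k)| ≤ ∑ k, ‖c k‖ * |M| * C1 k := by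
      refine (Finset.abs_sum_le_sum_abs _ _).trans (Finset.sum_le_sum fun k _ => ?_)
      rw [map_smul, smul_eq_mul, abs_mul]
      exact mul_le_mul (hcX k y) (y1 k) (abs_nonneg _) (by positivity)
    linarith
  · rw [mul_one]
    have e1 : J.hess y (pairField X y) (pairField V y) =
        ∑ k, ∑ l, c k (pairField X y) * (c l (pairField V y) * J.hess y (e k) (e l)) := by
      conv_lhs => rw [hce _ hXS, hce _ hVS]
      simp only [map_sum, map_smul, sum_apply, smul_apply, smul_eq_mul]
      simp only [Finset.mul_sum]
      rw [Finset.sum_comm]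
      refine Finset.sum_congr rfl fun k _ => Finset.sum_congr rfl fun l _ => by ring
    rw [e1]
    have : |∑ k, ∑ l, c k (pairField X y) * (c l (pairField V y) * J.hess y (e k) (e l))| ≤
        ∑ k, ∑ l, ‖c k‖ * |M| * (‖c l‖ * N * C2 k l) := by
      refine (Finset.abs_sum_le_sum_abs _ _).trans (Finset.sum_le_sum fun k _ =>
        (Finset.abs_sum_le_sum_abs _ _).trans (Finset.sum_le_sum fun l _ => ?_))
      rw [abs_mul, abs_mul]
      exact mul_le_mul (hcX k y) (mul_le_mul (hcV l y) (y2 k l) (abs_nonneg _) (by positivity))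
        (by positivity) (by positivity)
    linarith

theorem S1Integrable.kernBound (h : P.S1Integrable) (hg : P.Geometry)
    (hA : IsAdmissible P.Ω W T) (hV : IsSmoothField P.Ω V) :
    P.KernBound W T V fun _ => 1 := by
  have hΩ := hg.isOpen_Ω.measurableSet
  have hI := hg.measurableSet_I
  have hb := hg.isBounded_Ω
  refine kernBound_of_jetBound hg hA (fun i j => ?_) (fun i => ?_) fun i M => ?_
  · exact jetBound_of_sobolev hb hV (h.inner i j) (hΩ.prod hΩ) fun _ _ _ _ => Submodule.mem_top
  · exact jetBound_of_sobolev hb hV (h.outer_left i) (hΩ.prod hI) fun X hX y hy =>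
      ⟨Submodule.mem_top, (Submodule.mem_bot ℝ).2 (hX _ (hg.notMem_Ω _ hy.2))⟩
  · obtain ⟨C, hC⟩ := jetBound_of_sobolev hb hV (h.outer_right i) (hI.prod hΩ) (fun X hX y hy =>
      ⟨(Submodule.mem_bot ℝ).2 (hX _ (hg.notMem_Ω _ hy.1)), Submodule.mem_top⟩) M
    exact ⟨C, fun r hr X hX => ae_mono (Measure.restrict_mono
      (prod_mono subset_rfl (moved_subset hg hA hr i)) le_rfl) (hC X hX)⟩

/-- The weight of the singular kernels. -/
def weight (d : ℕ) (s : ℝ) (z : Euc d × Euc d) : ℝ := dist z.1 z.2 ^ ((d : ℝ) + 2 * s)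

theorem weight_nonneg (s : ℝ) (z : Euc d × Euc d) : 0 ≤ weight d s z :=
  Real.rpow_nonneg dist_nonneg _

theorem weight_swap (s : ℝ) (z : Euc d × Euc d) : weight d s z.swap = weight d s z := by
  simp [weight, dist_comm]

theorem WeightedBdd.exists_ae_le {s : ℝ} {D : Set (Euc d × Euc d)} {h : Euc d × Euc d → ℝ}
    (hh : WeightedBdd s D h) : ∃ C : ℝ, ∀ᵐ z ∂(volume.restrict D), |h z| * weight d s z ≤ C := by
  obtain ⟨C, -, hC⟩ := exists_ae_le_of_memLp_top hh
  refine ⟨C, hC.mono fun z hz => ?_⟩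
  exact (le_abs_self _).trans hz

/-- The boundedness principle is applied to the gradient and, with the second direction frozen at V,
to the Hessian. -/
theorem jetBound_of_forall {Ω : Set (Euc d)} (hb : Bornology.IsBounded Ω)
    {D : Set (Euc d × Euc d)} {ρ : Euc d × Euc d → ℝ} (hρ : ∀ z, 0 ≤ ρ z)
    {J : WeakJet (Euc d × Euc d)}
    (h0 : ∃ C : ℝ, ∀ᵐ z ∂(volume.restrict D), |J.val z| * ρ z ≤ C)
    (h1 : ∀ X, IsC0Field 1 Ω X → ∃ C : ℝ, ∀ᵐ z ∂(volume.restrict D),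
      |J.grad z (pairField X z)| * ρ z ≤ C)
    (h2 : ∀ X, IsC0Field 1 Ω X → ∃ C : ℝ, ∀ᵐ z ∂(volume.restrict D),
      |J.hess z (pairField X z) (pairField V z)| * ρ z ≤ C) : JetBound Ω D V ρ J := by
  intro M
  obtain ⟨C0, b0⟩ := h0
  obtain ⟨C1, b1⟩ := FieldBound.of_forall hb hρ h1 M
  obtain ⟨C2, b2⟩ := FieldBound.of_forall hb (l := fun z => (J.hess z).flip (pairField V z)) hρ h2 M
  refine ⟨max C0 (max C1 C2), fun X hX => ?_⟩
  filter_upwards [b0, b1 X hX, b2 X hX] with z z0 z1 z2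
  exact ⟨z0.trans (le_max_left _ _), z1.trans ((le_max_left _ _).trans (le_max_right _ _)),
    z2.trans ((le_max_right _ _).trans (le_max_right _ _))⟩

theorem S1Singular.jetBound_inner {s : ℝ} (h : P.S1Singular s) (hg : P.Geometry)
    (hV : IsSmoothField P.Ω V) (i j : Fin 2) :
    JetBound P.Ω (P.Ω ×ˢ P.Ω) V (weight d s) (P.γ i j) :=
  jetBound_of_forall hg.isBounded_Ω (weight_nonneg s) (h.val_inner i j).exists_ae_le
    (fun X hX => (h.grad_inner X hX i j).exists_ae_le)
    fun X hX => (h.hess_inner V X (hV.isC0Field_one hg.isBounded_Ω) hX i j).exists_ae_le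

theorem S1Singular.jetBound_outer {s : ℝ} (h : P.S1Singular s) (hg : P.Geometry)
    (hV : IsSmoothField P.Ω V) (i : Fin 2) :
    JetBound P.Ω (P.Ω ×ˢ P.I) V (weight d s) (P.γI i) := by
  have hsub : ∀ {p : Euc d × Euc d → Prop},
      (∀ᵐ z ∂(volume.restrict (P.Ω ×ˢ P.I ∪ P.I ×ˢ P.Ω)), p z) →
      ∀ᵐ z ∂(volume.restrict (P.Ω ×ˢ P.I)), p z := fun hp =>
    ae_mono (Measure.restrict_mono subset_union_left le_rfl) hp
  have hm : MeasurableSet (P.Ω ×ˢ P.I) := hg.isOpen_Ω.measurableSet.prod hg.measurableSet_I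
  have hpair : ∀ X : Euc d → Euc d, (∀ x, x ∉ P.Ω → X x = 0) → ∀ z ∈ P.Ω ×ˢ P.I,
      pairField X z = (X z.1, 0) := fun X hX z hz =>
    Prod.ext rfl (hX _ (hg.notMem_Ω _ hz.2))
  refine jetBound_of_forall hg.isBounded_Ω (weight_nonneg s) ?_ (fun X hX => ?_) fun X hX => ?_
  · obtain ⟨C, hC⟩ := (h.val_outer i).exists_ae_le
    exact ⟨C, hsub hC⟩
  · obtain ⟨C, hC⟩ := (h.grad_outer X hX i).exists_ae_le
    refine ⟨C, ?_⟩
    filter_upwards [hsub hC, self_mem_ae_restrict hm] with z hz hzm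
    rwa [hpair X hX.2.2 z hzm]
  · obtain ⟨C, hC⟩ := (h.hess_outer V X (hV.isC0Field_one hg.isBounded_Ω) hX i).exists_ae_le
    refine ⟨C, ?_⟩
    filter_upwards [hsub hC, self_mem_ae_restrict hm] with z hz hzm
    rwa [hpair X hX.2.2 z hzm, hpair V hV.zero z hzm]

variable {s r : ℝ}

/-- The weighted bounds for γ_{iI} differentiate in the first variable along (V(x), 0), which is
zero for x in I. Bounds on I × Ω thus have to be reflected from Ω × I. Symmetry of the kernel at
time r constrains γ_{iI} only where that kernel uses it, hence on F_r(Ω_i). -/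
theorem outer_ae_eq_swap (hd : 0 < d) (h : P.S1Singular s) (hg : P.Geometry)
    (hA : IsAdmissible P.Ω W T) (hsym : P.IsSingularSymmetric W T s) (hr : r ∈ Icc 0 T)
    (i : Fin 2) : ∀ᵐ y ∂(volume.restrict (P.I ×ˢ P.moved W r i)),
      (P.γI i).val y = (P.γI i).val y.swap ∧
      ∀ X X' : Euc d → Euc d, (∀ x, x ∉ P.Ω → X x = 0) → (∀ x, x ∉ P.Ω → X' x = 0) →
        (P.γI i).grad y (pairField X y) = (P.γI i).grad y.swap (pairField X y.swap) ∧
        (P.γI i).hess y (pairField X y) (pairField X' y) =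
          (P.γI i).hess y.swap (pairField X y.swap) (pairField X' y.swap) := by
  have ho := isOpen_moved hg hA hr i
  have hsub := moved_subset hg hA hr i
  have hm : MeasurableSet (P.I ×ˢ P.moved W r i) := hg.measurableSet_I.prod ho.measurableSet
  have hval : ∀ z ∈ P.I ×ˢ P.moved W r i, (P.γI i).val z = (P.γI i).val z.swap := fun z hz => by
    rw [← (kernIs_outer hg hA hr (Or.inr hz)).1, ← hsym.symm r hr z]
    exact (kernIs_outer hg hA hr (Or.inl ⟨hz.2, hz.1⟩)).1
  have key := IsSobolevTwo.ae_eq_swap hd (U := univ ×ˢ P.moved W r i)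
    (D := P.I ×ˢ P.moved W r i) (isOpen_univ.prod ho) hm
    (prod_mono (subset_univ _) subset_rfl) (S := (⊥ : Submodule ℝ (Euc d)).prod ⊤)
    (S' := (⊤ : Submodule ℝ (Euc d)).prod ⊥) (fun v hv => ⟨Submodule.mem_top, hv.1⟩)
    (J := P.γI i) (J' := P.γI i) (fun n hn => by
      have := (h.outer_right n hn i).restrict (U := univ ×ˢ P.moved W r i ∩ far n)
        ((isOpen_univ.prod ho).inter (isOpen_far n))
        (inter_subset_inter_left _ (prod_mono subset_rfl hsub))
      rwa [← inter_inter_distrib_right, prod_inter_prod, inter_univ, inter_eq_right.2 hsub] at this)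
    (fun n hn => by
      have := (h.outer_left n hn i).restrict (U := P.moved W r i ×ˢ univ ∩ far n)
        ((ho.prod isOpen_univ).inter (isOpen_far n))
        (inter_subset_inter_left _ (prod_mono hsub subset_rfl))
      rw [← inter_inter_distrib_right, prod_inter_prod, inter_univ, inter_eq_right.2 hsub] at this
      rwa [preimage_swap_prod, preimage_swap_prod]) hval
  filter_upwards [key, self_mem_ae_restrict hm] with y hy hym
  refine ⟨hval y hym, fun X X' hX hX' => ?_⟩
  have m1 : pairField X y ∈ (⊥ : Submodule ℝ (Euc d)).prod ⊤ :=
    ⟨(Submodule.mem_bot ℝ).2 (hX _ (hg.notMem_Ω _ hym.1)), Submodule.mem_top⟩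
  have m2 : pairField X' y ∈ (⊥ : Submodule ℝ (Euc d)).prod ⊤ :=
    ⟨(Submodule.mem_bot ℝ).2 (hX' _ (hg.notMem_Ω _ hym.1)), Submodule.mem_top⟩
  exact ⟨hy.1 _ m1, hy.2 _ m1 _ m2⟩

/-- The symmetry of the glued kernel relates γ_{ij} to the reflected γ_{ji} only on the piece
F_r(Ω_i) × F_r(Ω_j), not on all of Ω × Ω. -/
theorem inner_ae_eq_swap (hd : 0 < d) (h : P.S1Singular s) (hg : P.Geometry)
    (hA : IsAdmissible P.Ω W T) (hsym : P.IsSingularSymmetric W T s) (hr : r ∈ Icc 0 T)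
    (i j : Fin 2) : ∀ᵐ y ∂(volume.restrict (P.moved W r i ×ˢ P.moved W r j)),
      ∀ v, (P.γ i j).grad y v = (P.γ j i).grad y.swap v.swap := by
  have ho := isOpen_moved hg hA hr
  have hsub := moved_subset hg hA hr
  have hm : MeasurableSet (P.moved W r i ×ˢ P.moved W r j) :=
    (ho i).measurableSet.prod (ho j).measurableSet
  have hres : ∀ i j, ∀ n, 0 < n → IsSobolevTwo ⊤ (P.moved W r i ×ˢ P.moved W r j ∩ far n)
      (P.moved W r i ×ˢ P.moved W r j ∩ far n) ⊤ (P.γ i j) := fun i j n hn => by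
    have := (h.inner n hn i j).restrict (U := P.moved W r i ×ˢ P.moved W r j ∩ far n)
      (((ho i).prod (ho j)).inter (isOpen_far n))
      (inter_subset_inter_left _ (prod_mono (hsub i) (hsub j)))
    rwa [inter_eq_right.2 (inter_subset_inter_left _ (prod_mono (hsub i) (hsub j)))] at this
  have key := IsSobolevTwo.ae_eq_swap hd (U := P.moved W r i ×ˢ P.moved W r j)
    (D := P.moved W r i ×ˢ P.moved W r j) ((ho i).prod (ho j)) hm subset_rfl (S := ⊤) (S' := ⊤)
    (fun _ _ => Submodule.mem_top) (J := P.γ i j) (J' := P.γ j i) (hres i j)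
    (fun n hn => by rw [preimage_swap_prod]; exact hres j i n hn) (fun z hz => by
      rw [← (kernIs_inner hg hA hr hz).1, ← hsym.symm r hr z]
      exact (kernIs_inner hg hA hr (show z.swap ∈ _ from ⟨hz.2, hz.1⟩)).1)
  filter_upwards [key] with y hy v
  exact hy.1 v Submodule.mem_top

theorem S1Singular.kernBound (hd : 0 < d) (h : P.S1Singular s) (hg : P.Geometry)
    (hA : IsAdmissible P.Ω W T) (hV : IsSmoothField P.Ω V)
    (hsym : P.IsSingularSymmetric W T s) : P.KernBound W T V (weight d s) := by
  refine kernBound_of_jetBound hg hA (h.jetBound_inner hg hV) (h.jetBound_outer hg hV)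
    fun i M => ?_
  obtain ⟨C, hC⟩ := h.jetBound_outer hg hV i M
  refine ⟨C, fun r hr X hX => ?_⟩
  have hm : MeasurableSet (P.Ω ×ˢ P.I) := hg.isOpen_Ω.measurableSet.prod hg.measurableSet_I
  have h1 := ae_restrict_swap hm (hC X hX)
  rw [preimage_swap_prod] at h1
  have h2 := ae_mono (Measure.restrict_mono (prod_mono subset_rfl (moved_subset hg hA hr i))
    (le_refl volume)) h1
  filter_upwards [h2, outer_ae_eq_swap hd h hg hA hsym hr i] with y hy hs
  obtain ⟨s1, s2⟩ := hs
  obtain ⟨s3, s4⟩ := s2 X V hX.zero hV.zero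
  rw [JetLe, s1, s3, s4, ← weight_swap]
  exact hy

/-- The piecewise gradient of a symmetric kernel is symmetric. -/
theorem kernGrad_swap (hd : 0 < d) (h : P.S1Singular s) (hg : P.Geometry)
    (hA : IsAdmissible P.Ω W T) (hsym : P.IsSingularSymmetric W T s) (hr : r ∈ Icc 0 T)
    {X : Euc d → Euc d} (hX : ∀ x, x ∉ P.Ω → X x = 0) :
    ∀ᵐ y : Euc d × Euc d, P.kernGrad (P.moved W r) y.swap (pairField X y.swap) =
      P.kernGrad (P.moved W r) y (pairField X y) := by
  have hm := fun i => (isOpen_moved hg hA hr i).measurableSet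
  have hI := hg.measurableSet_I
  have a2 : ∀ i, ∀ᵐ y ∂(volume.restrict (P.I ×ˢ P.moved W r i)),
      (P.γI i).grad y (pairField X y) = (P.γI i).grad y.swap (pairField X y.swap) := fun i =>
    (outer_ae_eq_swap hd h hg hA hsym hr i).mono fun y hy => (hy.2 X X hX hX).1
  have a3 : ∀ i, ∀ᵐ y ∂(volume.restrict (P.moved W r i ×ˢ P.I)),
      (P.γI i).grad y (pairField X y) = (P.γI i).grad y.swap (pairField X y.swap) := fun i => by
    have := ae_restrict_swap (hI.prod (hm i)) (a2 i)
    rw [preimage_swap_prod] at this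
    exact this.mono fun y hy => by rw [Prod.swap_swap] at hy; exact hy.symm
  filter_upwards [ae_all_iff.2 fun i => ae_all_iff.2 fun j =>
      (ae_restrict_iff' ((hm i).prod (hm j))).1 (inner_ae_eq_swap hd h hg hA hsym hr i j),
    ae_all_iff.2 fun i => (ae_restrict_iff' (hI.prod (hm i))).1 (a2 i),
    ae_all_iff.2 fun i => (ae_restrict_iff' ((hm i).prod hI)).1 (a3 i)] with y y1 y2 y3
  by_cases c1 : ∃ i j, y ∈ P.moved W r i ×ˢ P.moved W r j
  · obtain ⟨i, j, hy⟩ := c1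
    rw [(kernIs_inner hg hA hr hy).2.1,
      (kernIs_inner hg hA hr (show y.swap ∈ P.moved W r j ×ˢ P.moved W r i from ⟨hy.2, hy.1⟩)).2.1]
    exact (y1 i j hy (pairField X y)).symm
  by_cases c2 : ∃ i, y ∈ P.moved W r i ×ˢ P.I ∪ P.I ×ˢ P.moved W r i
  · obtain ⟨i, hy⟩ := c2
    rw [(kernIs_outer hg hA hr hy).2.1, (kernIs_outer hg hA hr (show y.swap ∈
      P.moved W r i ×ˢ P.I ∪ P.I ×ˢ P.moved W r i from
        hy.elim (fun hy => Or.inr ⟨hy.2, hy.1⟩) fun hy => Or.inl ⟨hy.2, hy.1⟩)).2.1]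
    rcases hy with hy | hy
    · exact (y3 i hy).symm
    · exact (y2 i hy).symm
  · push Not at c1 c2
    rw [(kernIs_zero (P := P) c1 c2).2.1, (kernIs_zero (P := P) (y := y.swap)
      (fun i j hy => c1 j i ⟨hy.2, hy.1⟩) fun i hy => c2 i (hy.elim
        (fun hy => Or.inr ⟨hy.2, hy.1⟩) fun hy => Or.inl ⟨hy.2, hy.1⟩)).2.1]
    rfl

end Setting

end NonlocalShape
end

/-! ### Weighted integrals of the transported kernels. -/

open Set Filter Topology MeasureTheory
open scoped ENNReal ContDiff

noncomputable section

namespace NonlocalShape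

set_option linter.unusedSectionVars false

variable {d : ℕ} {P : Setting d} {W V : Euc d → Euc d} {T : ℝ}

theorem IsBoundedField.mono {Ω : Set (Euc d)} {M M' : ℝ} {X : Euc d → Euc d}
    (h : IsBoundedField Ω M X) (hM : M ≤ M') : IsBoundedField Ω M' X :=
  ⟨h.contDiff, h.zero, h.fderiv_zero, fun x => (h.bound x).trans hM,
    fun x => (h.bound_fderiv x).trans hM⟩

/-- The derivative of a `C²` field in the direction of a `C¹` field. -/
theorem IsSmoothField.isBoundedField_fderiv {Ω : Set (Euc d)} (hV : IsSmoothField Ω V)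
    (hb : Bornology.IsBounded Ω) {M : ℝ} (hM : 0 ≤ M) :
    ∃ M' : ℝ, ∀ X, IsBoundedField Ω M X → IsBoundedField Ω M' fun y => fderiv ℝ V y (X y) := by
  obtain ⟨N, hN⟩ := hV.isBoundedField hb
  have hN0 : 0 ≤ N := (norm_nonneg _).trans (hN.bound 0)
  obtain ⟨L, hL, hLb⟩ := exists_bound_of_vanishing hb
    (hV.contDiff_fderiv.continuous_fderiv (by simp)) hV.fderiv_fderiv_zero
  refine ⟨N * M + L * M, fun X hX => ?_⟩
  have hd : ∀ y, HasFDerivAt (fun y => fderiv ℝ V y (X y))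
      ((fderiv ℝ V y).comp (fderiv ℝ X y) + (fderiv ℝ (fderiv ℝ V) y).flip (X y)) y := fun y =>
    ((hV.contDiff_fderiv.differentiable (by simp) y).hasFDerivAt).clm_apply
      ((hX.contDiff.differentiable (by simp) y).hasFDerivAt)
  have h1 : 0 ≤ L * M := by positivity
  have h2 : 0 ≤ N * M := by positivity
  refine ⟨hV.contDiff_fderiv.clm_apply hX.contDiff, fun x hx => ?_, fun x hx => ?_, fun x => ?_,
    fun x => ?_⟩
  · simp [hX.zero x hx]
  · rw [(hd x).fderiv, hX.fderiv_zero x hx, hX.zero x hx]; simp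
  · have := ((fderiv ℝ V x).le_opNorm (X x)).trans
      (mul_le_mul (hN.bound_fderiv x) (hX.bound x) (norm_nonneg _) hN0)
    linarith
  · rw [(hd x).fderiv]
    refine (norm_add_le _ _).trans (add_le_add ?_ ?_)
    · exact (ContinuousLinearMap.opNorm_comp_le _ _).trans
        (mul_le_mul (hN.bound_fderiv x) (hX.bound_fderiv x) (norm_nonneg _) hN0)
    · refine ((fderiv ℝ (fderiv ℝ V) x).flip.le_opNorm (X x)).trans ?_
      rw [ContinuousLinearMap.opNorm_flip]
      exact mul_le_mul (hLb x) (hX.bound x) (norm_nonneg _) hL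

theorem IsAdmissible.exists_transport_field {Ω : Set (Euc d)} (hA : IsAdmissible Ω W T) :
    ∃ (Wt : ℝ → Euc d → Euc d) (M : ℝ), 0 ≤ M ∧ ∀ r ∈ Icc 0 T, IsBoundedField Ω M (Wt r) ∧
      ∀ x, Wt r (pert W r x) = W x := by
  obtain ⟨Wt, M, h⟩ := hA.exists_transport
  refine ⟨Wt, max M 0, le_max_right _ _, fun r hr => ?_⟩
  obtain ⟨h1, h2, h3, h4, h5⟩ := h r hr
  exact ⟨⟨h1, h3, h4, fun x => (h5 x).1.trans (le_max_left _ _),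
    fun x => (h5 x).2.trans (le_max_left _ _)⟩, h2⟩

namespace Setting

theorem Geometry.pert2_mem (hg : P.Geometry) (hA : IsAdmissible P.Ω W T) {r : ℝ}
    (hr : r ∈ Icc 0 T) {z : Euc d × Euc d} (hz : z ∈ P.dom ×ˢ P.dom) :
    pert2 W r z ∈ P.dom ×ˢ P.dom := by
  have : ∀ x ∈ P.dom, pert W r x ∈ P.dom := by
    rintro x (hx | hx)
    · exact Or.inl ((hA.pert_mem_iff hr).2 hx)
    · rw [hA.pert_of_notMem r (hg.notMem_Ω x hx)]; exact Or.inr hx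
  exact ⟨this _ hz.1, this _ hz.2⟩

/-- Bounds for the transported kernels and their time derivatives. -/
theorem KernBound.transport {ρ : Euc d × Euc d → ℝ} (h : P.KernBound W T V ρ) (hg : P.Geometry)
    (hA : IsAdmissible P.Ω W T) (hV : IsSmoothField P.Ω V) (hρ0 : ∀ z, 0 ≤ ρ z)
    (hρ : ∃ c : ℝ, 0 < c ∧ ∀ r ∈ Icc 0 T, ∀ z, c * ρ z ≤ ρ (pert2 W r z)) :
    ∃ C : ℝ, 0 ≤ C ∧ ∀ r ∈ Icc 0 T, ∀ᵐ z ∂(volume.restrict (P.dom ×ˢ P.dom)),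
      |P.kern (P.moved W r) (pert2 W r z)| * ρ z ≤ C ∧
      |P.kernGrad (P.moved W r) (pert2 W r z) (pairField W z)| * ρ z ≤ C ∧
      |P.kernGrad (P.moved W r) (pert2 W r z) (pairField V (pert2 W r z))| * ρ z ≤ C ∧
      |P.kernHess (P.moved W r) (pert2 W r z) (pairField W z) (pairField V (pert2 W r z)) +
        P.kernGrad (P.moved W r) (pert2 W r z) (pairDeriv V (pert2 W r z) (pairField W z))| * ρ z
        ≤ C := by
  obtain ⟨Wt, M, hM, hWt⟩ := hA.exists_transport_field
  obtain ⟨N, hN⟩ := hV.isBoundedField hg.isBounded_Ω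
  obtain ⟨L, hL⟩ := hV.isBoundedField_fderiv hg.isBounded_Ω hM
  obtain ⟨c, hc, hρc⟩ := hρ
  -- Three fields occur: W∘F_r⁻¹, V, and DV applied to W∘F_r⁻¹. A common bound for them yields one
  -- constant for all r.
  obtain ⟨C, hC⟩ := h (max M (max N L))
  have hdm := hg.measurableSet_dom.prod hg.measurableSet_dom
  -- The factor 2 is for the last quantity, a sum of two terms; division by c passes from the weight
  -- at F_r(z) to the weight at z.
  refine ⟨2 * |C| / c, by positivity, fun r hr => ?_⟩
  obtain ⟨hX, hXW⟩ := hWt r hr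
  have q := hA.isQuasiFlow_pair.quasiMeasurePreserving hr
  have a1 := q.ae ((ae_restrict_iff' hdm).1 (hC r hr _ (hX.mono (le_max_left _ _))))
  have a2 := q.ae ((ae_restrict_iff' hdm).1 (hC r hr _
    (hN.mono ((le_max_left _ _).trans (le_max_right _ _)))))
  have a3 := q.ae ((ae_restrict_iff' hdm).1 (hC r hr _
    ((hL _ hX).mono ((le_max_right _ _).trans (le_max_right _ _)))))
  rw [ae_restrict_iff' hdm]
  filter_upwards [a1, a2, a3] with z b1 b2 b3 hz
  have hz' := hg.pert2_mem hA hr hz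
  rw [flow_pair_eq_pert2] at b1 b2 b3
  obtain ⟨b1, b1', b1''⟩ := b1 hz'
  obtain ⟨-, b2, -⟩ := b2 hz'
  obtain ⟨-, b3, -⟩ := b3 hz'
  have eW : pairField (Wt r) (pert2 W r z) = pairField W z := Prod.ext (hXW _) (hXW _)
  have eU : pairField (fun y => fderiv ℝ V y (Wt r y)) (pert2 W r z) =
      pairDeriv V (pert2 W r z) (pairField W z) :=
    Prod.ext (congrArg (fderiv ℝ V _) (hXW _)) (congrArg (fderiv ℝ V _) (hXW _))
  rw [eW] at b1' b1''
  rw [eU] at b3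
  have key : ∀ {a B : ℝ}, |a| * ρ (pert2 W r z) ≤ B → |a| * ρ z ≤ B / c := fun {a B} ha => by
    rw [le_div_iff₀ hc]
    calc |a| * ρ z * c = |a| * (c * ρ z) := by ring
      _ ≤ |a| * ρ (pert2 W r z) := mul_le_mul_of_nonneg_left (hρc r hr z) (abs_nonneg _)
      _ ≤ B := ha
  have hC2 : C ≤ 2 * |C| := by linarith [le_abs_self C, abs_nonneg C]
  refine ⟨key (b1.trans hC2), key (b1'.trans hC2), key (b2.trans hC2), key ?_⟩
  have h1 := mul_le_mul_of_nonneg_right (abs_add_le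
    (P.kernHess (P.moved W r) (pert2 W r z) (pairField W z) (pairField V (pert2 W r z)))
    (P.kernGrad (P.moved W r) (pert2 W r z) (pairDeriv V (pert2 W r z) (pairField W z))))
    (hρ0 (pert2 W r z))
  linarith [le_abs_self C]

end Setting

theorem IsAdmissible.fam_jac2 {Ω : Set (Euc d)} (hA : IsAdmissible Ω W T)
    (μ : Measure (Euc d × Euc d)) (N : ℝ → Euc d × Euc d → ℝ) :
    Fam μ T N 0 (fun r z => jac2 W r z) (fun r z => jac2Dot W r z) := by
  obtain ⟨c, M, hc, hM, hb⟩ := hA.exists_jac2_bounds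
  exact .of_hasDerivAt hA.continuous_jac2 hA.continuous_jac2Dot (fun x r => hA.hasDerivAt_jac2 r x)
    (M := M) fun r hr z => ⟨(hb r hr z).2.1, (hb r hr z).2.2⟩

namespace Setting

/-- Differentiation of the weighted integrals of the transported kernels. -/
theorem kern_hasDerivWithinAt (hd : 0 < d) (hg : P.Geometry) (hA : IsAdmissible P.Ω W T)
    (hV : IsSmoothField P.Ω V) (hS : P.OffDiagSobolev) {ρ : Euc d × Euc d → ℝ}
    (hKB : P.KernBound W T V ρ) (hρ0 : ∀ z, 0 ≤ ρ z) (hρp : ∀ᵐ z, 0 < ρ z)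
    (hρ : ∃ c : ℝ, 0 < c ∧ ∀ r ∈ Icc 0 T, ∀ z, c * ρ z ≤ ρ (pert2 W r z))
    {h : Euc d × Euc d → ℝ}
    (hh : AEStronglyMeasurable h (volume.restrict (P.dom ×ˢ P.dom)))
    (hint : IntegrableOn (fun z => |h z| / ρ z) (P.dom ×ˢ P.dom)) {t : ℝ} (ht : t ∈ Icc 0 T) :
    (IntegrableOn (fun z => h z * P.kern (P.moved W t) (pert2 W t z) * jac2 W t z)
        (P.dom ×ˢ P.dom) ∧
      DifferentiableWithinAt ℝ (fun r => ∫ z in P.dom ×ˢ P.dom,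
        h z * P.kern (P.moved W r) (pert2 W r z) * jac2 W r z) (Icc 0 T) t) ∧
    ∀ i, IntegrableOn (fun z => h z * P.PsiT V W t i z * jac2 W t z) (P.dom ×ˢ P.dom) ∧
      IntegrableOn (fun z => h z * (P.PsiGradT V W t i z * jac2 W t z +
        P.PsiT V W t i z * jac2Dot W t z)) (P.dom ×ˢ P.dom) ∧
      HasDerivWithinAt (fun r => ∫ z in P.dom ×ˢ P.dom, h z * P.PsiT V W r i z * jac2 W r z)
        (∫ z in P.dom ×ˢ P.dom, h z * (P.PsiGradT V W t i z * jac2 W t z +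
          P.PsiT V W t i z * jac2Dot W t z)) (Icc 0 T) t := by
  obtain ⟨C, hC, hb⟩ := hKB.transport hg hA hV hρ0 hρ
  obtain ⟨f0, f1⟩ := hg.aeFamily_kern hd hA hV hS
  have hT := hA.pos.le
  set μ := (volume : Measure (Euc d × Euc d)).restrict (P.dom ×ˢ P.dom) with hμ
  -- The transported kernels times ρ are bounded uniformly in time, so |h|/ρ is a majorant that does
  -- not depend on time.
  set N : ℝ → Euc d × Euc d → ℝ := fun _ z => |h z| / ρ z with hN
  have hN0 : ∀ r z, 0 ≤ N r z := fun r z => div_nonneg (abs_nonneg _) (hρ0 z)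
  have hL : L1Cont μ T fun r z => N r z ^ 1 := by
    simp only [pow_one]
    exact .const hint
  have dom : ∀ {A : ℝ → Euc d × Euc d → ℝ}, (∀ r ∈ Icc 0 T, ∀ᵐ z ∂μ, |A r z| * ρ z ≤ C) →
      DomBy μ T N 1 fun r z => h z * A r z := fun {A} hA' => by
    refine ⟨C, hC, fun r hr => ?_⟩
    filter_upwards [hA' r hr, ae_restrict_of_ae hρp] with z h1 h2
    rw [abs_mul, pow_one, hN]
    have : |A r z| ≤ C / ρ z := by rwa [le_div_iff₀ h2]
    calc |h z| * |A r z| ≤ |h z| * (C / ρ z) := mul_le_mul_of_nonneg_left this (abs_nonneg _)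
      _ = C * (|h z| / ρ z) := by ring
  have fam : ∀ {A A' : ℝ → Euc d × Euc d → ℝ}, AEFamily μ T A A' →
      (∀ r ∈ Icc 0 T, ∀ᵐ z ∂μ, |A r z| * ρ z ≤ C) →
      (∀ r ∈ Icc 0 T, ∀ᵐ z ∂μ, |A' r z| * ρ z ≤ C) →
      Fam μ T N 1 (fun r z => h z * A r z) (fun r z => h z * A' r z) := fun hf h1 h2 =>
    ⟨((AEFamily.const hh).mul hT hf).congr fun r _ => ae_of_all _ fun z => ⟨rfl, by ring⟩,
      dom h1, dom h2⟩
  have F0 := fam f0 (fun r hr => (hb r hr).mono fun z hz => hz.1)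
    fun r hr => (hb r hr).mono fun z hz => hz.2.1
  have F1 := fam f1 (fun r hr => (hb r hr).mono fun z hz => hz.2.2.1)
    fun r hr => (hb r hr).mono fun z hz => hz.2.2.2
  have Fj := hA.fam_jac2 μ N
  have Fd := (hA.fam_divg_comp hV μ N continuous_fst).add (hA.fam_divg_comp hV μ N continuous_snd)
  constructor
  · have := (F0.mul hT hN0 Fj).hasDerivWithinAt hT hL ht
    exact ⟨this.1, this.2.2.differentiableWithinAt⟩
  · have Fi : ∀ i, Fam μ T N 1 (fun r z => h z * P.PsiT V W r i z)
        (fun r z => h z * P.PsiGradT V W r i z) := by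
      intro i
      fin_cases i
      · exact F1.congr fun r _ => ae_of_all _ fun z =>
          ⟨by simp [PsiT, Psi], by simp [PsiGradT, PsiGrad, pairDeriv]⟩
      · refine (F0.mul hT hN0 Fd).congr fun r _ => ae_of_all _ fun z => ⟨?_, ?_⟩
        · simp [PsiT, Psi, pert2]; ring
        · simp [PsiGradT, PsiGrad, pert2, pairField]; ring
    intro i
    have := (((Fi i).mul hT hN0 Fj).congr (B := fun r z => h z * P.PsiT V W r i z * jac2 W r z)
      (B' := fun r z => h z * (P.PsiGradT V W r i z * jac2 W r z +
        P.PsiT V W r i z * jac2Dot W r z)) fun r _ => ae_of_all _ fun z =>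
        ⟨rfl, by ring⟩).hasDerivWithinAt hT hL ht
    exact this

end Setting

end NonlocalShape
end

/-! ### The bilinear form for integrable kernels. -/

open Set Filter Topology MeasureTheory
open scoped ENNReal ContDiff

noncomputable section

namespace NonlocalShape

set_option linter.unusedSectionVars false

variable {d : ℕ} {P : Setting d} {W V : Euc d → Euc d} {T : ℝ}

theorem volume_restrict_prod (s : Set (Euc d)) :
    (volume : Measure (Euc d × Euc d)).restrict (s ×ˢ s) =
      (volume.restrict s).prod (volume.restrict s) := by
  rw [Measure.prod_restrict, Measure.volume_eq_prod]

theorem integrableOn_swap {B : Euc d × Euc d → ℝ} {s : Set (Euc d)} (hB : IntegrableOn B (s ×ˢ s)) :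
    IntegrableOn (fun z => B z.swap) (s ×ˢ s) := by
  have := (measurePreserving_swap.integrableOn_comp_preimage measurableEmbedding_swap
    (f := B) (s := s ×ˢ s)).2 hB
  rwa [preimage_swap_prod] at this

theorem integral_add_swap {B : Euc d × Euc d → ℝ} {s : Set (Euc d)}
    (hB : IntegrableOn B (s ×ˢ s)) : IntegrableOn (fun z => B z + B z.swap) (s ×ˢ s) ∧
      ∫ z in s ×ˢ s, (B z + B z.swap) = 2 * ∫ z in s ×ˢ s, B z := by
  refine ⟨hB.add (integrableOn_swap hB), ?_⟩
  have h1 := setIntegral_swap B (s ×ˢ s)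
  rw [preimage_swap_prod] at h1
  rw [integral_add hB (integrableOn_swap hB), h1]
  ring

theorem jac2_swap (r : ℝ) (z : Euc d × Euc d) : jac2 W r z.swap = jac2 W r z := mul_comm _ _

theorem jac2Dot_swap (r : ℝ) (z : Euc d × Euc d) : jac2Dot W r z.swap = jac2Dot W r z := by
  simp only [jac2Dot, jac2_swap]

namespace Setting

theorem nlInt_pull {Ω : Set (Euc d)} (hA : IsAdmissible Ω W T) {r : ℝ} (hr : r ∈ Icc 0 T)
    (k : Euc d × Euc d → ℝ) (u v : Euc d → ℝ) (z : Euc d × Euc d) :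
    nlInt k (pull W r u) (pull W r v) (pert2 W r z) = nlInt (fun z => k (pert2 W r z)) u v z := by
  have h1 : (pert2 W r z).swap = pert2 W r z.swap := rfl
  simp only [nlInt, h1]
  simp only [pert2, hA.pull_pert hr]

/-- The integrand is a function plus its reflection, so without symmetry of the kernel only the
factor (v(x)-v(y))u(x) has to be controlled. -/
theorem nlInt_eq_add_swap (k : Euc d × Euc d → ℝ) (u v : Euc d → ℝ) (z : Euc d × Euc d) :
    nlInt k u v z = (v z.1 - v z.2) * u z.1 * k z + (v z.swap.1 - v z.swap.2) * u z.swap.1 *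
      k z.swap := by
  simp only [nlInt, Prod.fst_swap, Prod.snd_swap]; ring

theorem nlInt_of_symm {k : Euc d × Euc d → ℝ} {z : Euc d × Euc d} (hk : k z.swap = k z)
    (u v : Euc d → ℝ) : nlInt k u v z = (v z.1 - v z.2) * (u z.1 - u z.2) * k z := by
  rw [nlInt, hk]; ring

theorem op_eq (hg : P.Geometry) (hA : IsAdmissible P.Ω W T) {r : ℝ} (hr : r ∈ Icc 0 T)
    (u v : Euc d → ℝ) : P.op W r (pull W r u) (pull W r v) = 1 / 2 * ∫ z in P.dom ×ˢ P.dom,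
      nlInt (fun z => P.kern (P.moved W r) (pert2 W r z)) u v z * jac2 W r z := by
  rw [op, hA.integral_image_prod hr hg.measurableSet_dom]
  simp only [nlInt_pull hA hr]

theorem opSD_eq (hg : P.Geometry) (hA : IsAdmissible P.Ω W T) {r : ℝ} (hr : r ∈ Icc 0 T)
    (u v : Euc d → ℝ) : P.opSD V W r (pull W r u) (pull W r v) =
      ∑ i : Fin 2, 1 / 2 * ∫ z in P.dom ×ˢ P.dom, nlInt (P.PsiT V W r i) u v z * jac2 W r z := by
  rw [opSD]
  refine Finset.sum_congr rfl fun i _ => ?_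
  rw [hA.integral_image_prod hr hg.measurableSet_dom]
  simp only [nlInt_pull hA hr]
  rfl

/-- The domain has finite measure: v(x)u(x) is integrable in x and constant in y, and u(x)v(y) is a
product of integrable functions. -/
theorem integrableOn_mul_fst (hg : P.Geometry) {u v : Euc d → ℝ}
    (hu : MemLp u 2 (volume.restrict P.dom)) (hv : MemLp v 2 (volume.restrict P.dom)) :
    IntegrableOn (fun z : Euc d × Euc d => (v z.1 - v z.2) * u z.1) (P.dom ×ˢ P.dom) := by
  have : IsFiniteMeasure (volume.restrict P.dom) :=
    isFiniteMeasure_restrict.2 hg.isBounded_dom.measure_lt_top.ne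
  rw [IntegrableOn, volume_restrict_prod]
  have h1 : Integrable (fun z : Euc d × Euc d => (v z.1 * u z.1) * 1)
      ((volume.restrict P.dom).prod (volume.restrict P.dom)) :=
    (hv.integrable_mul hu).mul_prod (integrable_const 1)
  have h2 : Integrable (fun z : Euc d × Euc d => u z.1 * v z.2)
      ((volume.restrict P.dom).prod (volume.restrict P.dom)) :=
    (hu.integrable (by norm_num)).mul_prod (hv.integrable (by norm_num))
  refine (h1.sub h2).congr (ae_of_all _ fun z => ?_)
  simp only [Pi.sub_apply]; ring

/-- The case ρ = 1. The two reflected halves of each integrand have the same integral, which absorbs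
the factor 1/2. -/
theorem S1Integrable.op_hasDerivWithinAt (h : P.S1Integrable) (hd : 0 < d) (hg : P.Geometry)
    (hA : IsAdmissible P.Ω W T) (hV : IsSmoothField P.Ω V) {u v : Euc d → ℝ}
    (hu : MemLp u 2 (volume.restrict P.dom)) (hv : MemLp v 2 (volume.restrict P.dom))
    {t : ℝ} (ht : t ∈ Icc 0 T) :
    (IntegrableOn (nlInt (P.kern (P.moved W t)) (pull W t u) (pull W t v))
        ((pert W t '' P.dom) ×ˢ (pert W t '' P.dom)) ∧
      DifferentiableWithinAt ℝ (fun r => P.op W r (pull W r u) (pull W r v)) (Icc 0 T) t) ∧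
    (∀ i, IntegrableOn (nlInt (P.Psi (P.moved W t) V i) (pull W t u) (pull W t v))
        ((pert W t '' P.dom) ×ˢ (pert W t '' P.dom))) ∧
    (∀ i, IntegrableOn (P.opDot V W t i u v) (P.dom ×ˢ P.dom)) ∧
    HasDerivWithinAt (fun r => P.opSD V W r (pull W r u) (pull W r v))
      (∑ i : Fin 2, 1 / 2 * ∫ z in P.dom ×ˢ P.dom, P.opDot V W t i u v z) (Icc 0 T) t := by
  have hint := integrableOn_mul_fst hg hu hv
  have key := fun t (ht : t ∈ Icc 0 T) => kern_hasDerivWithinAt hd hg hA hV (h.offDiagSobolev hg)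
    (h.kernBound hg hA hV) (fun _ => zero_le_one) (ae_of_all _ fun _ => one_pos)
    ⟨1, one_pos, fun _ _ _ => (one_mul _).le⟩ hint.1 (by simp only [div_one]; exact hint.abs) ht
  have e1 : ∀ (k : Euc d × Euc d → ℝ) r z, nlInt k u v z * jac2 W r z =
      (fun z : Euc d × Euc d => (v z.1 - v z.2) * u z.1 * k z * jac2 W r z) z +
        (fun z : Euc d × Euc d => (v z.1 - v z.2) * u z.1 * k z * jac2 W r z) z.swap :=
    fun k r z => by
      simp only [nlInt_eq_add_swap, jac2_swap]; ring
  have e2 : ∀ i, P.opDot V W t i u v = fun z => (fun z : Euc d × Euc d => (v z.1 - v z.2) * u z.1 *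
      (P.PsiGradT V W t i z * jac2 W t z + P.PsiT V W t i z * jac2Dot W t z)) z +
      (fun z : Euc d × Euc d => (v z.1 - v z.2) * u z.1 *
      (P.PsiGradT V W t i z * jac2 W t z + P.PsiT V W t i z * jac2Dot W t z)) z.swap :=
    fun i => funext fun z => by
      simp only [opDot, nlInt_eq_add_swap, jac2_swap, jac2Dot_swap]; ring
  obtain ⟨⟨k1, k2⟩, k3⟩ := key t ht
  refine ⟨⟨?_, ?_⟩, fun i => ?_, fun i => ?_, ?_⟩
  · rw [hA.integrableOn_image_prod ht hg.measurableSet_dom]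
    simp only [nlInt_pull hA ht, e1]
    exact (integral_add_swap k1).1
  · refine k2.congr (fun r hr => ?_) ?_ <;>
    · rw [op_eq hg hA (by assumption)]
      simp only [e1]
      rw [(integral_add_swap (key _ (by assumption)).1.1).2]
      ring
  · rw [hA.integrableOn_image_prod ht hg.measurableSet_dom]
    simp only [nlInt_pull hA ht, e1]
    exact (integral_add_swap (k3 i).1).1
  · rw [e2 i]
    exact (integral_add_swap (k3 i).2.1).1
  · have hsum := HasDerivWithinAt.fun_sum (u := Finset.univ) fun i (_ : i ∈ Finset.univ) =>
      (k3 i).2.2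
    have e3 : ∀ r ∈ Icc 0 T, P.opSD V W r (pull W r u) (pull W r v) = ∑ i : Fin 2,
        ∫ z in P.dom ×ˢ P.dom, (v z.1 - v z.2) * u z.1 * P.PsiT V W r i z * jac2 W r z :=
      fun r hr => by
        rw [opSD_eq hg hA hr]
        refine Finset.sum_congr rfl fun i _ => ?_
        simp only [e1]
        rw [(integral_add_swap ((key r hr).2 i).1).2]
        ring
    refine (hsum.congr e3 (e3 t ht)).congr_deriv (Finset.sum_congr rfl fun i _ => ?_)
    rw [e2 i, (integral_add_swap (k3 i).2.1).2]
    ring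

end Setting

end NonlocalShape
end

/-! ### The bilinear form for singular symmetric kernels. -/

open Set Filter Topology MeasureTheory
open scoped ENNReal ContDiff

noncomputable section

namespace NonlocalShape

set_option linter.unusedSectionVars false

variable {d : ℕ} {P : Setting d} {W V : Euc d → Euc d} {T : ℝ}

namespace Setting

theorem Standing.Γ_subset (h : P.Standing) : P.Γ ⊆ P.Ω := by
  rw [h.decomposition]
  exact fun x hx => Or.inl (Or.inr hx)

theorem Standing.notMem_part (h : P.Standing) {x : Euc d} (hx : x ∈ P.Γ) (i : Fin 2) :
    x ∉ P.part i := by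
  intro hi
  have : ∀ i, x ∈ frontier (P.part i) := fun i => by
    fin_cases i
    · exact hx.1
    · exact hx.2
  have h1 := this i
  rw [(h.isOpen_part i).frontier_eq] at h1
  exact h1.2 hi

theorem measurableSet_Γ : MeasurableSet P.Γ :=
  (isClosed_frontier.inter isClosed_frontier).measurableSet

/-- The kernels vanish on the interface and on `I × I`. -/
theorem Standing.kernIs_zero (h : P.Standing) (hA : IsAdmissible P.Ω W T) {r : ℝ}
    (hr : r ∈ Icc 0 T) {z : Euc d × Euc d}
    (hz : z.1 ∈ P.Γ ∨ z.2 ∈ P.Γ ∨ z.1 ∈ P.I ∧ z.2 ∈ P.I) :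
    P.KernIs (P.moved W r) ⟨0, 0, 0⟩ (pert2 W r z) := by
  have hg := h.geometry
  have m1 : ∀ i x, pert W r x ∈ P.moved W r i ↔ x ∈ P.part i := fun i x =>
    (hA.injective hr).mem_set_image
  have n1 : ∀ {x}, x ∈ P.Γ → ∀ i, pert W r x ∉ P.moved W r i := fun hx i hi =>
    h.notMem_part hx i ((m1 i _).1 hi)
  have n2 : ∀ {x}, x ∈ P.Γ → pert W r x ∉ P.I := fun hx hi =>
    hg.notMem_Ω _ hi ((hA.pert_mem_iff hr).2 (h.Γ_subset hx))
  have n3 : ∀ {x}, x ∈ P.I → ∀ i, pert W r x ∉ P.moved W r i := fun hx i hi =>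
    hg.notMem_Ω _ hx (hg.part_subset i ((m1 i _).1 hi))
  refine Setting.kernIs_zero (fun i j hy => ?_) fun i hy => ?_
  · rcases hz with hz | hz | hz
    · exact n1 hz i hy.1
    · exact n1 hz j hy.2
    · exact n3 hz.1 i hy.1
  · rcases hz with hz | hz | hz <;> rcases hy with hy | hy
    · exact n1 hz i hy.1
    · exact n2 hz hy.1
    · exact n2 hz hy.2
    · exact n1 hz i hy.2
    · exact n3 hz.1 i hy.1
    · exact n3 hz.2 i hy.2

theorem Standing.psi_zero (h : P.Standing) (hA : IsAdmissible P.Ω W T) {r : ℝ}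
    (hr : r ∈ Icc 0 T) {z : Euc d × Euc d}
    (hz : z.1 ∈ P.Γ ∨ z.2 ∈ P.Γ ∨ z.1 ∈ P.I ∧ z.2 ∈ P.I) (i : Fin 2) :
    P.PsiT V W r i z = 0 ∧ P.PsiGradT V W r i z = 0 := by
  obtain ⟨k1, k2, k3⟩ := h.kernIs_zero hA hr hz
  simp [PsiT, PsiGradT, Psi, PsiGrad, k1, k2, k3]

/-- The product of the differences of `u` and `v`, off the interface. -/
def diffProd (P : Setting d) (u v : Euc d → ℝ) : Euc d × Euc d → ℝ :=
  ((P.dom \ P.Γ) ×ˢ (P.dom \ P.Γ)).indicator fun z => (v z.1 - v z.2) * (u z.1 - u z.2)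

/-- Γ may have positive measure, and the lower bound on the kernel is not available there. As the
kernels vanish on Γ, the differences may be set to zero. -/
theorem mul_eq_diffProd_mul {u v : Euc d → ℝ} {k : ℝ} {z : Euc d × Euc d}
    (hz : z ∈ P.dom ×ˢ P.dom) (hk : z.1 ∈ P.Γ ∨ z.2 ∈ P.Γ → k = 0) :
    (v z.1 - v z.2) * (u z.1 - u z.2) * k = P.diffProd u v z * k := by
  by_cases h : z.1 ∈ P.Γ ∨ z.2 ∈ P.Γ
  · simp [hk h]
  · push Not at h
    have hm : z ∈ (P.dom \ P.Γ) ×ˢ (P.dom \ P.Γ) := ⟨⟨hz.1, h.1⟩, ⟨hz.2, h.2⟩⟩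
    rw [diffProd, indicator_of_mem hm]

theorem measurable_weight (s : ℝ) : Measurable (weight d s) :=
  (continuous_dist.measurable).pow_const _

theorem ae_weight_pos (hd : 0 < d) (s : ℝ) : ∀ᵐ z, 0 < weight d s z := by
  filter_upwards [ae_fst_ne_snd hd] with z hz
  exact Real.rpow_pos_of_pos (dist_pos.2 hz) _

theorem exists_weight_pert2 {Ω : Set (Euc d)} (hA : IsAdmissible Ω W T) {s : ℝ} (hs : 0 < s) :
    ∃ c : ℝ, 0 < c ∧ ∀ r ∈ Icc 0 T, ∀ z, c * weight d s z ≤ weight d s (pert2 W r z) := by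
  obtain ⟨κ, hκ, h⟩ := hA.dist_pert
  have hp : 0 ≤ (d : ℝ) + 2 * s := by positivity
  refine ⟨κ ^ ((d : ℝ) + 2 * s), Real.rpow_pos_of_pos hκ _, fun r hr z => ?_⟩
  rw [weight, ← Real.mul_rpow hκ.le dist_nonneg]
  exact Real.rpow_le_rpow (by positivity) (h r hr _ _) hp

theorem moved_zero : P.moved W 0 = P.part := by
  funext i
  have : pert W 0 = id := funext fun x => by simp [pert]
  rw [moved, this, image_id]

theorem integrableOn_diff_sq (hg : P.Geometry) {u : Euc d → ℝ}
    (hu : MemLp u 2 (volume.restrict P.dom)) :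
    IntegrableOn (fun z : Euc d × Euc d => (u z.1 - u z.2) ^ 2) (P.dom ×ˢ P.dom) := by
  have := (integral_add_swap (integrableOn_mul_fst hg hu hu)).1
  refine this.congr (ae_of_all _ fun z => ?_)
  simp only [Prod.fst_swap, Prod.snd_swap]; ring

theorem Geometry.ae_eq_zero_of_mem_I (hg : P.Geometry) {u : Euc d → ℝ}
    (hu : ∀ᵐ x ∂(volume.restrict P.I), u x = 0) :
    ∀ᵐ z : Euc d × Euc d, (z.1 ∈ P.I → u z.1 = 0) ∧ (z.2 ∈ P.I → u z.2 = 0) := by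
  rw [ae_restrict_iff' hg.measurableSet_I] at hu
  have h1 : ∀ᵐ z : Euc d × Euc d, z.1 ∈ P.I → u z.1 = 0 :=
    Measure.quasiMeasurePreserving_fst.ae hu
  have h2 : ∀ᵐ z : Euc d × Euc d, z.2 ∈ P.I → u z.2 = 0 :=
    Measure.quasiMeasurePreserving_snd.ae hu
  filter_upwards [h1, h2] with z a b using ⟨a, b⟩

/-- Near the diagonal 1/|x-y|^{d+2s} is at most γ_Γ/γ_*, so the energy dominates. At distance at
least ε the weight is bounded below and u ∈ L² suffices. On I × I the difference vanishes almost
everywhere. -/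
theorem integrableOn_diffProd_self (hg : P.Geometry) {s : ℝ} (hs : 0 < s) (hT : 0 ≤ T)
    (hsym : P.IsSingularSymmetric W T s) {u : Euc d → ℝ} (hu : P.MemVc u) :
    IntegrableOn (fun z => P.diffProd u u z / weight d s z) (P.dom ×ˢ P.dom) := by
  obtain ⟨γlo, γup, ε, hlo, -, hε, -, hbd⟩ := hsym.bounds
  have hsq := integrableOn_diff_sq hg hu.1
  have hdm := hg.measurableSet_dom.prod hg.measurableSet_dom
  have hEm : MeasurableSet ((P.dom \ P.Γ) ×ˢ (P.dom \ P.Γ)) :=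
    (hg.measurableSet_dom.diff measurableSet_Γ).prod (hg.measurableSet_dom.diff measurableSet_Γ)
  have hp : 0 < (d : ℝ) + 2 * s := by positivity
  set p := (d : ℝ) + 2 * s with hpdef
  have hεp : 0 < ε ^ p := Real.rpow_pos_of_pos hε _
  have hm : AEStronglyMeasurable (fun z => P.diffProd u u z / weight d s z)
      (volume.restrict (P.dom ×ˢ P.dom)) := by
    have h1 : AEStronglyMeasurable (fun z : Euc d × Euc d => (u z.1 - u z.2) * (u z.1 - u z.2))
        (volume.restrict (P.dom ×ˢ P.dom)) :=
      hsq.1.congr (ae_of_all _ fun z => by simp only; ring)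
    exact ((h1.indicator hEm).aemeasurable.div (measurable_weight s).aemeasurable).aestronglyMeasurable
  refine ((hu.2.1.abs.const_mul (1 / γlo)).add (hsq.const_mul (1 / ε ^ p))).mono' hm ?_
  rw [ae_restrict_iff' hdm]
  filter_upwards [hg.ae_eq_zero_of_mem_I hu.2.2] with z hz hzd
  simp only [Pi.add_apply]
  have p1 : 0 ≤ 1 / γlo * |nlInt (P.kern P.part) u u z| := by positivity
  have p2 : 0 ≤ 1 / ε ^ p * (u z.1 - u z.2) ^ 2 := by positivity
  have hw := weight_nonneg s z
  by_cases hE : z ∈ (P.dom \ P.Γ) ×ˢ (P.dom \ P.Γ)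
  swap
  · rw [diffProd, indicator_of_notMem hE]; simp only [zero_div, norm_zero]; linarith
  rw [diffProd, indicator_of_mem hE, ← sq, Real.norm_of_nonneg (by positivity)]
  by_cases hI : z.1 ∈ P.I ∧ z.2 ∈ P.I
  · rw [hz.1 hI.1, hz.2 hI.2] at p2 ⊢
    simp only [sub_self, ne_eq, OfNat.ofNat_ne_zero, not_false_eq_true, zero_pow, zero_div]
    simp only [sub_self, ne_eq, OfNat.ofNat_ne_zero, not_false_eq_true, zero_pow] at p2
    linarith
  rcases (dist_nonneg (x := z.1) (y := z.2)).eq_or_lt with h0 | h0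
  · have : z.1 = z.2 := dist_eq_zero.1 h0.symm
    rw [this] at p2 ⊢
    simp only [sub_self, ne_eq, OfNat.ofNat_ne_zero, not_false_eq_true, zero_pow, zero_div]
    simp only [sub_self, ne_eq, OfNat.ofNat_ne_zero, not_false_eq_true, zero_pow] at p2
    linarith
  have hwp : 0 < weight d s z := Real.rpow_pos_of_pos h0 _
  by_cases hd' : dist z.1 z.2 < ε
  · have h1 := hbd z.1 hE.1 z.2 hE.2 hI h0 hd'
    have h2 : γlo ≤ P.kern P.part z * weight d s z := h1
    have hk : P.kern P.part z.swap = P.kern P.part z := by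
      have := hsym.symm 0 ⟨le_rfl, hT⟩ z
      rwa [moved_zero] at this
    have hk0 : 0 < P.kern P.part z := by
      by_contra hn
      have := mul_nonpos_of_nonpos_of_nonneg (not_lt.1 hn) hw
      linarith
    rw [nlInt_of_symm hk, ← sq, abs_of_nonneg (mul_nonneg (sq_nonneg _) hk0.le)]
    have h3 : 1 / weight d s z ≤ 1 / γlo * P.kern P.part z := by
      rw [div_le_iff₀ hwp]
      have : 1 / γlo * γlo ≤ 1 / γlo * (P.kern P.part z * weight d s z) :=
        mul_le_mul_of_nonneg_left h2 (by positivity)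
      rw [one_div_mul_cancel hlo.ne'] at this
      linarith
    have h4 := mul_le_mul_of_nonneg_left h3 (sq_nonneg (u z.1 - u z.2))
    have h5 : (u z.1 - u z.2) ^ 2 / weight d s z = (u z.1 - u z.2) ^ 2 * (1 / weight d s z) := by
      ring
    rw [h5]
    linarith
  · have h1 : ε ^ p ≤ weight d s z := Real.rpow_le_rpow hε.le (not_lt.1 hd') hp.le
    have h2 : (u z.1 - u z.2) ^ 2 / weight d s z ≤ (u z.1 - u z.2) ^ 2 / ε ^ p :=
      div_le_div_of_nonneg_left (sq_nonneg _) hεp h1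
    have h3 : (u z.1 - u z.2) ^ 2 / ε ^ p = 1 / ε ^ p * (u z.1 - u z.2) ^ 2 := by ring
    linarith

theorem aestronglyMeasurable_diffProd (hg : P.Geometry) {u v : Euc d → ℝ}
    (hu : MemLp u 2 (volume.restrict P.dom)) (hv : MemLp v 2 (volume.restrict P.dom)) :
    AEStronglyMeasurable (P.diffProd u v) (volume.restrict (P.dom ×ˢ P.dom)) := by
  have hEm : MeasurableSet ((P.dom \ P.Γ) ×ˢ (P.dom \ P.Γ)) :=
    (hg.measurableSet_dom.diff measurableSet_Γ).prod (hg.measurableSet_dom.diff measurableSet_Γ)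
  have h1 := (integral_add_swap (integrableOn_mul_fst hg hu hv)).1.1
  refine AEStronglyMeasurable.indicator (h1.congr (ae_of_all _ fun z => ?_)) hEm
  simp only [Prod.fst_swap, Prod.snd_swap]; ring

/-- The mixed product is dominated by the sum of the two squares. -/
theorem integrableOn_diffProd (hg : P.Geometry) {s : ℝ} (hs : 0 < s) (hT : 0 ≤ T)
    (hsym : P.IsSingularSymmetric W T s) {u v : Euc d → ℝ} (hu : P.MemVc u) (hv : P.MemVc v) :
    IntegrableOn (fun z => |P.diffProd u v z| / weight d s z) (P.dom ×ˢ P.dom) := by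
  have h1 := integrableOn_diffProd_self hg hs hT hsym hu
  have h2 := integrableOn_diffProd_self hg hs hT hsym hv
  refine (h1.add h2).mono' (((aestronglyMeasurable_diffProd hg hu.1 hv.1).norm.aemeasurable.div
    (measurable_weight s).aemeasurable).aestronglyMeasurable) (ae_of_all _ fun z => ?_)
  have hw := weight_nonneg s z
  rw [Real.norm_of_nonneg (by positivity), Pi.add_apply, ← add_div]
  refine div_le_div_of_nonneg_right ?_ hw
  simp only [diffProd]
  by_cases hE : z ∈ (P.dom \ P.Γ) ×ˢ (P.dom \ P.Γ)
  · simp only [indicator_of_mem hE, abs_mul]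
    nlinarith [sq_nonneg (|v z.1 - v z.2| - |u z.1 - u z.2|), sq_abs (v z.1 - v z.2),
      sq_abs (u z.1 - u z.2), sq_nonneg (v z.1 - v z.2), sq_nonneg (u z.1 - u z.2)]
  · simp [indicator_of_notMem hE]

theorem psiT_swap (hd : 0 < d) {s r : ℝ} (h : P.S1Singular s) (hg : P.Geometry)
    (hA : IsAdmissible P.Ω W T) (hV : IsSmoothField P.Ω V)
    (hsym : P.IsSingularSymmetric W T s) (hr : r ∈ Icc 0 T) (i : Fin 2) :
    ∀ᵐ z, P.PsiT V W r i z.swap = P.PsiT V W r i z := by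
  have e : ∀ z : Euc d × Euc d, pert2 W r z.swap = (pert2 W r z).swap := fun z => rfl
  fin_cases i
  · have h1 := (hA.isQuasiFlow_pair.quasiMeasurePreserving hr).ae
      (kernGrad_swap hd h hg hA hsym hr hV.zero)
    filter_upwards [h1] with z hz
    simp only [PsiT, Psi, e]
    exact hz
  · refine ae_of_all _ fun z => ?_
    simp only [PsiT, Psi, e, hsym.symm r hr, Prod.fst_swap, Prod.snd_swap]
    rw [add_comm]
    rfl

theorem measurableSet_D (hg : P.Geometry) (n : ℕ) : MeasurableSet (P.D n) := by
  have h1 := hg.isOpen_Ω.measurableSet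
  have h2 := hg.measurableSet_I
  have h3 : MeasurableSet {z : Euc d × Euc d | 1 / (n : ℝ) ≤ dist z.1 z.2} :=
    (isClosed_le continuous_const continuous_dist).measurableSet
  exact ((h1.prod h1).union ((h1.prod h2).union (h2.prod h1))).inter h3

theorem D_subset (n : ℕ) : P.D n ⊆ P.dom ×ˢ P.dom := by
  rintro z ⟨h | h | h, -⟩
  · exact ⟨Or.inl h.1, Or.inl h.2⟩
  · exact ⟨Or.inl h.1, Or.inr h.2⟩
  · exact ⟨Or.inr h.1, Or.inl h.2⟩

/-- The sets D_n with n ≥ 1 increase to the domain without I × I and without the diagonal, exactly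
where the integrand is assumed to vanish. -/
theorem tendsto_integral_D (hg : P.Geometry) {f : Euc d × Euc d → ℝ}
    (hf : IntegrableOn f (P.dom ×ˢ P.dom)) (h0 : ∀ z ∈ P.I ×ˢ P.I, f z = 0)
    (h1 : ∀ z : Euc d × Euc d, z.1 = z.2 → f z = 0) :
    Tendsto (fun n => ∫ z in P.D n, f z) atTop (𝓝 (∫ z in P.dom ×ˢ P.dom, f z)) := by
  -- Index 0 is skipped: since 1/0 = 0, `P.D 0` imposes no distance condition, and the sets increase
  -- only from index 1 on.
  rw [← tendsto_add_atTop_iff_nat 1]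
  have hsub : ⋃ n, P.D (n + 1) ⊆ P.dom ×ˢ P.dom := iUnion_subset fun n => D_subset _
  have hmono : Monotone fun n => P.D (n + 1) := fun m n hmn z hz => by
    refine ⟨hz.1, le_trans ?_ hz.2⟩
    have : (m : ℝ) ≤ n := by exact_mod_cast hmn
    push_cast
    gcongr
  have key := tendsto_setIntegral_of_monotone (f := f) (fun n => measurableSet_D hg (n + 1)) hmono
    (hf.mono_set hsub)
  have e : ∫ z in P.dom ×ˢ P.dom, f z = ∫ z in ⋃ n, P.D (n + 1), f z := by
    refine setIntegral_eq_of_subset_of_forall_sdiff_eq_zero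
      (hg.measurableSet_dom.prod hg.measurableSet_dom) hsub fun z hz => ?_
    by_contra hne
    refine hz.2 (mem_iUnion.2 ?_)
    have hd : 0 < dist z.1 z.2 := dist_pos.2 fun h => hne (h1 z h)
    obtain ⟨n, hn⟩ := exists_nat_one_div_lt hd
    refine ⟨n, ?_, by push_cast; exact hn.le⟩
    rcases hz.1.1 with a | a <;> rcases hz.1.2 with b | b
    · exact Or.inl ⟨a, b⟩
    · exact Or.inr (Or.inl ⟨a, b⟩)
    · exact Or.inr (Or.inr ⟨a, b⟩)
    · exact absurd (h0 z ⟨a, b⟩) hne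
  rw [e]
  exact key

/-- The case ρ = |x-y|^{d+2s} with h = `diffProd`. The derivative is an absolutely convergent
integral over the whole domain, so the limits over D_n exist and equal the parts of that integral.
-/
theorem S1Singular.op_hasDerivWithinAt {s : ℝ} (h : P.S1Singular s) (hs : 0 < s) (hd : 0 < d)
    (hP : P.Standing) (hA : IsAdmissible P.Ω W T) (hV : IsSmoothField P.Ω V)
    (hsym : P.IsSingularSymmetric W T s) {u v : Euc d → ℝ}
    (hu : P.MemVc u) (hv : P.MemVc v) {t : ℝ} (ht : t ∈ Icc 0 T) :
    (IntegrableOn (nlInt (P.kern (P.moved W t)) (pull W t u) (pull W t v))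
        ((pert W t '' P.dom) ×ˢ (pert W t '' P.dom)) ∧
      DifferentiableWithinAt ℝ (fun r => P.op W r (pull W r u) (pull W r v)) (Icc 0 T) t) ∧
    (∀ i, IntegrableOn (nlInt (P.Psi (P.moved W t) V i) (pull W t u) (pull W t v))
        ((pert W t '' P.dom) ×ˢ (pert W t '' P.dom))) ∧
    (∀ i, ∀ n : ℕ, 0 < n → IntegrableOn (P.opDotSymm V W t i u v) (P.D n)) ∧
    ∃ L : Fin 2 → ℝ,
      (∀ i, Tendsto (fun n : ℕ => 1 / 2 * ∫ z in P.D n, P.opDotSymm V W t i u v z)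
        atTop (𝓝 (L i))) ∧
      HasDerivWithinAt (fun r => P.opSD V W r (pull W r u) (pull W r v))
        (∑ i, L i) (Icc 0 T) t := by
  have hg := hP.geometry
  have hdm := hg.measurableSet_dom.prod hg.measurableSet_dom
  have key := fun t (ht : t ∈ Icc 0 T) => kern_hasDerivWithinAt hd hg hA hV h.offDiagSobolev
    (h.kernBound hd hg hA hV hsym) (weight_nonneg s) (ae_weight_pos hd s)
    (exists_weight_pert2 hA hs) (aestronglyMeasurable_diffProd hg hu.1 hv.1)
    (integrableOn_diffProd hg hs hA.pos.le hsym hu hv) ht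
  have e1 : ∀ r ∈ Icc 0 T, ∀ᵐ z ∂(volume.restrict (P.dom ×ˢ P.dom)),
      nlInt (fun z => P.kern (P.moved W r) (pert2 W r z)) u v z * jac2 W r z =
        P.diffProd u v z * P.kern (P.moved W r) (pert2 W r z) * jac2 W r z := by
    intro r hr
    filter_upwards [self_mem_ae_restrict hdm] with z hz
    rw [nlInt_of_symm (k := fun z => P.kern (P.moved W r) (pert2 W r z))
      (hsym.symm r hr (pert2 W r z)), mul_eq_diffProd_mul hz fun hΓ =>
        (hP.kernIs_zero hA hr (or_assoc.1 (Or.inl hΓ))).1]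
  have e2 : ∀ i, ∀ r ∈ Icc 0 T, ∀ᵐ z ∂(volume.restrict (P.dom ×ˢ P.dom)),
      nlInt (P.PsiT V W r i) u v z * jac2 W r z =
        P.diffProd u v z * P.PsiT V W r i z * jac2 W r z := by
    intro i r hr
    filter_upwards [self_mem_ae_restrict hdm,
      ae_restrict_of_ae (psiT_swap hd h hg hA hV hsym hr i)] with z hz hsw
    rw [nlInt_of_symm hsw, mul_eq_diffProd_mul hz fun hΓ =>
        (hP.psi_zero hA hr (or_assoc.1 (Or.inl hΓ)) i).1]
  have e3 : ∀ i, ∀ z ∈ P.dom ×ˢ P.dom, P.opDotSymm V W t i u v z =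
      P.diffProd u v z * (P.PsiGradT V W t i z * jac2 W t z + P.PsiT V W t i z * jac2Dot W t z) :=
    fun i z hz => by
      rw [opDotSymm, mul_eq_diffProd_mul hz fun hΓ =>
        (hP.psi_zero hA ht (or_assoc.1 (Or.inl hΓ)) i).2, mul_eq_diffProd_mul hz fun hΓ =>
        (hP.psi_zero hA ht (or_assoc.1 (Or.inl hΓ)) i).1]
      ring
  obtain ⟨⟨k1, k2⟩, k3⟩ := key t ht
  have hI : ∀ i, IntegrableOn (P.opDotSymm V W t i u v) (P.dom ×ˢ P.dom) := fun i =>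
    (integrableOn_congr_fun (e3 i) hdm).2 (k3 i).2.1
  refine ⟨⟨?_, ?_⟩, fun i => ?_, fun i n _ => (hI i).mono_set (D_subset n),
    fun i => 1 / 2 * ∫ z in P.dom ×ˢ P.dom, P.opDotSymm V W t i u v z, fun i => ?_, ?_⟩
  · rw [hA.integrableOn_image_prod ht hg.measurableSet_dom]
    simp only [nlInt_pull hA ht]
    exact k1.congr ((e1 t ht).mono fun z hz => hz.symm)
  · have e4 : ∀ r ∈ Icc 0 T, P.op W r (pull W r u) (pull W r v) = 1 / 2 *
        ∫ z in P.dom ×ˢ P.dom, P.diffProd u v z * P.kern (P.moved W r) (pert2 W r z) *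
          jac2 W r z := fun r hr => by
      rw [op_eq hg hA hr, integral_congr_ae (e1 r hr)]
    exact (k2.const_mul (1 / 2)).congr e4 (e4 t ht)
  · rw [hA.integrableOn_image_prod ht hg.measurableSet_dom]
    simp only [nlInt_pull hA ht]
    exact (k3 i).1.congr ((e2 i t ht).mono fun z hz => hz.symm)
  · refine (tendsto_integral_D hg (hI i) (fun z hz => ?_) fun z hz => ?_).const_mul _
    · obtain ⟨a, b⟩ := hP.psi_zero (V := V) hA ht (Or.inr (Or.inr hz)) i
      rw [opDotSymm, a, b]; ring
    · rw [opDotSymm, hz]; ring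
  · have hsum := HasDerivWithinAt.fun_sum (u := Finset.univ) fun i (_ : i ∈ Finset.univ) =>
      (k3 i).2.2.const_mul (1 / 2)
    have e5 : ∀ r ∈ Icc 0 T, P.opSD V W r (pull W r u) (pull W r v) = ∑ i : Fin 2, 1 / 2 *
        ∫ z in P.dom ×ˢ P.dom, P.diffProd u v z * P.PsiT V W r i z * jac2 W r z :=
      fun r hr => by
        rw [opSD_eq hg hA hr]
        exact Finset.sum_congr rfl fun i _ => by rw [integral_congr_ae (e2 i r hr)]
    refine (hsum.congr e5 (e5 t ht)).congr_deriv (Finset.sum_congr rfl fun i _ => ?_)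
    exact congrArg (1 / 2 * ·) (setIntegral_congr_fun hdm (e3 i)).symm

end Setting

end NonlocalShape
end

/-! ### Assembly of the theorem. -/

theorem mainTheorem4 (d : ℕ) (hd : d = 2 ∨ d = 3) (P : NonlocalShape.Setting d) (hP : P.Standing)
    (V W : NonlocalShape.Euc d → NonlocalShape.Euc d)
    (hV : NonlocalShape.IsC0Field 2 P.Ω V) (hW : NonlocalShape.IsC0Field 2 P.Ω W)
    (T : ℝ) (hT : 0 < T) (hTW : ∀ x, T * ‖fderiv ℝ W x‖ < 1)
    (hS1 : P.S1Integrable ∨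
      ∃ s ∈ Set.Ioo (0 : ℝ) 1, P.IsSingularSymmetric W T s ∧ P.S1Singular s)
    (u v ψ φ : NonlocalShape.Euc d → ℝ)
    (hu : P.MemVc u) (hv : P.MemVc v) (hψ : P.MemVc ψ) (hφ : P.MemVc φ) :
    -- all integrals are well defined
    (∀ t ∈ Set.Icc (0 : ℝ) T, P.LagrIntegrable V W t
      (NonlocalShape.pull W t u) (NonlocalShape.pull W t v)
      (NonlocalShape.pull W t ψ) (NonlocalShape.pull W t φ)) ∧
    -- (D1)
    DifferentiableOn ℝ (fun t => P.G V W t u v ψ φ) (Set.Icc 0 T) ∧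
    -- differentiability of the bilinear form and of the linear functional
    DifferentiableOn ℝ
      (fun t => P.op W t (NonlocalShape.pull W t u) (NonlocalShape.pull W t ψ)) (Set.Icc 0 T) ∧
    DifferentiableOn ℝ
      (fun t => P.op W t (NonlocalShape.pull W t φ) (NonlocalShape.pull W t v)) (Set.Icc 0 T) ∧
    DifferentiableOn ℝ (fun t => P.linF W t (NonlocalShape.pull W t ψ)) (Set.Icc 0 T) ∧
    -- the formulas
    ∀ t ∈ Set.Icc (0 : ℝ) T,
      (MeasureTheory.IntegrableOn (P.adjDot W t u φ) P.Ω ∧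
        HasDerivWithinAt
          (fun r => P.adjF W r (NonlocalShape.pull W r u) (NonlocalShape.pull W r φ))
          (∫ x in P.Ω, P.adjDot W t u φ x) (Set.Icc 0 T) t) ∧
      (MeasureTheory.IntegrableOn (P.objDot V W t u) P.Ω ∧
        HasDerivWithinAt (fun r => P.objSD V W r (NonlocalShape.pull W r u))
          (∫ x in P.Ω, P.objDot V W t u x) (Set.Icc 0 T) t) ∧
      (MeasureTheory.IntegrableOn (P.forDot V W t v) P.Ω ∧
        HasDerivWithinAt (fun r => P.forSD V W r (NonlocalShape.pull W r v))
          (∫ x in P.Ω, P.forDot V W t v x) (Set.Icc 0 T) t) ∧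
      -- integrable kernels
      (P.S1Integrable →
        (∀ i, MeasureTheory.IntegrableOn (P.opDot V W t i u v) (P.dom ×ˢ P.dom)) ∧
        HasDerivWithinAt
          (fun r => P.opSD V W r (NonlocalShape.pull W r u) (NonlocalShape.pull W r v))
          (∑ i : Fin 2, 1 / 2 * ∫ z in P.dom ×ˢ P.dom, P.opDot V W t i u v z)
          (Set.Icc 0 T) t) ∧
      -- singular symmetric kernels
      ((∃ s ∈ Set.Ioo (0 : ℝ) 1, P.IsSingularSymmetric W T s ∧ P.S1Singular s) →
        (∀ i, ∀ n : ℕ, 0 < n → MeasureTheory.IntegrableOn (P.opDotSymm V W t i u v) (P.D n)) ∧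
        ∃ L : Fin 2 → ℝ,
          (∀ i, Filter.Tendsto (fun n : ℕ => 1 / 2 * ∫ z in P.D n, P.opDotSymm V W t i u v z)
            Filter.atTop (nhds (L i))) ∧
          HasDerivWithinAt
            (fun r => P.opSD V W r (NonlocalShape.pull W r u) (NonlocalShape.pull W r v))
            (∑ i, L i) (Set.Icc 0 T) t) := by
  have hd0 : 0 < d := by omega
  have hg := hP.geometry
  have hA := hW.isAdmissible hP.isOpen_Ω hP.isBounded_Ω hT hTW
  have hVs := hV.isSmoothField hP.isOpen_Ω
  have hp := fun i => (hP.isOpen_part i).measurableSet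
  have hr : ∀ {w : NonlocalShape.Euc d → ℝ}, P.MemVc w →
      MeasureTheory.MemLp w 2 (MeasureTheory.volume.restrict P.Ω) := fun hw =>
    hw.1.mono_measure (MeasureTheory.Measure.restrict_mono Set.subset_union_left le_rfl)
  have kadj := fun t (ht : t ∈ Set.Icc 0 T) => NonlocalShape.Setting.adjF_hasDerivWithinAt hA
    hP.ubar_sobolev (hr hu) (hr hφ) ht
  have kobj := fun t (ht : t ∈ Set.Icc 0 T) => NonlocalShape.Setting.objSD_hasDerivWithinAt hA hVs
    hP.ubar_sobolev (hr hu) ht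
  have kfor := fun t (ht : t ∈ Set.Icc 0 T) => NonlocalShape.Setting.forSD_hasDerivWithinAt hA hVs
    hp hP.f_sobolev (hr hv) ht
  have klin := fun t (ht : t ∈ Set.Icc 0 T) => NonlocalShape.Setting.forSD_hasDerivWithinAt hA hVs
    hp hP.f_sobolev (hr hψ) ht
  -- For (D1) only what both kernel classes share is needed. The two derivative formulas are
  -- obtained separately at the end, each from its own hypothesis and not from the alternative that
  -- happens to hold.
  have kop : ∀ {a b : NonlocalShape.Euc d → ℝ}, P.MemVc a → P.MemVc b → ∀ t ∈ Set.Icc 0 T,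
      (MeasureTheory.IntegrableOn (NonlocalShape.Setting.nlInt (P.kern (P.moved W t))
          (NonlocalShape.pull W t a) (NonlocalShape.pull W t b))
        ((NonlocalShape.pert W t '' P.dom) ×ˢ (NonlocalShape.pert W t '' P.dom)) ∧
      DifferentiableWithinAt ℝ (fun r => P.op W r (NonlocalShape.pull W r a)
        (NonlocalShape.pull W r b)) (Set.Icc 0 T) t) ∧
      (∀ i, MeasureTheory.IntegrableOn (NonlocalShape.Setting.nlInt (P.Psi (P.moved W t) V i)
          (NonlocalShape.pull W t a) (NonlocalShape.pull W t b))
        ((NonlocalShape.pert W t '' P.dom) ×ˢ (NonlocalShape.pert W t '' P.dom))) ∧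
      DifferentiableWithinAt ℝ (fun r => P.opSD V W r (NonlocalShape.pull W r a)
        (NonlocalShape.pull W r b)) (Set.Icc 0 T) t := by
    intro a b ha hb t ht
    rcases hS1 with h | ⟨s, hs, hsym, h⟩
    · obtain ⟨h1, h2, -, h3⟩ := h.op_hasDerivWithinAt hd0 hg hA hVs ha.1 hb.1 ht
      exact ⟨h1, h2, h3.differentiableWithinAt⟩
    · obtain ⟨h1, h2, -, L, -, h3⟩ := h.op_hasDerivWithinAt hs.1 hd0 hP hA hVs hsym ha hb ht
      exact ⟨h1, h2, h3.differentiableWithinAt⟩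
  refine ⟨fun t ht => ⟨(kobj t ht).1, (kfor t ht).1.1, (kop hu hv t ht).2.1, (kop hu hψ t ht).1.1,
    (klin t ht).2.1, (kop hφ hv t ht).1.1, (kadj t ht).1⟩, fun t ht => ?_,
    fun t ht => (kop hu hψ t ht).1.2, fun t ht => (kop hφ hv t ht).1.2,
    fun t ht => (klin t ht).2.2, fun t ht => ⟨(kadj t ht).2, (kobj t ht).2, (kfor t ht).1.2,
      fun h => (h.op_hasDerivWithinAt hd0 hg hA hVs hu.1 hv.1 ht).2.2, ?_⟩⟩
  · exact ((((((kobj t ht).2.2.differentiableWithinAt.sub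
      (kfor t ht).1.2.2.differentiableWithinAt).add (kop hu hv t ht).2.2).add
      (kop hu hψ t ht).1.2).sub (klin t ht).2.2).add (kop hφ hv t ht).1.2).sub
      (kadj t ht).2.2.differentiableWithinAt
  · rintro ⟨s, hs, hsym, h⟩
    exact (h.op_hasDerivWithinAt hs.1 hd0 hP hA hVs hsym hu hv ht).2.2
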